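/- **Theorem 3.1 (Replacement principle, real case).** *Conventions.* A random polynomial of degree at most $n$ with real coefficients is a random variable $f$ with values in the real polynomials of degree at most $n$ (no assumption is made on the joint law of its coefficients). Zeros are counted with multiplicity; the zero polynomial has no zeros in $\mathbb C$. $N_\Omega(f)$ is the number of zeros of $f$ in $\Omega\subset\mathbb C$, $B(z,r)$ is the open disk of radius $r$ around $z$ in $\mathbb C$, $\mathbb C_\pm=\{z:\pm\operatorname{Im}z>0\}$, and $dz$ is Lebesgue measure on $\mathbb C$. $|\nabla^aG|$ is the Euclidean norm of the tensor of all $a$-th order partial derivatives of $G$ in the underlying real coordinates. The mixed $(k,l)$-correlation function $\rho_f^{(k,l)}$ is defined on $\mathbb R^k\times\mathbb C_+^l$ by $$\mathbb E\sum_{i_1,\dots,i_k\text{ distinct}}\ \sum_{j_1,\dots,j_l\text{ distinct}}\varphi(\zeta_{i_1,\mathbb R},\dots,\zeta_{i_k,\mathbb R},\zeta_{j_1,\mathbb C_+},\dots,\zeta_{j_l,\mathbb C_+})=\int_{\mathbb R^k}\int_{\mathbb C_+^l}\varphi(x,z)\,\rho_f^{(k,l)}(x,z)\,dz\,dx$$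 for all continuous compactly supported $\varphi:\mathbb R^k\times\mathbb C^l\to\mathbb C$, where $(\zeta_{i,\mathbb R})$ and $(\zeta_{j,\mathbb C_+})$ enumerate, with multiplicity, the zeros of $f$ in $\mathbb R$ and in $\mathbb C_+$; it is extended to $\mathbb R^k\times(\mathbb C_+\cup\mathbb C_-)^l$ so as to be symmetric under conjugation of any of the last $l$ variables. In general $\rho_f^{(k,l)}$ is a measure, and the integrals below are integrals against it. *Statement.* Let $C,r_0\ge1\ge c_0>0$ be real, let $a_0\ge1$ and $k,l\ge0$ be integers with $k+l>0$, and set $A:=\frac{200(k+l)^2(a_0+2)}{c_0}$. There is a constant $\tilde C$ depending only on $C,r_0,c_0,k,l,a_0$ such that the following holds. Let $n\ge1$, let $f,\tilde f$ be random polynomials of degree at most $n$ with real coefficients, let $x_1,\dots,x_k\in\mathbb R$ and $z_1,\dots,z_l\in\mathbb C$, and put $U:=\bigcup_{i=1}^kB(x_i,100r_0)\cup\bigcup_{j=1}^lB(z_j,100r_0)$. Assume: (i) (Non-degeneracy) $f$ is not identically zero with probability at least $1-Cn^{-A}$, and similarly for $\tilde f$. (ii) (Non-clustering) For every $r\ge1$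 and every $w\in\{x_1,\dots,x_k,z_1,\dots,z_l\}$, one has $N_{B(w,r)}(f)\le Cn^{1/A}r^2$ with probability at least $1-Cn^{-A}$, and similarly for $\tilde f$. (iii) (Comparability of log-magnitudes) For every integer $1\le k'\le n^{c_0}$, all $z_1',\dots,z_{k'}'\in U$ and every smooth $F:\mathbb C^{k'}\to\mathbb C$ with $|\nabla^aF(w)|\le n^{c_0}$ for all $0\le a\le a_0$ and $w\in\mathbb C^{k'}$, $$\Big|\mathbb E\,F(\log|f(z_1')|,\dots,\log|f(z_{k'}')|)-\mathbb E\,F(\log|\tilde f(z_1')|,\dots,\log|\tilde f(z_{k'}')|)\Big|\le Cn^{-c_0},$$ where $F$ is taken to be $0$ when one of its arguments is undefined. (iv) (Weak level repulsion, for $\tilde f$ only) On the set of pairs of real $x,y\in U$ with $|x-y|\le1/C$, $\rho^{(2,0)}_{\tilde f}$ is a function with $\rho^{(2,0)}_{\tilde f}(x,y)\le C$; and on the set of $z\in U$ with $|\operatorname{Im}z|\le1/C$, $\rho^{(0,1)}_{\tilde f}$ is a function with $\rho^{(0,1)}_{\tilde f}(z)\le C$. Let $M>0$ and let $G:\mathbb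 R^k\times\mathbb C^l\to\mathbb C$ be a smooth function supported on $[-r_0,r_0]^k\times B(0,r_0)^l$ with $|\nabla^aG(w)|\le M$ for all $0\le a\le a_0+2(k+l)+1$ and all $w\in\mathbb R^k\times\mathbb C^l$. Then $$\Big|\int_{\mathbb R^k}\int_{\mathbb C^l}G(y,w)\,\rho^{(k,l)}_f(x_1+y_1,\dots,x_k+y_k,z_1+w_1,\dots,z_l+w_l)\,dw\,dy-\int_{\mathbb R^k}\int_{\mathbb C^l}G(y,w)\,\rho^{(k,l)}_{\tilde f}(x_1+y_1,\dots,x_k+y_k,z_1+w_1,\dots,z_l+w_l)\,dw\,dy\Big|\le\tilde C\,M\,n^{-\frac{c_0}{200(a_0+2)(k+l)}}.$$ -/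

import Mathlib

open MeasureTheory

open scoped ENNReal ContDiff Polynomial

noncomputable section

namespace RandomZeros

/-- The Euclidean (Hilbert-Schmidt) norm `|∇^a F (w)|` of the tensor of all `a`-th order partial
derivatives of `F` at `w`, taken with respect to the coordinates given by the basis `b`. -/
def gradNorm {ι V : Type*} [Fintype ι] [NormedAddCommGroup V] [NormedSpace ℝ V]
    (b : Module.Basis ι ℝ V) (a : ℕ) (F : V → ℂ) (w : V) : ℝ :=
  Real.sqrt (∑ i : Fin a → ι, ‖iteratedFDeriv ℝ a F w (fun j => b (i j))‖ ^ 2)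

/-- The standard real coordinates `Re w_1, Im w_1, ..., Re w_m, Im w_m` on `ℂ^m`. -/
def complexBasis (m : ℕ) : Module.Basis (Σ _ : Fin m, Fin 2) ℝ (Fin m → ℂ) :=
  Pi.basis fun _ => Complex.basisOneI

/-- The standard real coordinates on `ℝ^k × ℂ^l`. -/
def mixedBasis (k l : ℕ) :
    Module.Basis (Fin k ⊕ (Σ _ : Fin l, Fin 2)) ℝ ((Fin k → ℝ) × (Fin l → ℂ)) :=
  (Pi.basisFun ℝ (Fin k)).prod (complexBasis l)

/-- `f` is a random polynomial of degree at most `n` with real coefficients: a random variable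
with values in the real polynomials of degree at most `n`. Nothing is assumed on the joint law of
the coefficients. -/
structure IsRandomPoly {Ω : Type*} [MeasurableSpace Ω] (n : ℕ) (f : Ω → ℝ[X]) : Prop where
  measurable_coeff : ∀ i : ℕ, Measurable fun η => (f η).coeff i
  natDegree_le : ∀ η, (f η).natDegree ≤ n

/-- The zeros of `p` in the open upper half-plane, with multiplicity (none if `p = 0`). -/
def upperZeros (p : ℝ[X]) : Multiset ℂ :=
  open Classical in (p.aroots ℂ).filter fun z => 0 < z.im

/-- The number `N_{B(z,r)}(p)` of complex zeros of `p` in the open disk `B(z,r)`, counted with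
multiplicity (zero if `p = 0`). -/
def zeroCount (p : ℝ[X]) (z : ℂ) (r : ℝ) : ℕ :=
  open Classical in (p.aroots ℂ).countP fun ζ => ζ ∈ Metric.ball z r

/-- Conjugate exactly those coordinates `w j` with `σ j = true`. -/
def conjCoords {l : ℕ} (σ : Fin l → Bool) (w : Fin l → ℂ) : Fin l → ℂ :=
  fun j => bif σ j then (starRingEnd ℂ) (w j) else w j

/-- The counting measure on `ℝ^k × (ℂ_+ ∪ ℂ_-)^l` of the ordered `(k+l)`-tuples of `k` real zeros
and `l` zeros in the upper half-plane of a fixed polynomial `p` (indices distinct, zeros repeated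
according to multiplicity), extended to be symmetric under conjugation of any of the last `l`
coordinates. The type attached to a multiset is an index set enumerating it with multiplicity. -/
def zeroTuples (k l : ℕ) (p : ℝ[X]) : Measure ((Fin k → ℝ) × (Fin l → ℂ)) :=
  open Classical in
  ∑ i : Fin k ↪ p.roots, ∑ j : Fin l ↪ upperZeros p, ∑ σ : Fin l → Bool,
    Measure.dirac (fun s => (i s).1, conjCoords σ fun t => (j t).1)

/-- The mixed `(k,l)`-correlation measure `ρ^{(k,l)}_f` of the zeros of a random polynomial `f`:
the expectation of the random measure `zeroTuples k l (f η)`. When it has a density, the density is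
the mixed `(k,l)`-correlation function. -/
def mixedCorr {Ω : Type*} [MeasurableSpace Ω] (P : Measure Ω) (f : Ω → ℝ[X]) (k l : ℕ) :
    Measure ((Fin k → ℝ) × (Fin l → ℂ)) :=
  P.bind fun η => zeroTuples k l (f η)

/-- On the set `S`, the measure `μ` is given by a density (with respect to Lebesgue measure) that
is bounded by `C` at every point of `S`. -/
def HasDensityLEOn {E : Type*} [MeasureSpace E] (μ : Measure E) (S : Set E) (C : ℝ) : Prop :=
  ∃ ρ : E → ℝ≥0∞, Measurable ρ ∧ μ.restrict S = (volume.restrict S).withDensity ρ ∧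
    ∀ q ∈ S, ρ q ≤ ENNReal.ofReal C

/-- The union of the open disks of radius `R` in `ℂ` around the points `x_i` and `z_j`. -/
def region {k l : ℕ} (x : Fin k → ℝ) (z : Fin l → ℂ) (R : ℝ) : Set ℂ :=
  (⋃ i, Metric.ball (x i : ℂ) R) ∪ ⋃ j, Metric.ball (z j) R

/-- Non-degeneracy: `f` is not identically zero with probability at least `1 - C n^{-A}`. -/
def NonDegenerate {Ω : Type*} [MeasurableSpace Ω] (P : Measure Ω) (f : Ω → ℝ[X])
    (n : ℕ) (C A : ℝ) : Prop :=
  1 - C * (n : ℝ) ^ (-A) ≤ P.real {η | f η ≠ 0}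

/-- Non-clustering around the point `z`: for each `r ≥ 1`, the disk `B(z,r)` has at most
`C n^{1/A} r^2` zeros with probability at least `1 - C n^{-A}`. -/
def NonClusteringAt {Ω : Type*} [MeasurableSpace Ω] (P : Measure Ω) (f : Ω → ℝ[X])
    (n : ℕ) (C A : ℝ) (z : ℂ) : Prop :=
  ∀ r : ℝ, 1 ≤ r → 1 - C * (n : ℝ) ^ (-A) ≤
    P.real {η | (zeroCount (f η) z r : ℝ) ≤ C * (n : ℝ) ^ (1 / A) * r ^ 2}

/-- The value `F (log |p(u_1)|, ..., log |p(u_m)|)`, which is zero by convention when one of the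
logarithms is undefined. -/
def logStat {m : ℕ} (F : (Fin m → ℂ) → ℂ) (u : Fin m → ℂ) (p : ℝ[X]) : ℂ :=
  open Classical in
  if ∀ s, p.aeval (u s) ≠ 0 then F fun s => (Real.log ‖p.aeval (u s)‖ : ℂ) else 0

/-- Comparability of the log-magnitudes of `f` and `f'` on the set `U`. -/
def LogComparable {Ω Ω' : Type*} [MeasurableSpace Ω] [MeasurableSpace Ω']
    (P : Measure Ω) (P' : Measure Ω') (f : Ω → ℝ[X]) (f' : Ω' → ℝ[X])
    (n : ℕ) (C c₀ : ℝ) (a₀ : ℕ) (U : Set ℂ) : Prop :=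
  ∀ m : ℕ, 1 ≤ m → (m : ℝ) ≤ (n : ℝ) ^ c₀ →
    ∀ u : Fin m → ℂ, (∀ s, u s ∈ U) →
      ∀ F : (Fin m → ℂ) → ℂ, ContDiff ℝ ∞ F →
        (∀ a ≤ a₀, ∀ w, gradNorm (complexBasis m) a F w ≤ (n : ℝ) ^ c₀) →
          ‖(∫ η, logStat F u (f η) ∂P) - ∫ η, logStat F u (f' η) ∂P'‖ ≤ C * (n : ℝ) ^ (-c₀)

/-- Weak level repulsion on the set `U`: `ρ^{(2,0)}(x,y) ≤ C` for real `x, y` in `U` with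
`|x - y| ≤ 1/C`, and `ρ^{(0,1)}(z) ≤ C` for `z` in `U` with `|Im z| ≤ 1/C`. -/
def WeakLevelRepulsion {Ω : Type*} [MeasurableSpace Ω] (P : Measure Ω) (f : Ω → ℝ[X])
    (C : ℝ) (U : Set ℂ) : Prop :=
  HasDensityLEOn (mixedCorr P f 2 0)
      {q | (q.1 0 : ℂ) ∈ U ∧ (q.1 1 : ℂ) ∈ U ∧ |q.1 0 - q.1 1| ≤ 1 / C} C ∧
    HasDensityLEOn (mixedCorr P f 0 1) {q | q.2 0 ∈ U ∧ |(q.2 0).im| ≤ 1 / C} C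

end RandomZeros

end

open RandomZeros

/-!
# Replacement of random polynomials with comparable log-magnitudes

**From zeros to log-magnitudes.** By Green's formula (`integral_log_smul_lapAlong`), the sum of a
smooth compactly supported function over the zeros of `p` is, up to a constant factor, the integral
of `log |p|` against its Laplacian. Iterating over `m` variables turns a sum over all `m`-tuples of
zeros into a multilinear integral of `log |p|`. The logarithm is unbounded, and its size depends on
the leading coefficient; it is therefore replaced by its interpolation defect, the difference with
the affine interpolant at three nearby points. The Laplacian does not see affine functions, so the
formula persists (`integral_prod_polyDefect_smul_iterLap`), whereas the defect of the logarithm of a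
linear factor decays quadratically in the distance to its zero. Hence the moments of the defect of
`log |p|` are controlled by `zeroWeight p`, a weighted count of the zeros, which non-clustering at
dyadic scales bounds with high probability (`NonClusteringAt.measureReal_zeroWeight`).

**Comparison of smooth statistics.** Let `A = 200 K² (a₀ + 2) / c₀` with `K = k + l`, and measure
everything in powers of `N = n ^ (1 / A)`. After truncation of the defects at a power of `N`, the
integrand is, for each choice of the points, an admissible test function of the log-magnitudes at
`4 m` points, so comparability of log-magnitudes applies. The result is that smooth statistics of
`m ≤ K + 1` zeros differ by at most order `N ^ (-34 K²)`, which leaves room for test functions whose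
derivatives grow like powers of `N`.

**Repulsion from the real axis.** Weak level repulsion bounds the expected number of close pairs of
zeros of `f'` near a real point. Close pairs are dominated by a smooth statistic, so the bound
passes to `f`. A nonreal zero near the real axis forms a close pair with its conjugate; a union bound over
a grid shows that for both polynomials a strip of width about `N ^ (-5 K)` contains a nonreal zero
with probability at most of order `N ^ (-3 K)` (`exists_measureReal_hasStripZero_le`).

**Correlation measures.** A sum over distinct real zeros and distinct zeros in the upper half-plane
is a combination of sums over all tuples, one for each pattern of coincidences
(`exists_sum_embedding_eq`). Off the strip event, the indicators of the real axis and of the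
half-planes may be replaced by smooth cutoffs at the scale of the strip (`testFun`,
`ite_isType_eq_testFun`). The resulting smooth statistics are comparable, and the strip event costs
its probability times a power of the number of zeros. The total error is of order `N ^ (-K)`, which
is `n ^ (-c₀ / (200 (a₀ + 2) (k + l)))` (`exists_norm_integral_mixedCorr_sub_le`).
-/

open RandomZeros

noncomputable section

/-! ### Directional derivatives and iterated Laplacians -/

section Calculus

variable {V W : Type*} [NormedAddCommGroup V] [NormedSpace ℝ V]
  [NormedAddCommGroup W] [NormedSpace ℝ W]

/-- The derivative of `g` in the fixed direction `v`. -/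
def dirDeriv (v : V) (g : V → ℂ) : V → ℂ := fun x => fderiv ℝ g x v

/-- The Laplacian of `g` along the plane spanned by `u` and `v`, that is `∂_u² g + ∂_v² g`. -/
def lapAlong (u v : V) (g : V → ℂ) : V → ℂ :=
  fun x => dirDeriv u (dirDeriv u g) x + dirDeriv v (dirDeriv v g) x

/-- All derivatives of `g` of order at most `n` have operator norm at most `B` everywhere. -/
def DerivLE (n : ℕ) (B : ℝ) (g : V → ℂ) : Prop :=
  ∀ i ≤ n, ∀ x, ‖iteratedFDeriv ℝ i g x‖ ≤ B

lemma ContDiff.dirDeriv {g : V → ℂ} (hg : ContDiff ℝ ∞ g) (v : V) :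
    ContDiff ℝ ∞ (dirDeriv v g) := by
  have h : ContDiff ℝ ∞ (fderiv ℝ g) := hg.fderiv_right (by simp)
  exact h.clm_apply contDiff_const

lemma ContDiff.lapAlong {g : V → ℂ} (hg : ContDiff ℝ ∞ g) (u v : V) :
    ContDiff ℝ ∞ (lapAlong u v g) :=
  ((hg.dirDeriv u).dirDeriv u).add ((hg.dirDeriv v).dirDeriv v)

lemma tsupport_dirDeriv_subset (v : V) (g : V → ℂ) : tsupport (dirDeriv v g) ⊆ tsupport g := by
  refine closure_minimal (fun x hx => ?_) (isClosed_tsupport g)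
  refine support_fderiv_subset ℝ (f := g) ?_
  intro h
  apply hx
  simp [dirDeriv, h]

lemma tsupport_lapAlong_subset (u v : V) (g : V → ℂ) : tsupport (lapAlong u v g) ⊆ tsupport g :=
  (tsupport_add _ _).trans (Set.union_subset
    ((tsupport_dirDeriv_subset _ _).trans (tsupport_dirDeriv_subset _ _))
    ((tsupport_dirDeriv_subset _ _).trans (tsupport_dirDeriv_subset _ _)))

lemma DerivLE.dirDeriv {g : V → ℂ} (hg : ContDiff ℝ ∞ g) {n : ℕ} {B : ℝ}
    (h : DerivLE (n + 1) B g) {v : V} (hv : ‖v‖ ≤ 1) : DerivLE n B (dirDeriv v g) := by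
  intro i hi x
  have h1 : ContDiff ℝ ∞ (fderiv ℝ g) := hg.fderiv_right (by simp)
  have h2 := norm_iteratedFDeriv_clm_apply_const (c := v) (n := i) (N := ∞)
    (h1.contDiffAt (x := x)) (by exact_mod_cast le_top)
  rw [norm_iteratedFDeriv_fderiv] at h2
  have h3 := h (i + 1) (by omega) x
  calc _ ≤ _ := h2
    _ ≤ 1 * B := by gcongr
    _ = B := one_mul B

lemma DerivLE.lapAlong {g : V → ℂ} (hg : ContDiff ℝ ∞ g) {n : ℕ} {B : ℝ}
    (h : DerivLE (n + 2) B g) {u v : V} (hu : ‖u‖ ≤ 1) (hv : ‖v‖ ≤ 1) :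
    DerivLE n (2 * B) (lapAlong u v g) := by
  have h1 : DerivLE n B (_root_.dirDeriv u (_root_.dirDeriv u g)) :=
    (h.dirDeriv hg hu).dirDeriv (hg.dirDeriv u) hu
  have h2 : DerivLE n B (_root_.dirDeriv v (_root_.dirDeriv v g)) :=
    (h.dirDeriv hg hv).dirDeriv (hg.dirDeriv v) hv
  intro i hi x
  have h3 : iteratedFDeriv ℝ i (_root_.lapAlong u v g) x =
      iteratedFDeriv ℝ i (_root_.dirDeriv u (_root_.dirDeriv u g)) x +
      iteratedFDeriv ℝ i (_root_.dirDeriv v (_root_.dirDeriv v g)) x := by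
    refine iteratedFDeriv_add_apply (𝕜 := ℝ) (i := i) (f := _root_.dirDeriv u (_root_.dirDeriv u g))
      (g := _root_.dirDeriv v (_root_.dirDeriv v g)) ?_ ?_
    · exact (((hg.dirDeriv u).dirDeriv u).of_le (by exact_mod_cast le_top)).contDiffAt
    · exact (((hg.dirDeriv v).dirDeriv v).of_le (by exact_mod_cast le_top)).contDiffAt
  rw [h3, two_mul]
  exact (norm_add_le _ _).trans (add_le_add (h1 i hi x) (h2 i hi x))

lemma dirDeriv_comp_affine {g : V → ℂ} (hg : ContDiff ℝ ∞ g) {φ : W → V} {L : W →L[ℝ] V}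
    (hφ : ∀ x, HasFDerivAt φ L x) (w : W) (x : W) :
    dirDeriv w (fun y => g (φ y)) x = dirDeriv (L w) g (φ x) := by
  have h1 : HasFDerivAt g (fderiv ℝ g (φ x)) (φ x) :=
    (hg.differentiable (by simp) (φ x)).hasFDerivAt
  have h2 := h1.comp x (hφ x)
  have h3 : fderiv ℝ (fun y => g (φ y)) x = (fderiv ℝ g (φ x)).comp L := h2.fderiv
  simp [dirDeriv, h3]

lemma lapAlong_comp_affine {g : V → ℂ} (hg : ContDiff ℝ ∞ g) {φ : W → V} {L : W →L[ℝ] V}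
    (hφ : ∀ x, HasFDerivAt φ L x) (u v : W) (x : W) :
    lapAlong u v (fun y => g (φ y)) x = lapAlong (L u) (L v) g (φ x) := by
  have h (w : W) : dirDeriv w (dirDeriv w (fun y => g (φ y))) x
      = dirDeriv (L w) (dirDeriv (L w) g) (φ x) := by
    have : dirDeriv w (fun y => g (φ y)) = fun y => dirDeriv (L w) g (φ y) :=
      funext fun y => dirDeriv_comp_affine hg hφ w y
    rw [this]
    exact dirDeriv_comp_affine (hg.dirDeriv _) hφ w x
  simp [lapAlong, h]

/-- The Laplacians in the complex coordinates listed in `L`, applied one after the other. -/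
def lapList {m : ℕ} (L : List (Fin m)) (g : (Fin m → ℂ) → ℂ) : (Fin m → ℂ) → ℂ :=
  L.foldl (fun g j => lapAlong (Pi.single j 1) (Pi.single j Complex.I) g) g

/-- The product of the Laplacians in all complex coordinates, a differential operator of
order `2m`. -/
def iterLap {m : ℕ} (g : (Fin m → ℂ) → ℂ) : (Fin m → ℂ) → ℂ := lapList (List.finRange m) g

lemma ContDiff.lapList {m : ℕ} (L : List (Fin m)) {g : (Fin m → ℂ) → ℂ} (hg : ContDiff ℝ ∞ g) :
    ContDiff ℝ ∞ (lapList L g) := by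
  induction L generalizing g with
  | nil => exact hg
  | cons j L ih => exact ih (hg.lapAlong _ _)

lemma tsupport_lapList_subset {m : ℕ} (L : List (Fin m)) (g : (Fin m → ℂ) → ℂ) :
    tsupport (lapList L g) ⊆ tsupport g := by
  induction L generalizing g with
  | nil => exact subset_rfl
  | cons j L ih => exact (ih _).trans (tsupport_lapAlong_subset _ _ _)

lemma norm_single_le_one {m : ℕ} (j : Fin m) {c : ℂ} (hc : ‖c‖ ≤ 1) :
    ‖(Pi.single j c : Fin m → ℂ)‖ ≤ 1 := by
  refine (pi_norm_le_iff_of_nonneg zero_le_one).2 fun i => ?_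
  by_cases h : i = j
  · subst h
    simpa using hc
  · simp [h]

lemma DerivLE.lapList {m : ℕ} (L : List (Fin m)) {g : (Fin m → ℂ) → ℂ} (hg : ContDiff ℝ ∞ g)
    {B : ℝ} {n : ℕ} (h : DerivLE (n + 2 * L.length) B g) :
    DerivLE n (2 ^ L.length * B) (lapList L g) := by
  induction L generalizing g B with
  | nil => simpa [_root_.lapList] using h
  | cons j L ih =>
    have h1 : DerivLE (n + 2 * L.length) (2 * B)
        (_root_.lapAlong (Pi.single j 1) (Pi.single j Complex.I) g) := by
      refine DerivLE.lapAlong hg ?_ (norm_single_le_one j (by simp)) (norm_single_le_one j (by simp))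
      convert! h using 1
    have h2 := ih (hg.lapAlong _ _) h1
    rw [List.length_cons, pow_succ, mul_assoc]
    exact h2

lemma ContDiff.iterLap {m : ℕ} {g : (Fin m → ℂ) → ℂ} (hg : ContDiff ℝ ∞ g) :
    ContDiff ℝ ∞ (iterLap g) := hg.lapList _

lemma tsupport_iterLap_subset {m : ℕ} (g : (Fin m → ℂ) → ℂ) :
    tsupport (iterLap g) ⊆ tsupport g := tsupport_lapList_subset _ _

lemma DerivLE.norm_iterLap_le {m : ℕ} {g : (Fin m → ℂ) → ℂ} (hg : ContDiff ℝ ∞ g)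
    {B : ℝ} (h : DerivLE (2 * m) B g) (x : Fin m → ℂ) : ‖iterLap g x‖ ≤ 2 ^ m * B := by
  have := DerivLE.lapList (List.finRange m) hg (n := 0) (B := B) (by simpa using h) 0 le_rfl x
  rw [_root_.iterLap]
  simpa using this

/-- The slice of `(Fin (m + 1) → ℂ)` with fixed first coordinate is an affine copy of
`Fin m → ℂ`. -/
lemma hasFDerivAt_cons_right {m : ℕ} (z₀ : ℂ) (z : Fin m → ℂ) :
    HasFDerivAt (fun w : Fin m → ℂ => (Fin.cons z₀ w : Fin (m + 1) → ℂ))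
      (ContinuousLinearMap.pi (Fin.cons 0 fun j => ContinuousLinearMap.proj (R := ℝ) j)) z := by
  rw [hasFDerivAt_pi']
  intro i
  refine Fin.cases ?_ (fun j => ?_) i
  · simpa [ContinuousLinearMap.proj_pi] using hasFDerivAt_const z₀ z
  · simpa [ContinuousLinearMap.proj_pi] using hasFDerivAt_apply (𝕜 := ℝ) j z

lemma hasFDerivAt_cons_left {m : ℕ} (w : Fin m → ℂ) (z₀ : ℂ) :
    HasFDerivAt (fun t : ℂ => (Fin.cons t w : Fin (m + 1) → ℂ))
      (ContinuousLinearMap.pi (Fin.cons (ContinuousLinearMap.id ℝ ℂ) fun _ => 0)) z₀ := by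
  rw [hasFDerivAt_pi']
  intro i
  refine Fin.cases ?_ (fun j => ?_) i
  · simp only [Fin.cons_zero, ContinuousLinearMap.proj_pi]
    exact hasFDerivAt_id (𝕜 := ℝ) z₀
  · simpa [ContinuousLinearMap.proj_pi] using hasFDerivAt_const (𝕜 := ℝ) (w j) z₀

lemma lapList_map_succ {m : ℕ} (L : List (Fin m)) {g : (Fin (m + 1) → ℂ) → ℂ}
    (hg : ContDiff ℝ ∞ g) (z₀ : ℂ) (z : Fin m → ℂ) :
    lapList (L.map Fin.succ) g (Fin.cons z₀ z) = lapList L (fun w => g (Fin.cons z₀ w)) z := by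
  induction L generalizing g with
  | nil => rfl
  | cons j L ih =>
    have h1 := ih (hg.lapAlong (Pi.single j.succ 1) (Pi.single j.succ Complex.I))
    have h2 : (fun w => lapAlong (Pi.single j.succ 1) (Pi.single j.succ Complex.I) g
        (Fin.cons z₀ w)) = lapAlong (Pi.single j 1) (Pi.single j Complex.I)
          (fun w => g (Fin.cons z₀ w)) := by
      funext w
      rw [lapAlong_comp_affine hg (hasFDerivAt_cons_right z₀)]
      congr 2 <;>
      · funext i
        refine Fin.cases ?_ (fun i => ?_) i
        · simp
        · simp [Pi.single_apply]
    rw [h2] at h1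
    exact h1

lemma iterLap_succ {m : ℕ} {g : (Fin (m + 1) → ℂ) → ℂ} (hg : ContDiff ℝ ∞ g) (z₀ : ℂ)
    (z : Fin m → ℂ) :
    iterLap g (Fin.cons z₀ z) =
      iterLap (fun w => lapAlong (Pi.single 0 1) (Pi.single 0 Complex.I) g (Fin.cons z₀ w)) z := by
  rw [iterLap, List.finRange_succ]
  exact lapList_map_succ _ (hg.lapAlong (Pi.single 0 1) (Pi.single 0 Complex.I)) z₀ z

lemma lapAlong_zero_cons {m : ℕ} {g : (Fin (m + 1) → ℂ) → ℂ} (hg : ContDiff ℝ ∞ g) (z₀ : ℂ)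
    (z : Fin m → ℂ) :
    lapAlong (Pi.single 0 1) (Pi.single 0 Complex.I) g (Fin.cons z₀ z) =
      lapAlong 1 Complex.I (fun t => g (Fin.cons t z)) z₀ := by
  rw [lapAlong_comp_affine hg (hasFDerivAt_cons_left z)]
  congr 2 <;>
  · funext i
    refine Fin.cases ?_ (fun i => ?_) i
    · simp
    · simp

end Calculus

/-! ### Smooth functions with bounded derivatives -/

section SmoothBdd

variable {V W : Type*} [NormedAddCommGroup V] [NormedSpace ℝ V]
  [NormedAddCommGroup W] [NormedSpace ℝ W]

/-- `g` is smooth and each of its derivatives, including `g` itself, is bounded. -/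
def SmoothBdd (g : V → ℂ) : Prop :=
  ContDiff ℝ ∞ g ∧ ∀ i : ℕ, ∃ C : ℝ, ∀ x, ‖iteratedFDeriv ℝ i g x‖ ≤ C

lemma SmoothBdd.exists_derivLE {g : V → ℂ} (hg : SmoothBdd g) (n : ℕ) :
    ∃ C : ℝ, 1 ≤ C ∧ DerivLE n C g := by
  choose C hC using hg.2
  refine ⟨1 + ∑ i ∈ Finset.range (n + 1), |C i|, ?_, fun i hi x => ?_⟩
  · linarith [Finset.sum_nonneg (s := Finset.range (n + 1)) fun i _ => abs_nonneg (C i)]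
  · have h1 : |C i| ≤ ∑ i ∈ Finset.range (n + 1), |C i| :=
      Finset.single_le_sum (f := fun i => |C i|) (fun i _ => abs_nonneg _)
        (Finset.mem_range.2 (by omega))
    linarith [hC i x, le_abs_self (C i)]

lemma SmoothBdd.comp_clm {g : V → ℂ} (hg : SmoothBdd g) (L : W →L[ℝ] V) :
    SmoothBdd fun x => g (L x) := by
  refine ⟨hg.1.comp L.contDiff, fun i => ?_⟩
  obtain ⟨C, hC⟩ := hg.2 i
  refine ⟨C * ‖L‖ ^ i, fun x => ?_⟩
  have h := L.iteratedFDeriv_comp_right hg.1 x (i := i) (by exact_mod_cast le_top)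
  rw [show (fun x => g (L x)) = g ∘ L from rfl, h]
  refine (ContinuousMultilinearMap.norm_compContinuousLinearMap_le _ _).trans ?_
  simp only [Finset.prod_const, Finset.card_univ, Fintype.card_fin]
  gcongr
  exact hC _

lemma DerivLE.mul {g h : V → ℂ} (hg : ContDiff ℝ ∞ g) (hh : ContDiff ℝ ∞ h) {n : ℕ} {A B : ℝ}
    (h1 : DerivLE n A g) (h2 : DerivLE n B h) :
    DerivLE n (2 ^ n * A * B) fun x => g x * h x := by
  intro i hi x
  have hA : 0 ≤ A := (norm_nonneg _).trans (h1 0 (by omega) x)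
  have hB : 0 ≤ B := (norm_nonneg _).trans (h2 0 (by omega) x)
  refine (norm_iteratedFDeriv_mul_le hg hh x (n := i) (by exact_mod_cast le_top)).trans ?_
  calc _ ≤ ∑ j ∈ Finset.range (i + 1), (i.choose j : ℝ) * A * B := by
        refine Finset.sum_le_sum fun j hj => ?_
        have := Finset.mem_range.1 hj
        gcongr
        · exact h1 _ (by omega) x
        · exact h2 _ (by omega) x
    _ = 2 ^ i * A * B := by
        rw [← Finset.sum_mul, ← Finset.sum_mul]
        congr 2
        exact_mod_cast Nat.sum_range_choose i
    _ ≤ 2 ^ n * A * B := by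
        gcongr
        · norm_num

lemma SmoothBdd.mul {g h : V → ℂ} (hg : SmoothBdd g) (hh : SmoothBdd h) :
    SmoothBdd fun x => g x * h x := by
  refine ⟨hg.1.mul hh.1, fun i => ?_⟩
  obtain ⟨A, -, hA⟩ := hg.exists_derivLE i
  obtain ⟨B, -, hB⟩ := hh.exists_derivLE i
  exact ⟨_, hA.mul hg.1 hh.1 hB i le_rfl⟩

lemma smoothBdd_const (c : ℂ) : SmoothBdd fun _ : V => c := by
  refine ⟨contDiff_const, fun i => ⟨‖c‖, fun x => ?_⟩⟩
  rcases Nat.eq_zero_or_pos i with rfl | hi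
  · simp
  · rw [iteratedFDeriv_const_of_ne hi.ne']
    simp

lemma SmoothBdd.prod {ι : Type*} (s : Finset ι) {g : ι → V → ℂ} (hg : ∀ j ∈ s, SmoothBdd (g j)) :
    SmoothBdd fun x => ∏ j ∈ s, g j x := by
  classical
  induction s using Finset.induction_on with
  | empty => simpa using smoothBdd_const (V := V) 1
  | insert a s ha ih =>
    simp only [Finset.prod_insert ha]
    exact (hg a (Finset.mem_insert_self _ _)).mul
      (ih fun j hj => hg j (Finset.mem_insert_of_mem hj))

lemma SmoothBdd.of_hasCompactSupport {g : V → ℂ} (hg : ContDiff ℝ ∞ g) (h : HasCompactSupport g) :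
    SmoothBdd g := by
  refine ⟨hg, fun i => ?_⟩
  exact (hg.continuous_iteratedFDeriv (by exact_mod_cast le_top)).bounded_above_of_compact_support
    (h.iteratedFDeriv i)

/-- Precomposing with an affine map whose linear part has norm at most `c ≥ 1` costs a factor `c ^ n`
in the derivatives of order at most `n`. -/
lemma DerivLE.comp_affine {g : V → ℂ} (hg : ContDiff ℝ ∞ g) {n : ℕ} {B : ℝ} (h : DerivLE n B g)
    (L : W →L[ℝ] V) {c : ℝ} (hc : 1 ≤ c) (hL : ‖L‖ ≤ c) (v : V) :
    DerivLE n (B * c ^ n) fun x => g (L x + v) := by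
  intro i hi x
  have hB : 0 ≤ B := (norm_nonneg _).trans (h 0 (by omega) v)
  have h0 : ContDiff ℝ ∞ fun y => g (y + v) := hg.comp (contDiff_id.add contDiff_const)
  have h1 := L.iteratedFDeriv_comp_right h0 x (i := i) (by exact_mod_cast le_top)
  rw [show (fun x => g (L x + v)) = (fun y => g (y + v)) ∘ L from rfl, h1]
  refine (ContinuousMultilinearMap.norm_compContinuousLinearMap_le _ _).trans ?_
  simp only [Finset.prod_const, Finset.card_univ, Fintype.card_fin]
  rw [iteratedFDeriv_comp_add_right]
  calc _ ≤ B * c ^ i := by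
        gcongr
        exact h i hi _
    _ ≤ B * c ^ n := by gcongr

lemma smoothBdd_smoothTransition : SmoothBdd fun t : ℝ => (Real.smoothTransition t : ℂ) := by
  have hs : ContDiff ℝ ∞ fun t : ℝ => (Real.smoothTransition t : ℂ) :=
    Complex.ofRealCLM.contDiff.comp Real.smoothTransition.contDiff
  refine ⟨hs, fun i => ?_⟩
  have hcont := hs.continuous_iteratedFDeriv (m := i) (by exact_mod_cast le_top)
  rcases Nat.eq_zero_or_pos i with rfl | hi
  · refine ⟨1, fun x => ?_⟩
    rw [norm_iteratedFDeriv_zero, Complex.norm_real, Real.norm_eq_abs, abs_of_nonneg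
      (Real.smoothTransition.nonneg x)]
    exact Real.smoothTransition.le_one x
  · obtain ⟨C, hC⟩ := (isCompact_Icc (a := (0 : ℝ)) (b := 1)).exists_bound_of_continuousOn
      hcont.continuousOn
    refine ⟨max C 0, fun x => ?_⟩
    by_cases hx : x ∈ Set.Icc (0 : ℝ) 1
    · exact (hC x hx).trans (le_max_left _ _)
    · have h0 : iteratedFDeriv ℝ i (fun t : ℝ => (Real.smoothTransition t : ℂ)) x = 0 := by
        have key : ∃ c : ℂ, (fun t : ℝ => (Real.smoothTransition t : ℂ)) =ᶠ[nhds x] fun _ => c := by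
          rw [Set.mem_Icc, not_and_or, not_le, not_le] at hx
          rcases hx with hx | hx
          · refine ⟨0, ?_⟩
            filter_upwards [Iio_mem_nhds hx] with t ht
            simp [Real.smoothTransition.zero_of_nonpos (le_of_lt ht)]
          · refine ⟨1, ?_⟩
            filter_upwards [Ioi_mem_nhds hx] with t ht
            simp [Real.smoothTransition.one_of_one_le (le_of_lt ht)]
        obtain ⟨c, hc⟩ := key
        rw [(hc.iteratedFDeriv ℝ i).eq_of_nhds, iteratedFDeriv_const_of_ne hi.ne']
        rfl
      rw [h0]
      simp

end SmoothBdd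

/-! ### Green's formula for the logarithm in the plane -/

section Green

lemma abs_log_pow_le (q : ℕ) {t : ℝ} (ht : 0 < t) :
    |Real.log t| ^ q ≤ ((q : ℝ) + 1) ^ q * t⁻¹ + t ^ q := by
  rcases le_or_gt t 1 with h | h
  · have h1 := Real.abs_log_mul_self_rpow_lt t (1 / ((q : ℝ) + 1)) ht h (by positivity)
    rw [one_div_one_div, abs_mul, abs_of_pos (Real.rpow_pos_of_pos ht _)] at h1
    have h2 : |Real.log t| ≤ ((q : ℝ) + 1) * t ^ (-(1 / ((q : ℝ) + 1))) := by
      rw [Real.rpow_neg ht.le, ← div_eq_mul_inv, le_div_iff₀ (Real.rpow_pos_of_pos ht _)]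
      exact h1.le
    have h3 : |Real.log t| ^ q ≤ ((q : ℝ) + 1) ^ q * t⁻¹ := by
      calc |Real.log t| ^ q ≤ (((q : ℝ) + 1) * t ^ (-(1 / ((q : ℝ) + 1)))) ^ q := by gcongr
        _ = ((q : ℝ) + 1) ^ q * t ^ (-(1 / ((q : ℝ) + 1)) * q) := by
          rw [mul_pow, ← Real.rpow_natCast (t ^ _), ← Real.rpow_mul ht.le]
        _ ≤ ((q : ℝ) + 1) ^ q * t ^ (-1 : ℝ) := by
          gcongr ?_ * ?_
          apply Real.rpow_le_rpow_of_exponent_ge ht h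
          rw [neg_mul, neg_le_neg_iff, div_mul_eq_mul_div, one_mul, div_le_one (by positivity)]
          linarith
        _ = _ := by rw [Real.rpow_neg_one]
    have : 0 ≤ t ^ q := by positivity
    linarith
  · have h1 : |Real.log t| ≤ t := by
      rw [abs_of_pos (Real.log_pos h)]
      linarith [Real.log_le_sub_one_of_pos ht]
    have h2 : |Real.log t| ^ q ≤ t ^ q := by gcongr
    have : 0 ≤ ((q : ℝ) + 1) ^ q * t⁻¹ := by positivity
    linarith

lemma integrableOn_abs_log_norm_pow (q : ℕ) (R : ℝ) :
    IntegrableOn (fun z : ℂ => |Real.log ‖z‖| ^ q) (Metric.ball 0 R) := by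
  refine (integrableOn_fun_norm_addHaar (volume : Measure ℂ)
    (f := fun t => |Real.log t| ^ q) (r := R)).2 ?_
  rw [Complex.finrank_real_complex]
  have hb : IntegrableOn (fun t : ℝ => ((q : ℝ) + 1) ^ q + t ^ (q + 1)) (Set.Ioo 0 R) :=
    (Continuous.integrableOn_Icc (by fun_prop)).mono_set Set.Ioo_subset_Icc_self
  refine hb.mono' (by fun_prop) ?_
  refine (ae_restrict_iff' measurableSet_Ioo).2 (Filter.Eventually.of_forall fun t ht => ?_)
  have ht0 : 0 < t := ht.1
  have h1 := abs_log_pow_le q ht0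
  rw [smul_eq_mul, Real.norm_eq_abs, abs_mul, abs_pow, abs_pow, abs_abs, abs_of_pos ht0]
  calc t ^ (2 - 1) * |Real.log t| ^ q ≤ t * (((q : ℝ) + 1) ^ q * t⁻¹ + t ^ q) := by
        rw [show 2 - 1 = 1 from rfl, pow_one]
        gcongr
    _ = _ := by
        field_simp
        ring

/-- The local moments of `log |z - ζ|` are bounded uniformly in `ζ`. -/
lemma setIntegral_abs_log_norm_sub_pow_le (q : ℕ) (R R' : ℝ) (w ζ : ℂ) (h : ‖ζ - w‖ ≤ R') :
    IntegrableOn (fun z : ℂ => |Real.log ‖z - ζ‖| ^ q) (Metric.ball w R) ∧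
    ∫ z in Metric.ball w R, |Real.log ‖z - ζ‖| ^ q ≤
      ∫ z in Metric.ball (0 : ℂ) (R + R'), |Real.log ‖z‖| ^ q := by
  have hsub : (fun z => z - ζ) '' (Metric.ball w R) ⊆ Metric.ball (0 : ℂ) (R + R') := by
    rintro _ ⟨z, hz, rfl⟩
    rw [Metric.mem_ball, dist_eq_norm] at hz ⊢
    calc ‖z - ζ - 0‖ = ‖(z - w) - (ζ - w)‖ := by congr 1; ring
      _ ≤ ‖z - w‖ + ‖ζ - w‖ := norm_sub_le _ _
      _ < R + R' := by linarith
  have hemb : MeasurableEmbedding (fun z : ℂ => z - ζ) :=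
    (Homeomorph.subRight ζ).measurableEmbedding
  have hmp : MeasurePreserving (fun z : ℂ => z - ζ) volume volume :=
    measurePreserving_sub_right volume ζ
  have hint := integrableOn_abs_log_norm_pow q (R + R')
  have h1 := (hmp.integrableOn_image hemb (s := Metric.ball w R)).1 (hint.mono_set hsub)
  refine ⟨h1, ?_⟩
  have h2 := hmp.setIntegral_image_emb hemb (fun z : ℂ => |Real.log ‖z‖| ^ q) (Metric.ball w R)
  rw [← h2]
  exact setIntegral_mono_set hint (Filter.Eventually.of_forall fun z => by positivity)
    hsub.eventuallyLE

lemma integral_smul_dirDeriv_dirDeriv {f : ℂ → ℝ} {g : ℂ → ℂ} (hf : ContDiff ℝ ∞ f)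
    (hg : ContDiff ℝ ∞ g) (hc : HasCompactSupport g) (v : ℂ) :
    ∫ z, f z • dirDeriv v (dirDeriv v g) z = -∫ z, fderiv ℝ f z v • dirDeriv v g z := by
  have hg1 := hg.dirDeriv v
  have hg2 := hg1.dirDeriv v
  have hc1 : HasCompactSupport (dirDeriv v g) :=
    hc.of_isClosed_subset (isClosed_tsupport _) (tsupport_dirDeriv_subset v g)
  have hc2 : HasCompactSupport (dirDeriv v (dirDeriv v g)) :=
    hc1.of_isClosed_subset (isClosed_tsupport _) (tsupport_dirDeriv_subset v _)
  have hf1 : Continuous fun z => fderiv ℝ f z v :=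
    (hf.continuous_fderiv (by simp)).clm_apply continuous_const
  refine integral_smul_fderiv_eq_neg_fderiv_smul_of_integrable (𝕜 := ℝ) ?_ ?_ ?_ ?_ ?_
  · exact (hf1.smul hg1.continuous).integrable_of_hasCompactSupport hc1.smul_left
  · exact (hf.continuous.smul hg2.continuous).integrable_of_hasCompactSupport hc2.smul_left
  · exact (hf.continuous.smul hg1.continuous).integrable_of_hasCompactSupport hc1.smul_left
  · exact fun x _ => hf.differentiable (by simp) x
  · exact fun x _ => hg1.differentiable (by simp) x

lemma HasCompactSupport.dirDeriv {g : ℂ → ℂ} (hc : HasCompactSupport g) (v : ℂ) :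
    HasCompactSupport (dirDeriv v g) :=
  hc.of_isClosed_subset (isClosed_tsupport _) (tsupport_dirDeriv_subset v g)

lemma HasCompactSupport.lapAlong {g : ℂ → ℂ} (hc : HasCompactSupport g) (u v : ℂ) :
    HasCompactSupport (lapAlong u v g) :=
  hc.of_isClosed_subset (isClosed_tsupport _) (tsupport_lapAlong_subset u v g)

lemma integral_smul_lapAlong {f : ℂ → ℝ} {g : ℂ → ℂ} (hf : ContDiff ℝ ∞ f)
    (hg : ContDiff ℝ ∞ g) (hc : HasCompactSupport g) :
    ∫ z, f z • lapAlong 1 Complex.I g z =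
      -∫ z, (fderiv ℝ f z 1 • dirDeriv 1 g z + fderiv ℝ f z Complex.I • dirDeriv Complex.I g z) := by
  have hcf (v : ℂ) : Continuous fun z => fderiv ℝ f z v :=
    (hf.continuous_fderiv (by simp)).clm_apply continuous_const
  have h2 (v : ℂ) : Integrable fun z => f z • dirDeriv v (dirDeriv v g) z :=
    (hf.continuous.smul ((hg.dirDeriv v).dirDeriv v).continuous).integrable_of_hasCompactSupport
      ((hc.dirDeriv v).dirDeriv v).smul_left
  have h1 (v : ℂ) : Integrable fun z => fderiv ℝ f z v • dirDeriv v g z :=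
    ((hcf v).smul (hg.dirDeriv v).continuous).integrable_of_hasCompactSupport
      (hc.dirDeriv v).smul_left
  simp only [lapAlong, smul_add]
  rw [integral_add (h2 1) (h2 _), integral_add (h1 1) (h1 _),
    integral_smul_dirDeriv_dirDeriv hf hg hc, integral_smul_dirDeriv_dirDeriv hf hg hc, neg_add]

lemma integral_dirDeriv {g : ℂ → ℂ} (hg : ContDiff ℝ ∞ g) (hc : HasCompactSupport g) (v : ℂ) :
    ∫ z, dirDeriv v g z = 0 := by
  have := integral_smul_fderiv_eq_neg_fderiv_smul_of_integrable (𝕜 := ℝ) (μ := volume)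
    (f := fun _ : ℂ => (1 : ℝ)) (g := g) (v := v) (by simp)
    (by
      have h : Integrable fun x => fderiv ℝ g x v :=
        (hg.dirDeriv v).continuous.integrable_of_hasCompactSupport (hc.dirDeriv v)
      simpa using h)
    (by simpa using hg.continuous.integrable_of_hasCompactSupport hc)
    (fun x _ => differentiableAt_const _) (fun x _ => hg.differentiable (by simp) x)
  simpa [dirDeriv] using this

/-- The Laplacian of a test function is orthogonal to affine functions. -/
lemma integral_affine_smul_lapAlong {g : ℂ → ℂ} (hg : ContDiff ℝ ∞ g) (hc : HasCompactSupport g)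
    (a b c : ℝ) : ∫ z, (a + b * z.re + c * z.im) • lapAlong 1 Complex.I g z = 0 := by
  have hd (z : ℂ) : HasFDerivAt (fun z : ℂ => a + b * z.re + c * z.im)
      (b • Complex.reCLM + c • Complex.imCLM) z := by
    have h1 := (Complex.reCLM.hasFDerivAt (x := z)).const_mul b
    have h2 := (Complex.imCLM.hasFDerivAt (x := z)).const_mul c
    exact (h1.const_add a).add h2
  have hf : ContDiff ℝ ∞ fun z : ℂ => a + b * z.re + c * z.im :=
    (contDiff_const.add (contDiff_const.mul Complex.reCLM.contDiff)).add
      (contDiff_const.mul Complex.imCLM.contDiff)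
  rw [integral_smul_lapAlong hf hg hc]
  simp only [(hd _).fderiv]
  have hi (v : ℂ) (s : ℝ) : Integrable fun z => s • dirDeriv v g z :=
    ((hg.dirDeriv v).continuous.integrable_of_hasCompactSupport (hc.dirDeriv v)).smul s
  rw [integral_add (hi _ _) (hi _ _), integral_smul, integral_smul, integral_dirDeriv hg hc,
    integral_dirDeriv hg hc]
  simp

/-- The smooth approximation `½ log (|z|² + ε)` of `log |z|`. -/
def regLog (ε : ℝ) (z : ℂ) : ℝ := 2⁻¹ * Real.log (z.re ^ 2 + z.im ^ 2 + ε)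

lemma contDiff_regLog {ε : ℝ} (hε : 0 < ε) : ContDiff ℝ ∞ (regLog ε) := by
  have h : ContDiff ℝ ∞ fun z : ℂ => z.re ^ 2 + z.im ^ 2 + ε :=
    ((Complex.reCLM.contDiff.pow 2).add (Complex.imCLM.contDiff.pow 2)).add contDiff_const
  exact contDiff_const.mul (h.log fun z => by positivity)

lemma fderiv_regLog {ε : ℝ} (hε : 0 < ε) (z v : ℂ) :
    fderiv ℝ (regLog ε) z v = (z.re * v.re + z.im * v.im) / (z.re ^ 2 + z.im ^ 2 + ε) := by
  have h1 := (Complex.reCLM.hasFDerivAt (x := z)).pow 2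
  have h2 := (Complex.imCLM.hasFDerivAt (x := z)).pow 2
  have h3 : HasFDerivAt (regLog ε) _ z :=
    (((h1.add h2).add_const ε).log (by
      have : 0 < z.re ^ 2 + z.im ^ 2 + ε := by positivity
      simpa using this.ne')).const_mul 2⁻¹
  rw [h3.fderiv]
  simp
  field_simp

/-- The radial form of the regularised Green formula. -/
lemma integral_regLog_smul_lapAlong {g : ℂ → ℂ} (hg : ContDiff ℝ ∞ g) (hc : HasCompactSupport g)
    {ε : ℝ} (hε : 0 < ε) :
    ∫ z, regLog ε z • lapAlong 1 Complex.I g z =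
      -∫ p in polarCoord.target, (p.1 ^ 2 / (p.1 ^ 2 + ε)) •
        deriv (fun r : ℝ => g (r * Complex.exp (p.2 * Complex.I))) p.1 := by
  rw [integral_smul_lapAlong (contDiff_regLog hε) hg hc, ← Complex.integral_comp_polarCoord_symm]
  congr 1
  refine setIntegral_congr_fun polarCoord.open_target.measurableSet fun p hp => ?_
  have hp0 : 0 < p.1 := by
    have := hp
    simp only [polarCoord_target, Set.mem_prod, Set.mem_Ioi] at this
    exact this.1
  set e : ℂ := Complex.exp (p.2 * Complex.I) with he
  have hz : Complex.polarCoord.symm p = p.1 * e := by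
    rw [Complex.polarCoord_symm_apply, he, Complex.exp_mul_I]
    simp
  have hre : e.re = Real.cos p.2 := by rw [he, Complex.exp_ofReal_mul_I_re]
  have him : e.im = Real.sin p.2 := by rw [he, Complex.exp_ofReal_mul_I_im]
  have hder : HasDerivAt (fun r : ℝ => g (r * e)) (fderiv ℝ g (p.1 * e) e) p.1 := by
    have h1 : HasFDerivAt g (fderiv ℝ g (p.1 * e)) (p.1 * e) :=
      (hg.differentiable (by simp) _).hasFDerivAt
    have h2 : HasDerivAt (fun r : ℝ => (r : ℂ) * e) e p.1 := by
      simpa using (Complex.ofRealCLM.hasDerivAt (x := p.1)).mul_const e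
    exact h1.comp_hasDerivAt p.1 h2
  have hlin : fderiv ℝ g (p.1 * e) e =
      e.re • fderiv ℝ g (p.1 * e) 1 + e.im • fderiv ℝ g (p.1 * e) Complex.I := by
    rw [← map_smul, ← map_smul, ← map_add]
    congr 1
    apply Complex.ext <;> simp
  simp only [hz, hder.deriv, hlin, fderiv_regLog hε, dirDeriv]
  simp only [Complex.mul_re, Complex.mul_im, Complex.ofReal_re, Complex.ofReal_im, Complex.one_re,
    Complex.one_im, Complex.I_re, Complex.I_im, smul_add, smul_smul, zero_mul, sub_zero,
    add_zero, mul_zero, mul_one, zero_add]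
  have hcs : e.re ^ 2 + e.im ^ 2 = 1 := by rw [hre, him]; exact Real.cos_sq_add_sin_sq _
  have hden : (p.1 * e.re) ^ 2 + (p.1 * e.im) ^ 2 + ε = p.1 ^ 2 + ε := by
    linear_combination p.1 ^ 2 * hcs
  rw [hden]
  congr 2 <;> ring

lemma abs_regLog_le {ε : ℝ} (hε : 0 < ε) (hε1 : ε ≤ 1) {z : ℂ} (hz : z ≠ 0) :
    |regLog ε z| ≤ |Real.log ‖z‖| + ‖z‖ ^ 2 + 1 := by
  have hsq : z.re ^ 2 + z.im ^ 2 = ‖z‖ ^ 2 := by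
    rw [← Complex.normSq_eq_norm_sq, Complex.normSq_apply]; ring
  have hpos : 0 < ‖z‖ := norm_pos_iff.2 hz
  rw [regLog, hsq, abs_mul, abs_of_pos (by norm_num : (0 : ℝ) < 2⁻¹)]
  rcases le_or_gt 1 (‖z‖ ^ 2 + ε) with h | h
  · rw [abs_of_nonneg (Real.log_nonneg h)]
    have := Real.log_le_sub_one_of_pos (by positivity : 0 < ‖z‖ ^ 2 + ε)
    nlinarith [abs_nonneg (Real.log ‖z‖), sq_nonneg ‖z‖]
  · rw [abs_of_nonpos (Real.log_nonpos (by positivity) h.le)]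
    have h1 : Real.log (‖z‖ ^ 2) ≤ Real.log (‖z‖ ^ 2 + ε) :=
      Real.log_le_log (by positivity) (by linarith)
    rw [Real.log_pow] at h1
    push_cast at h1
    nlinarith [neg_abs_le (Real.log ‖z‖), sq_nonneg ‖z‖]

lemma integral_deriv_ray {g : ℂ → ℂ} (hg : ContDiff ℝ ∞ g) (hc : HasCompactSupport g) (e : ℂ)
    (he : e ≠ 0) : ∫ r in Set.Ioi (0 : ℝ), deriv (fun r : ℝ => g (r * e)) r = -g 0 := by
  have hl : ContDiff ℝ ∞ fun r : ℝ => g (r * e) :=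
    hg.comp (Complex.ofRealCLM.contDiff.mul contDiff_const)
  have hcs : HasCompactSupport fun r : ℝ => g (r * e) := by
    refine hc.comp_isClosedEmbedding (g := fun r : ℝ => (r : ℂ) * e) ?_
    exact (Homeomorph.mulRight₀ e he).isClosedEmbedding.comp
      Complex.isometry_ofReal.isClosedEmbedding
  have h := integral_Ioi_of_hasDerivAt_of_tendsto (a := (0 : ℝ)) (m := 0)
    (f := fun r : ℝ => g (r * e)) (f' := deriv fun r : ℝ => g (r * e))
    hl.continuous.continuousWithinAt
    (fun x _ => (hl.differentiable (by simp) x).hasDerivAt)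
    (((hl.continuous_deriv (by simp)).integrable_of_hasCompactSupport hcs.deriv).integrableOn)
    (hcs.is_zero_at_infty.mono_left atTop_le_cocompact)
  simpa using h

/-- The local integrability of the logarithm against test functions. -/
lemma integrable_log_smul {g : ℂ → ℂ} (hg : Continuous g) (hc : HasCompactSupport g) (ζ : ℂ) :
    Integrable fun z => Real.log ‖z - ζ‖ • g z := by
  obtain ⟨R, hR⟩ := hc.isCompact.isBounded.subset_ball 0
  have h1 := (setIntegral_abs_log_norm_sub_pow_le 1 R ‖ζ‖ 0 ζ (by simp)).1
  obtain ⟨M, hM⟩ := hg.bounded_above_of_compact_support hc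
  have hsupp : Function.support (fun z => Real.log ‖z - ζ‖ • g z) ⊆ Metric.ball 0 R := by
    intro z hz
    apply hR
    apply subset_tsupport
    intro h
    apply hz
    simp [h]
  rw [← integrableOn_iff_integrable_of_support_subset hsupp]
  refine (h1.mul_const M).mono' ?_ ?_
  · exact (((measurable_id.sub_const ζ).norm.log).aestronglyMeasurable.smul
      hg.aestronglyMeasurable)
  · refine Filter.Eventually.of_forall fun z => ?_
    rw [norm_smul, pow_one, Real.norm_eq_abs]
    gcongr
    exact hM z

lemma integral_log_smul_lapAlong_zero {g : ℂ → ℂ} (hg : ContDiff ℝ ∞ g)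
    (hc : HasCompactSupport g) :
    ∫ z, Real.log ‖z‖ • lapAlong 1 Complex.I g z = (2 * Real.pi) • g 0 := by
  have hseq : ∀ n : ℕ, 0 < 1 / ((n : ℝ) + 1) := fun n => by positivity
  have hseq1 : ∀ n : ℕ, 1 / ((n : ℝ) + 1) ≤ 1 := fun n => by
    rw [div_le_one (by positivity)]; linarith [(Nat.cast_nonneg n : (0 : ℝ) ≤ n)]
  have htend := tendsto_one_div_add_atTop_nhds_zero_nat (𝕜 := ℝ)
  have hlap := (hg.lapAlong 1 Complex.I).continuous
  have hlapc := hc.lapAlong 1 Complex.I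
  -- the left sides converge
  have hL : Filter.Tendsto (fun n : ℕ => ∫ z, regLog (1 / ((n : ℝ) + 1)) z •
      lapAlong 1 Complex.I g z) Filter.atTop
      (nhds (∫ z, Real.log ‖z‖ • lapAlong 1 Complex.I g z)) := by
    refine tendsto_integral_of_dominated_convergence
      (fun z => ‖Real.log ‖z - 0‖ • lapAlong 1 Complex.I g z‖ +
        (‖z‖ ^ 2 + 1) * ‖lapAlong 1 Complex.I g z‖) ?_ ?_ ?_ ?_
    · exact fun n => ((contDiff_regLog (hseq n)).continuous.smul hlap).aestronglyMeasurable
    · refine (integrable_log_smul hlap hlapc 0).norm.add ?_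
      refine Continuous.integrable_of_hasCompactSupport ?_ ?_
      · exact ((continuous_norm.pow 2).add continuous_const).mul hlap.norm
      · exact hlapc.norm.mul_left
    · intro n
      filter_upwards [compl_mem_ae_iff.2 (measure_singleton (0 : ℂ))] with z hz
      rw [norm_smul, norm_smul, ← add_mul, Real.norm_eq_abs, Real.norm_eq_abs, sub_zero]
      gcongr
      rw [← add_assoc]
      exact abs_regLog_le (hseq n) (hseq1 n) hz
    · filter_upwards [compl_mem_ae_iff.2 (measure_singleton (0 : ℂ))] with z hz
      refine Filter.Tendsto.smul_const ?_ _
      have hsq : z.re ^ 2 + z.im ^ 2 = ‖z‖ ^ 2 := by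
        rw [← Complex.normSq_eq_norm_sq, Complex.normSq_apply]; ring
      have hpos : 0 < ‖z‖ := norm_pos_iff.2 hz
      have h1 : Filter.Tendsto (fun n : ℕ => ‖z‖ ^ 2 + 1 / ((n : ℝ) + 1)) Filter.atTop
          (nhds (‖z‖ ^ 2)) := by simpa using htend.const_add (‖z‖ ^ 2)
      have h2 := (h1.log (by positivity)).const_mul (2⁻¹ : ℝ)
      rw [Real.log_pow] at h2
      simp only [regLog, hsq]
      convert h2 using 2
      push_cast
      ring
  -- the right sides converge
  have hD (θ r : ℝ) : deriv (fun r : ℝ => g (r * Complex.exp (θ * Complex.I))) r =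
      fderiv ℝ g (r * Complex.exp (θ * Complex.I)) (Complex.exp (θ * Complex.I)) := by
    have h1 : HasFDerivAt g (fderiv ℝ g (r * Complex.exp (θ * Complex.I)))
        (r * Complex.exp (θ * Complex.I)) := (hg.differentiable (by simp) _).hasFDerivAt
    have h2 : HasDerivAt (fun r : ℝ => (r : ℂ) * Complex.exp (θ * Complex.I))
        (Complex.exp (θ * Complex.I)) r := by
      simpa using (Complex.ofRealCLM.hasDerivAt (x := r)).mul_const
        (Complex.exp (θ * Complex.I))
    exact (h1.comp_hasDerivAt r h2).deriv
  set D : ℝ × ℝ → ℂ := fun p =>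
    deriv (fun r : ℝ => g (r * Complex.exp (p.2 * Complex.I))) p.1 with hDdef
  have hDcont : Continuous D := by
    have : D = fun p : ℝ × ℝ => fderiv ℝ g (p.1 * Complex.exp (p.2 * Complex.I))
        (Complex.exp (p.2 * Complex.I)) := funext fun p => hD p.2 p.1
    rw [this]
    have hf := hg.continuous_fderiv (by simp)
    exact (hf.comp (by fun_prop)).clm_apply (by fun_prop)
  obtain ⟨R, hR⟩ := hc.isCompact.isBounded.subset_ball 0
  obtain ⟨M, hM⟩ := (hg.continuous_fderiv (by simp)).bounded_above_of_compact_support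
    (hc.fderiv (𝕜 := ℝ))
  have hDint : IntegrableOn D polarCoord.target := by
    have hbd : IntegrableOn D (Set.Icc 0 R ×ˢ Set.Icc (-Real.pi) Real.pi) :=
      hDcont.continuousOn.integrableOn_compact (isCompact_Icc.prod isCompact_Icc)
    refine hbd.of_forall_sdiff_eq_zero polarCoord.open_target.measurableSet fun p hp => ?_
    have hp1 := hp.1
    simp only [polarCoord_target, Set.mem_prod, Set.mem_Ioi, Set.mem_Ioo] at hp1
    have hp2 : R < p.1 := by
      by_contra hcon
      exact hp.2 ⟨⟨hp1.1.le, not_lt.1 hcon⟩, hp1.2.1.le, hp1.2.2.le⟩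
    have hout : (p.1 * Complex.exp (p.2 * Complex.I) : ℂ) ∉ tsupport g := by
      intro hmem
      have := hR hmem
      rw [mem_ball_zero_iff, norm_mul, Complex.norm_exp_ofReal_mul_I, mul_one, Complex.norm_real,
        Real.norm_eq_abs, abs_of_pos hp1.1] at this
      linarith
    rw [hDdef]
    simp only [hD]
    have h0 : fderiv ℝ g (p.1 * Complex.exp (p.2 * Complex.I)) = 0 := by
      by_contra hne
      exact hout (support_fderiv_subset ℝ hne)
    simp [h0]
  have hRt : Filter.Tendsto (fun n : ℕ => -∫ p in polarCoord.target,
      (p.1 ^ 2 / (p.1 ^ 2 + 1 / ((n : ℝ) + 1))) • D p) Filter.atTop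
      (nhds (-∫ p in polarCoord.target, D p)) := by
    refine Filter.Tendsto.neg (tendsto_integral_of_dominated_convergence (fun p => ‖D p‖)
      ?_ hDint.norm ?_ ?_)
    · intro n
      have := hseq n
      have hq : Continuous fun p : ℝ × ℝ => p.1 ^ 2 / (p.1 ^ 2 + 1 / ((n : ℝ) + 1)) :=
        (continuous_fst.pow 2).div ((continuous_fst.pow 2).add continuous_const)
          fun p => by positivity
      exact (hq.smul hDcont).aestronglyMeasurable
    · intro n
      refine Filter.Eventually.of_forall fun p => ?_
      have := hseq n
      rw [norm_smul, Real.norm_eq_abs, abs_of_nonneg (by positivity)]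
      refine mul_le_of_le_one_left (norm_nonneg _) ?_
      rw [div_le_one (by positivity)]
      linarith
    · refine (ae_restrict_iff' polarCoord.open_target.measurableSet).2
        (Filter.Eventually.of_forall fun p hp => ?_)
      simp only [polarCoord_target, Set.mem_prod, Set.mem_Ioi, Set.mem_Ioo] at hp
      have h1 : Filter.Tendsto (fun n : ℕ => p.1 ^ 2 / (p.1 ^ 2 + 1 / ((n : ℝ) + 1)))
          Filter.atTop (nhds (p.1 ^ 2 / (p.1 ^ 2 + 0))) :=
        (tendsto_const_nhds).div (htend.const_add _) (by have := hp.1; positivity)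
      have h2 : p.1 ^ 2 / (p.1 ^ 2 + 0) = 1 := by
        rw [add_zero, div_self (by have := hp.1; positivity)]
      rw [h2] at h1
      have h3 : Filter.Tendsto (fun n : ℕ => (p.1 ^ 2 / (p.1 ^ 2 + 1 / ((n : ℝ) + 1))) • D p)
          Filter.atTop (nhds ((1 : ℝ) • D p)) := h1.smul tendsto_const_nhds
      simpa using h3
  have heq : (fun n : ℕ => ∫ z, regLog (1 / ((n : ℝ) + 1)) z • lapAlong 1 Complex.I g z) =
      fun n : ℕ => -∫ p in polarCoord.target,
        (p.1 ^ 2 / (p.1 ^ 2 + 1 / ((n : ℝ) + 1))) • D p :=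
    funext fun n => integral_regLog_smul_lapAlong hg hc (hseq n)
  rw [heq] at hL
  rw [tendsto_nhds_unique hL hRt, polarCoord_target, Measure.volume_eq_prod,
    ← Measure.prod_restrict, integral_prod_symm]
  · simp only [hDdef]
    have : ∀ θ : ℝ, ∫ r in Set.Ioi (0 : ℝ),
        deriv (fun r : ℝ => g (r * Complex.exp (θ * Complex.I))) r = -g 0 := fun θ =>
      integral_deriv_ray hg hc _ (Complex.exp_ne_zero _)
    simp only [this]
    rw [setIntegral_const, Real.volume_real_Ioo_of_le (by linarith [Real.pi_pos])]
    rw [smul_neg, neg_neg]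
    congr 1
    ring
  · rw [Measure.prod_restrict, ← Measure.volume_eq_prod]
    exact hDint

/-- Green's formula: `Δ log |· - ζ| = 2π δ_ζ`. -/
theorem integral_log_smul_lapAlong {g : ℂ → ℂ} (hg : ContDiff ℝ ∞ g) (hc : HasCompactSupport g)
    (ζ : ℂ) : ∫ z, Real.log ‖z - ζ‖ • lapAlong 1 Complex.I g z = (2 * Real.pi) • g ζ := by
  have hφ (x : ℂ) : HasFDerivAt (fun y : ℂ => y + ζ) (ContinuousLinearMap.id ℝ ℂ) x :=
    (hasFDerivAt_id x).add_const ζ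
  have h1 := integral_log_smul_lapAlong_zero (g := fun z => g (z + ζ))
    (hg.comp (contDiff_id.add contDiff_const))
    (hc.comp_homeomorph (Homeomorph.addRight ζ))
  simp only [lapAlong_comp_affine hg hφ, ContinuousLinearMap.id_apply, zero_add] at h1
  rw [← h1, ← integral_add_right_eq_self (μ := (volume : Measure ℂ)) _ ζ]
  simp

end Green

/-! ### The interpolation defect of the logarithm -/

section Defect

/-- The four points at which a function is sampled by `interpDefect`: the point `y.1` itself and
the three vertices `y.2, y.2 + 1, y.2 + i` of a right triangle. -/
def samplePoint (y : ℂ × ℂ) : Fin 4 → ℂ := ![y.1, y.2, y.2 + 1, y.2 + Complex.I]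

/-- The coefficients with which `interpDefect` combines the values at the sample points. -/
def sampleCoeff (y : ℂ × ℂ) : Fin 4 → ℝ :=
  ![1, -1 + (y.1 - y.2).re + (y.1 - y.2).im, -(y.1 - y.2).re, -(y.1 - y.2).im]

/-- The difference at `y.1` between `φ` and the affine function that agrees with `φ` at
`y.2, y.2 + 1, y.2 + i`. It vanishes on affine functions. For `φ = log |p|` this removes the leading
coefficient of `p` and makes the contribution of a distant zero decay quadratically. -/
def interpDefect (φ : ℂ → ℝ) (y : ℂ × ℂ) : ℝ := ∑ q, sampleCoeff y q * φ (samplePoint y q)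

/-- The law (not normalised) of the sample: `y.1` ranges over `B(w,R)` and `y.2` over `B(w,1)`. -/
def sampleMeasure (w : ℂ) (R : ℝ) : Measure (ℂ × ℂ) :=
  (volume.restrict (Metric.ball w R)).prod (volume.restrict (Metric.ball w 1))

/-- The size of the interpolation defect around `w` of the logarithm centred at `ζ`. -/
def decayWeight (w ζ : ℂ) : ℝ := ((max 1 ‖ζ - w‖) ^ 2)⁻¹

lemma decayWeight_pos (w ζ : ℂ) : 0 < decayWeight w ζ := by
  have : (0 : ℝ) < max 1 ‖ζ - w‖ := lt_max_of_lt_left one_pos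
  unfold decayWeight
  positivity

instance (w : ℂ) (R : ℝ) : IsFiniteMeasure (volume.restrict (Metric.ball w R)) :=
  ⟨by simpa using (measure_ball_lt_top (μ := (volume : Measure ℂ)) (x := w) (r := R))⟩

instance (w : ℂ) (R : ℝ) : IsFiniteMeasure (sampleMeasure w R) := by
  unfold sampleMeasure; infer_instance

lemma sampleMeasure_real_univ (w : ℂ) {R : ℝ} (hR : 0 ≤ R) :
    (sampleMeasure w R).real Set.univ = Real.pi * R ^ 2 * Real.pi := by
  simp [sampleMeasure, Measure.real, ← Set.univ_prod_univ, Measure.prod_prod, Complex.volume_ball,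
    ENNReal.toReal_ofReal hR]
  ring

lemma ae_sampleMeasure (w : ℂ) (R : ℝ) :
    ∀ᵐ y ∂(sampleMeasure w R), y.1 ∈ Metric.ball w R ∧ y.2 ∈ Metric.ball w 1 := by
  rw [sampleMeasure, Measure.prod_restrict]
  exact ae_restrict_mem (measurableSet_ball.prod measurableSet_ball)

lemma interpDefect_affine (a b c : ℝ) (y : ℂ × ℂ) :
    interpDefect (fun z => a + b * z.re + c * z.im) y = 0 := by
  simp [interpDefect, Fin.sum_univ_four, sampleCoeff, samplePoint]
  ring

lemma interpDefect_add (φ ψ : ℂ → ℝ) (y : ℂ × ℂ) :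
    interpDefect (fun z => φ z + ψ z) y = interpDefect φ y + interpDefect ψ y := by
  simp only [interpDefect, mul_add, Finset.sum_add_distrib]

lemma interpDefect_sum {ι : Type*} (s : Finset ι) (φ : ι → ℂ → ℝ) (y : ℂ × ℂ) :
    interpDefect (fun z => ∑ i ∈ s, φ i z) y = ∑ i ∈ s, interpDefect (φ i) y := by
  simp only [interpDefect, Finset.mul_sum]
  exact Finset.sum_comm

lemma abs_sampleCoeff_le {w : ℂ} {R : ℝ} (hR : 1 ≤ R) {y : ℂ × ℂ} (h1 : y.1 ∈ Metric.ball w R)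
    (h2 : y.2 ∈ Metric.ball w 1) (q : Fin 4) : |sampleCoeff y q| ≤ 2 * R + 3 := by
  rw [Metric.mem_ball, dist_eq_norm] at h1 h2
  have h3 : ‖y.1 - y.2‖ ≤ R + 1 := by
    calc ‖y.1 - y.2‖ = ‖(y.1 - w) - (y.2 - w)‖ := by congr 1; ring
      _ ≤ ‖y.1 - w‖ + ‖y.2 - w‖ := norm_sub_le _ _
      _ ≤ R + 1 := by linarith
  have hre := abs_le.1 ((Complex.abs_re_le_norm _).trans h3)
  have him := abs_le.1 ((Complex.abs_im_le_norm _).trans h3)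
  rw [abs_le]
  fin_cases q <;> simp [sampleCoeff] at hre him ⊢ <;> constructor <;> linarith [hre.1, hre.2, him.1, him.2]

lemma samplePoint_mem_ball {w : ℂ} {R : ℝ} (hR : 1 ≤ R) {y : ℂ × ℂ} (h1 : y.1 ∈ Metric.ball w R)
    (h2 : y.2 ∈ Metric.ball w 1) (q : Fin 4) : samplePoint y q ∈ Metric.ball w (R + 2) := by
  rw [Metric.mem_ball, dist_eq_norm] at h1 h2 ⊢
  have h3 (e : ℂ) (he : ‖e‖ ≤ 1) : ‖y.2 + e - w‖ < R + 2 := by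
    calc ‖y.2 + e - w‖ = ‖(y.2 - w) + e‖ := by congr 1; ring
      _ ≤ ‖y.2 - w‖ + ‖e‖ := norm_add_le _ _
      _ < R + 2 := by linarith
  fin_cases q
  · simp only [samplePoint, Fin.zero_eta, Matrix.cons_val_zero]; linarith
  · simpa [samplePoint] using h3 0 (by simp)
  · simpa [samplePoint] using h3 1 (by simp)
  · simpa [samplePoint] using h3 Complex.I (by simp)

lemma measurable_samplePoint (q : Fin 4) : Measurable fun y => samplePoint y q := by
  fin_cases q <;> simp [samplePoint] <;> fun_prop

lemma measurable_sampleCoeff (q : Fin 4) : Measurable fun y => sampleCoeff y q := by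
  fin_cases q <;> simp [sampleCoeff] <;> fun_prop

lemma measurable_interpDefect {φ : ℂ → ℝ} (hφ : Measurable φ) : Measurable (interpDefect φ) :=
  Finset.measurable_sum _ fun q _ =>
    (measurable_sampleCoeff q).mul (hφ.comp (measurable_samplePoint q))

/-- The logarithmic kernel `log |· - ζ|` with its affine interpolation removed. -/
def logDefect (ζ : ℂ) : ℂ × ℂ → ℝ := interpDefect fun z => Real.log ‖z - ζ‖

lemma measurable_logDefect (ζ : ℂ) : Measurable (logDefect ζ) :=
  measurable_interpDefect (by fun_prop)

/-- Taylor expansion of `log |z - ζ|` to first order around a point `w` far from `ζ`. -/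
lemma abs_log_norm_sub_affine_le {w ζ z : ℂ} {ρ : ℝ} (hz : ‖z - w‖ ≤ ρ) (hρ : 0 < ρ)
    (hζ : 2 * ρ ≤ ‖ζ - w‖) :
    |Real.log ‖z - ζ‖ - Real.log ‖ζ - w‖ + ((z - w) / (ζ - w)).re| ≤ ρ ^ 2 * (‖ζ - w‖ ^ 2)⁻¹ := by
  have hpos : 0 < ‖ζ - w‖ := by linarith
  have hne : ζ - w ≠ 0 := norm_pos_iff.1 hpos
  set s : ℂ := -((z - w) / (ζ - w)) with hs
  have hsn : ‖s‖ ≤ ρ / ‖ζ - w‖ := by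
    rw [hs, norm_neg, norm_div]; gcongr
  have hhalf : ρ / ‖ζ - w‖ ≤ 1 / 2 := by
    rw [div_le_div_iff₀ hpos (by norm_num)]; linarith
  have hs1 : ‖s‖ < 1 := by linarith
  have h1s : (1 + s) ≠ 0 := by
    intro h
    have : s = -1 := by linear_combination h
    rw [this] at hs1
    simp at hs1
  have hfac : ‖z - ζ‖ = ‖ζ - w‖ * ‖1 + s‖ := by
    rw [← norm_mul, hs, ← norm_neg]
    congr 1
    field_simp
    ring
  have h := Complex.norm_log_one_add_sub_self_le hs1
  have hre : Real.log ‖z - ζ‖ - Real.log ‖ζ - w‖ + ((z - w) / (ζ - w)).re =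
      (Complex.log (1 + s) - s).re := by
    rw [hfac, Real.log_mul hpos.ne' (norm_ne_zero_iff.2 h1s), Complex.sub_re, Complex.log_re, hs,
      Complex.neg_re]
    ring
  rw [hre]
  refine (Complex.abs_re_le_norm _).trans (h.trans ?_)
  have hinv : (1 - ‖s‖)⁻¹ ≤ 2 := by
    rw [inv_le_comm₀ (by linarith) (by norm_num)]; linarith
  calc ‖s‖ ^ 2 * (1 - ‖s‖)⁻¹ / 2 ≤ (ρ / ‖ζ - w‖) ^ 2 * 2 / 2 := by gcongr
    _ = _ := by rw [div_pow]; field_simp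

lemma abs_logDefect_le_of_far {w ζ : ℂ} {R : ℝ} (hR : 1 ≤ R) {y : ℂ × ℂ}
    (h1 : y.1 ∈ Metric.ball w R) (h2 : y.2 ∈ Metric.ball w 1) (hζ : 2 * (R + 2) ≤ ‖ζ - w‖) :
    |logDefect ζ y| ≤ 4 * (2 * R + 3) * (R + 2) ^ 2 * (‖ζ - w‖ ^ 2)⁻¹ := by
  set u : ℂ := (ζ - w)⁻¹ with hu
  set c : ℝ := Real.log ‖ζ - w‖ + (w * u).re with hc
  have hsplit : logDefect ζ y = interpDefect (fun z => Real.log ‖z - ζ‖ - Real.log ‖ζ - w‖ +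
      ((z - w) / (ζ - w)).re) y := by
    have h := interpDefect_affine (-c) u.re (-u.im) y
    rw [← add_zero (logDefect ζ y), ← h, logDefect, ← interpDefect_add]
    congr 1
    funext z
    rw [div_eq_mul_inv, ← hu, hc]
    simp only [Complex.mul_re, Complex.sub_re, Complex.sub_im]
    ring
  rw [hsplit, interpDefect]
  refine (Finset.abs_sum_le_sum_abs _ _).trans ?_
  calc _ ≤ ∑ _q : Fin 4, (2 * R + 3) * ((R + 2) ^ 2 * (‖ζ - w‖ ^ 2)⁻¹) := by
        refine Finset.sum_le_sum fun q _ => ?_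
        rw [abs_mul]
        gcongr
        · exact abs_sampleCoeff_le hR h1 h2 q
        · refine abs_log_norm_sub_affine_le ?_ (by linarith) hζ
          have := samplePoint_mem_ball hR h1 h2 q
          rw [Metric.mem_ball, dist_eq_norm] at this
          exact this.le
    _ = _ := by
        rw [Finset.sum_const, Finset.card_univ, Fintype.card_fin, nsmul_eq_mul]
        push_cast
        ring

/-- The moments of the logarithm at each sample point. -/
lemma integrable_abs_log_samplePoint (n : ℕ) (R R' : ℝ) (hR : 1 ≤ R) :
    ∃ D : ℝ, 0 ≤ D ∧ ∀ (q : Fin 4) (w ζ : ℂ), ‖ζ - w‖ ≤ R' →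
      Integrable (fun y => |Real.log ‖samplePoint y q - ζ‖| ^ n) (sampleMeasure w R) ∧
      ∫ y, |Real.log ‖samplePoint y q - ζ‖| ^ n ∂(sampleMeasure w R) ≤ D := by
  set J : ℝ → ℝ := fun ρ => ∫ z in Metric.ball (0 : ℂ) (ρ + (R' + 1)), |Real.log ‖z‖| ^ n with hJ
  have hJ0 : ∀ ρ, 0 ≤ J ρ := fun ρ => integral_nonneg fun z => by positivity
  refine ⟨Real.pi * J R + Real.pi * R ^ 2 * J 1,
    add_nonneg (mul_nonneg Real.pi_pos.le (hJ0 _))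
      (mul_nonneg (by positivity) (hJ0 _)), fun q w ζ hζ => ?_⟩
  have hvol (ρ : ℝ) (hρ : 0 ≤ ρ) : (volume.restrict (Metric.ball w ρ)).real Set.univ =
      Real.pi * ρ ^ 2 := by
    simp [Measure.real, Complex.volume_ball, ENNReal.toReal_ofReal hρ]
    ring
  have hsecond (e : ℂ) (he : ‖e‖ ≤ 1) :
      Integrable (fun y : ℂ × ℂ => |Real.log ‖y.2 + e - ζ‖| ^ n) (sampleMeasure w R) ∧
      ∫ y, |Real.log ‖y.2 + e - ζ‖| ^ n ∂(sampleMeasure w R) ≤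
        Real.pi * J R + Real.pi * R ^ 2 * J 1 := by
    obtain ⟨h1, h2⟩ := setIntegral_abs_log_norm_sub_pow_le n 1 (R' + 1) w (ζ - e) (by
      calc ‖ζ - e - w‖ = ‖(ζ - w) - e‖ := by congr 1; ring
        _ ≤ ‖ζ - w‖ + ‖e‖ := norm_sub_le _ _
        _ ≤ R' + 1 := by linarith)
    simp only [show ∀ z : ℂ, z - (ζ - e) = z + e - ζ from fun z => by ring] at h1 h2
    refine ⟨Integrable.comp_snd (f := fun z : ℂ => |Real.log ‖z + e - ζ‖| ^ n) h1 _, ?_⟩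
    rw [sampleMeasure, integral_fun_snd (fun z : ℂ => |Real.log ‖z + e - ζ‖| ^ n), smul_eq_mul,
      hvol R (by linarith)]
    have h3 : Real.pi * R ^ 2 * ∫ z in Metric.ball w 1, |Real.log ‖z + e - ζ‖| ^ n ≤
        Real.pi * R ^ 2 * J 1 := by gcongr
    have := mul_nonneg Real.pi_pos.le (hJ0 R)
    linarith
  fin_cases q
  · obtain ⟨h1, h2⟩ := setIntegral_abs_log_norm_sub_pow_le n R (R' + 1) w ζ (by linarith)
    refine ⟨Integrable.comp_fst (f := fun z : ℂ => |Real.log ‖z - ζ‖| ^ n) h1 _, ?_⟩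
    simp only [samplePoint, Fin.zero_eta, Matrix.cons_val_zero]
    rw [sampleMeasure, integral_fun_fst (fun z : ℂ => |Real.log ‖z - ζ‖| ^ n), smul_eq_mul,
      hvol 1 zero_le_one]
    have h3 : Real.pi * 1 ^ 2 * ∫ z in Metric.ball w R, |Real.log ‖z - ζ‖| ^ n ≤
        Real.pi * J R := by
      rw [one_pow, mul_one]; gcongr
    have : 0 ≤ Real.pi * R ^ 2 * J 1 := mul_nonneg (by positivity) (hJ0 1)
    linarith
  · simpa [samplePoint] using hsecond 0 (by simp)
  · simpa [samplePoint] using hsecond 1 (by simp)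
  · simpa [samplePoint] using hsecond Complex.I (by simp)

/-- All moments of the interpolation defect of `log |· - ζ|` around `w` decay like
`|ζ - w| ^ (-2)`. -/
lemma exists_integral_abs_logDefect_pow_le (n : ℕ) (R : ℝ) (hR : 1 ≤ R) :
    ∃ D : ℝ, 0 ≤ D ∧ ∀ w ζ : ℂ,
      Integrable (fun y => |logDefect ζ y| ^ n) (sampleMeasure w R) ∧
      ∫ y, |logDefect ζ y| ^ n ∂(sampleMeasure w R) ≤ D * decayWeight w ζ ^ n := by
  obtain ⟨D, hD, hDq⟩ := integrable_abs_log_samplePoint n R (2 * (R + 2)) hR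
  set E : ℝ := 4 * (2 * R + 3) * (R + 2) ^ 2 with hE
  set c : ℝ := (4 * (2 * R + 3)) ^ n with hc
  have hmeas (ζ : ℂ) : Measurable fun y => |logDefect ζ y| ^ n :=
    (measurable_logDefect ζ).abs.pow_const n
  refine ⟨c * D * ((2 * (R + 2)) ^ 2) ^ n + E ^ n * (Real.pi * R ^ 2 * Real.pi),
    by positivity, fun w ζ => ?_⟩
  have hdw := decayWeight_pos w ζ
  rcases le_or_gt ‖ζ - w‖ (2 * (R + 2)) with h | h
  · have hpt : ∀ᵐ y ∂(sampleMeasure w R), |logDefect ζ y| ^ n ≤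
        ∑ q : Fin 4, 4⁻¹ * c * |Real.log ‖samplePoint y q - ζ‖| ^ n := by
      filter_upwards [ae_sampleMeasure w R] with y hy
      have h1 : |logDefect ζ y| ≤
          ∑ q : Fin 4, 4⁻¹ * (4 * (2 * R + 3) * |Real.log ‖samplePoint y q - ζ‖|) := by
        rw [logDefect, interpDefect]
        refine (Finset.abs_sum_le_sum_abs _ _).trans (Finset.sum_le_sum fun q _ => ?_)
        rw [abs_mul]
        calc _ ≤ (2 * R + 3) * |Real.log ‖samplePoint y q - ζ‖| := by
              gcongr
              exact abs_sampleCoeff_le hR hy.1 hy.2 q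
          _ = _ := by ring
      calc |logDefect ζ y| ^ n ≤ _ := pow_le_pow_left₀ (abs_nonneg _) h1 n
        _ ≤ ∑ q : Fin 4, 4⁻¹ * (4 * (2 * R + 3) * |Real.log ‖samplePoint y q - ζ‖|) ^ n :=
            Real.pow_arith_mean_le_arith_mean_pow _ _ _ (fun _ _ => by norm_num)
              (by simp) (fun q _ => by positivity) n
        _ = _ := by
            refine Finset.sum_congr rfl fun q _ => ?_
            rw [mul_pow, hc, mul_assoc]
    have hint : Integrable (fun y => ∑ q : Fin 4, 4⁻¹ * c *
        |Real.log ‖samplePoint y q - ζ‖| ^ n) (sampleMeasure w R) :=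
      integrable_finsetSum _ fun q _ => (hDq q w ζ h).1.const_mul _
    have hint2 : Integrable (fun y => |logDefect ζ y| ^ n) (sampleMeasure w R) := by
      refine hint.mono' (hmeas ζ).aestronglyMeasurable ?_
      filter_upwards [hpt] with y hy
      rwa [Real.norm_eq_abs, abs_of_nonneg (by positivity)]
    refine ⟨hint2, (integral_mono_ae hint2 hint hpt).trans ?_⟩
    rw [integral_finsetSum _ fun q _ => (hDq q w ζ h).1.const_mul _]
    have h4 : ∑ q : Fin 4, ∫ y, 4⁻¹ * c * |Real.log ‖samplePoint y q - ζ‖| ^ n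
        ∂(sampleMeasure w R) ≤ ∑ _q : Fin 4, 4⁻¹ * c * D := by
      refine Finset.sum_le_sum fun q _ => ?_
      rw [integral_const_mul]
      gcongr
      exact (hDq q w ζ h).2
    have h5 : 1 ≤ ((2 * (R + 2)) ^ 2) ^ n * decayWeight w ζ ^ n := by
      rw [← mul_pow]
      refine one_le_pow₀ ?_
      rw [decayWeight, ← div_eq_mul_inv, one_le_div (by positivity)]
      gcongr
      exact max_le (by linarith) h
    calc _ ≤ _ := h4
      _ = c * D * 1 := by
        rw [Finset.sum_const, Finset.card_univ, Fintype.card_fin, nsmul_eq_mul]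
        push_cast
        ring
      _ ≤ c * D * (((2 * (R + 2)) ^ 2) ^ n * decayWeight w ζ ^ n) := by gcongr
      _ ≤ _ := by
        rw [add_mul, mul_assoc (c * D)]
        have : 0 ≤ E ^ n * (Real.pi * R ^ 2 * Real.pi) * decayWeight w ζ ^ n := by positivity
        linarith
  · have hdw2 : (‖ζ - w‖ ^ 2)⁻¹ = decayWeight w ζ := by
      rw [decayWeight, max_eq_right (by linarith)]
    have hpt : ∀ᵐ y ∂(sampleMeasure w R), |logDefect ζ y| ^ n ≤ (E * decayWeight w ζ) ^ n := by
      filter_upwards [ae_sampleMeasure w R] with y hy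
      have := abs_logDefect_le_of_far hR hy.1 hy.2 h.le
      rw [hdw2] at this
      exact pow_le_pow_left₀ (abs_nonneg _) this n
    have hint2 : Integrable (fun y => |logDefect ζ y| ^ n) (sampleMeasure w R) := by
      refine (integrable_const ((E * decayWeight w ζ) ^ n)).mono' (hmeas ζ).aestronglyMeasurable ?_
      filter_upwards [hpt] with y hy
      rwa [Real.norm_eq_abs, abs_of_nonneg (by positivity)]
    refine ⟨hint2, (integral_mono_ae hint2 (integrable_const _) hpt).trans ?_⟩
    rw [integral_const, smul_eq_mul, sampleMeasure_real_univ w (by linarith), mul_pow]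
    have : 0 ≤ c * D * ((2 * (R + 2)) ^ 2) ^ n * decayWeight w ζ ^ n := by positivity
    nlinarith [this]

lemma integrable_logDefect {R : ℝ} (hR : 1 ≤ R) (w ζ : ℂ) :
    Integrable (logDefect ζ) (sampleMeasure w R) := by
  obtain ⟨D, -, hD⟩ := exists_integral_abs_logDefect_pow_le 1 R hR
  have := (hD w ζ).1
  simp only [pow_one] at this
  exact (integrable_norm_iff (measurable_logDefect ζ).aestronglyMeasurable).1 this

/-- Moments of a sum of interpolation defects. By convexity, with weights proportional to
`decayWeight`, the constant does not depend on the number of summands. -/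
lemma exists_integral_abs_sum_logDefect_pow_le (n : ℕ) (hn : n ≠ 0) (R : ℝ) (hR : 1 ≤ R) :
    ∃ D : ℝ, 0 ≤ D ∧ ∀ {ι : Type} [Fintype ι] (ζ : ι → ℂ) (w : ℂ),
      Integrable (fun y => |∑ i, logDefect (ζ i) y| ^ n) (sampleMeasure w R) ∧
      ∫ y, |∑ i, logDefect (ζ i) y| ^ n ∂(sampleMeasure w R) ≤
        D * (∑ i, decayWeight w (ζ i)) ^ n := by
  obtain ⟨D, hD, hDw⟩ := exists_integral_abs_logDefect_pow_le n R hR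
  refine ⟨D, hD, fun {ι} _ ζ w => ?_⟩
  rcases isEmpty_or_nonempty ι with hι | hι
  · simp [hn]
  set S : ℝ := ∑ i, decayWeight w (ζ i) with hS
  have hS0 : 0 < S := Finset.sum_pos (fun i _ => decayWeight_pos w (ζ i)) Finset.univ_nonempty
  have hpt (y : ℂ × ℂ) : |∑ i, logDefect (ζ i) y| ^ n ≤
      ∑ i, S ^ n * (decayWeight w (ζ i) / S) * (decayWeight w (ζ i) ^ n)⁻¹ *
        |logDefect (ζ i) y| ^ n := by
    have h1 : |∑ i, logDefect (ζ i) y| ≤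
        ∑ i, (decayWeight w (ζ i) / S) * (S * (decayWeight w (ζ i))⁻¹ * |logDefect (ζ i) y|) := by
      refine (Finset.abs_sum_le_sum_abs _ _).trans (Finset.sum_le_sum fun i _ => le_of_eq ?_)
      have := (decayWeight_pos w (ζ i)).ne'
      field_simp
    calc _ ≤ _ := pow_le_pow_left₀ (abs_nonneg _) h1 n
      _ ≤ ∑ i, (decayWeight w (ζ i) / S) *
          (S * (decayWeight w (ζ i))⁻¹ * |logDefect (ζ i) y|) ^ n := by
        refine Real.pow_arith_mean_le_arith_mean_pow _ _ _
          (fun i _ => (div_pos (decayWeight_pos w (ζ i)) hS0).le) ?_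
          (fun i _ => ?_) n
        · rw [← Finset.sum_div, div_self hS0.ne']
        · have := (decayWeight_pos w (ζ i)).le
          positivity
      _ = _ := by
        refine Finset.sum_congr rfl fun i _ => ?_
        rw [mul_pow, mul_pow, inv_pow]
        ring
  have hint : Integrable (fun y => ∑ i, S ^ n * (decayWeight w (ζ i) / S) *
      (decayWeight w (ζ i) ^ n)⁻¹ * |logDefect (ζ i) y| ^ n) (sampleMeasure w R) :=
    integrable_finsetSum _ fun i _ => (hDw w (ζ i)).1.const_mul _
  have hint2 : Integrable (fun y => |∑ i, logDefect (ζ i) y| ^ n) (sampleMeasure w R) := by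
    refine hint.mono' ?_ (Filter.Eventually.of_forall fun y => ?_)
    · exact ((Finset.measurable_sum _ fun i _ =>
        measurable_logDefect (ζ i)).abs.pow_const n).aestronglyMeasurable
    · rw [Real.norm_eq_abs, abs_of_nonneg (by positivity)]
      exact hpt y
  refine ⟨hint2, (integral_mono hint2 hint hpt).trans ?_⟩
  rw [integral_finsetSum _ fun i _ => (hDw w (ζ i)).1.const_mul _]
  calc _ ≤ ∑ i, S ^ n * D * (decayWeight w (ζ i) / S) := by
        refine Finset.sum_le_sum fun i _ => ?_
        have h0 := decayWeight_pos w (ζ i)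
        rw [integral_const_mul]
        calc _ ≤ S ^ n * (decayWeight w (ζ i) / S) * (decayWeight w (ζ i) ^ n)⁻¹ *
              (D * decayWeight w (ζ i) ^ n) := by
              gcongr
              exact (hDw w (ζ i)).2
          _ = _ := by
              field_simp
    _ = _ := by
        rw [← Finset.mul_sum, ← Finset.sum_div, div_self hS0.ne']
        ring

/-- Green's formula with the interpolation defect as kernel. -/
lemma integral_logDefect_smul_lapAlong {g : ℂ → ℂ} (hg : ContDiff ℝ ∞ g) {w : ℂ} {R : ℝ}
    (hR : 1 ≤ R) (hs : tsupport g ⊆ Metric.ball w R) (ζ : ℂ) :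
    ∫ y, logDefect ζ y • lapAlong 1 Complex.I g y.1 ∂(sampleMeasure w R) =
      (2 * Real.pi * Real.pi) • g ζ := by
  have hc : HasCompactSupport g :=
    Metric.isCompact_of_isClosed_isBounded (isClosed_tsupport g) (Metric.isBounded_ball.subset hs)
  have hlap := (hg.lapAlong 1 Complex.I).continuous
  have hlapc := hc.lapAlong 1 Complex.I
  obtain ⟨M, hM⟩ := hlap.bounded_above_of_compact_support hlapc
  have hint : Integrable (fun y : ℂ × ℂ => logDefect ζ y • lapAlong 1 Complex.I g y.1)
      (sampleMeasure w R) := by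
    refine ((integrable_logDefect hR w ζ).norm.mul_const M).mono' ?_ ?_
    · exact (measurable_logDefect ζ).aestronglyMeasurable.smul
        (hlap.comp continuous_fst).aestronglyMeasurable
    · refine Filter.Eventually.of_forall fun y => ?_
      rw [norm_smul]
      gcongr
      exact hM _
  have hin (w' : ℂ) : ∫ z in Metric.ball w R, logDefect ζ (z, w') • lapAlong 1 Complex.I g z =
      (2 * Real.pi) • g ζ := by
    rw [setIntegral_eq_integral_of_forall_compl_eq_zero fun z hz => by
      have h0 : z ∉ Function.support (lapAlong 1 Complex.I g) := fun h =>
        hz (hs (tsupport_lapAlong_subset _ _ _ (subset_tsupport _ h)))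
      rw [Function.notMem_support.1 h0, smul_zero]]
    set L1 := Real.log ‖w' - ζ‖
    set L2 := Real.log ‖w' + 1 - ζ‖
    set L3 := Real.log ‖w' + Complex.I - ζ‖
    have hdec (z : ℂ) : logDefect ζ (z, w') = Real.log ‖z - ζ‖ +
        ((-L1 - w'.re * (L1 - L2) - w'.im * (L1 - L3)) + (L1 - L2) * z.re + (L1 - L3) * z.im) := by
      simp [logDefect, interpDefect, Fin.sum_univ_four, sampleCoeff, samplePoint, L1, L2, L3]
      ring
    simp only [hdec, add_smul _ (_ : ℝ) (lapAlong 1 Complex.I g _)]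
    have h1 := integrable_log_smul hlap hlapc ζ
    have hcontAff : Continuous fun z : ℂ => (-L1 - w'.re * (L1 - L2) - w'.im * (L1 - L3)) +
        (L1 - L2) * z.re + (L1 - L3) * z.im := by fun_prop
    have h2 : Integrable fun z : ℂ => ((-L1 - w'.re * (L1 - L2) - w'.im * (L1 - L3)) +
        (L1 - L2) * z.re + (L1 - L3) * z.im) • lapAlong 1 Complex.I g z :=
      (hcontAff.smul hlap).integrable_of_hasCompactSupport hlapc.smul_left
    have h3 := integral_add h1 h2
    rw [integral_affine_smul_lapAlong hg hc, add_zero, integral_log_smul_lapAlong hg hc] at h3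
    rw [← h3]
    refine integral_congr_ae (Filter.Eventually.of_forall fun z => ?_)
    simp only [add_smul]
  rw [sampleMeasure] at hint ⊢
  rw [integral_prod_symm _ hint]
  simp only [hin]
  rw [setIntegral_const, Measure.real, Complex.volume_ball, smul_smul]
  congr 1
  simp
  ring

/-- The product of the open disks `B(w_j, R)`. -/
def polyBall {m : ℕ} (w : Fin m → ℂ) (R : ℝ) : Set (Fin m → ℂ) :=
  {v | ∀ j, v j ∈ Metric.ball (w j) R}

lemma hasCompactSupport_of_tsupport_subset_polyBall {m : ℕ} {g : (Fin m → ℂ) → ℂ} {w : Fin m → ℂ}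
    {R : ℝ} (hs : tsupport g ⊆ polyBall w R) : HasCompactSupport g := by
  refine Metric.isCompact_of_isClosed_isBounded (isClosed_tsupport g) ?_
  refine (Bornology.IsBounded.pi (S := fun j => Metric.ball (w j) R)
    fun j => Metric.isBounded_ball).subset fun v hv j _ => hs hv j

/-- The law of a tuple of independent samples around the points `w_j`. -/
def tupleMeasure {m : ℕ} (w : Fin m → ℂ) (R : ℝ) : Measure (Fin m → ℂ × ℂ) :=
  Measure.pi fun j => sampleMeasure (w j) R

instance {m : ℕ} (w : Fin m → ℂ) (R : ℝ) : IsFiniteMeasure (tupleMeasure w R) := by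
  unfold tupleMeasure; infer_instance

lemma contDiff_cons_right {m : ℕ} (z₀ : ℂ) :
    ContDiff ℝ ∞ fun v : Fin m → ℂ => (Fin.cons z₀ v : Fin (m + 1) → ℂ) := by
  refine contDiff_pi.2 fun j => Fin.cases ?_ (fun j => ?_) j
  · simpa using contDiff_const
  · simpa using contDiff_apply ℝ ℂ j

lemma contDiff_cons_left {m : ℕ} (z : Fin m → ℂ) :
    ContDiff ℝ ∞ fun t : ℂ => (Fin.cons t z : Fin (m + 1) → ℂ) := by
  refine contDiff_pi.2 fun j => Fin.cases ?_ (fun j => ?_) j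
  · simp only [Fin.cons_zero]; exact contDiff_id
  · simpa using contDiff_const

lemma slice_right {m : ℕ} {G : (Fin (m + 1) → ℂ) → ℂ} (hG : ContDiff ℝ ∞ G)
    {w : Fin (m + 1) → ℂ} {R : ℝ} (hs : tsupport G ⊆ polyBall w R) (z₀ : ℂ) :
    (ContDiff ℝ ∞ fun v : Fin m → ℂ => G (Fin.cons z₀ v)) ∧
      (tsupport fun v : Fin m → ℂ => G (Fin.cons z₀ v)) ⊆ polyBall (fun j => w j.succ) R := by
  refine ⟨hG.comp (contDiff_cons_right z₀), ?_⟩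
  refine (tsupport_comp_subset_preimage G (contDiff_cons_right z₀).continuous).trans ?_
  intro v hv j
  have := hs hv j.succ
  simpa using this

lemma slice_left {m : ℕ} {G : (Fin (m + 1) → ℂ) → ℂ} (hG : ContDiff ℝ ∞ G)
    {w : Fin (m + 1) → ℂ} {R : ℝ} (hs : tsupport G ⊆ polyBall w R) (z : Fin m → ℂ) :
    (ContDiff ℝ ∞ fun t : ℂ => G (Fin.cons t z)) ∧
      (tsupport fun t : ℂ => G (Fin.cons t z)) ⊆ Metric.ball (w 0) R := by
  refine ⟨hG.comp (contDiff_cons_left z), ?_⟩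
  refine (tsupport_comp_subset_preimage G (contDiff_cons_left z).continuous).trans ?_
  intro v hv
  have := hs hv 0
  simpa using this

/-- Green's formula in several variables: the iterated Laplacian of a test function against the
product of the logarithmic kernels reproduces the test function. -/
theorem integral_prod_logDefect_smul_iterLap {R : ℝ} (hR : 1 ≤ R) {m : ℕ} {g : (Fin m → ℂ) → ℂ}
    (hg : ContDiff ℝ ∞ g) {w : Fin m → ℂ} (hs : tsupport g ⊆ polyBall w R) (ζ : Fin m → ℂ) :
    ∫ y, (∏ j, logDefect (ζ j) (y j)) • iterLap g (fun j => (y j).1) ∂(tupleMeasure w R) =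
      (2 * Real.pi * Real.pi) ^ m • g ζ := by
  induction m with
  | zero =>
    have h0 : iterLap g = g := rfl
    simp only [tupleMeasure, Finset.univ_eq_empty, Finset.prod_empty, one_smul, pow_zero, h0]
    rw [Measure.pi_of_empty, integral_dirac]
    congr 1
    exact Subsingleton.elim _ _
  | succ m ih =>
    have hc := hasCompactSupport_of_tsupport_subset_polyBall hs
    have hlap := hg.iterLap.continuous
    have hlapc : HasCompactSupport (iterLap g) :=
      hc.of_isClosed_subset (isClosed_tsupport _) (tsupport_iterLap_subset g)
    obtain ⟨M, hM⟩ := hlap.bounded_above_of_compact_support hlapc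
    set w' : Fin m → ℂ := fun j => w j.succ with hw'
    set ζ' : Fin m → ℂ := fun j => ζ j.succ with hζ'
    have hmp := (measurePreserving_piFinSuccAbove (fun j => sampleMeasure (w j) R) 0).symm
    rw [tupleMeasure, ← hmp.integral_comp (MeasurableEquiv.measurableEmbedding _)]
    have hcomp (y : (ℂ × ℂ) × (Fin m → ℂ × ℂ)) :
        (∏ j, logDefect (ζ j) ((MeasurableEquiv.piFinSuccAbove (fun _ => ℂ × ℂ) 0).symm y j)) •
          iterLap g (fun j => ((MeasurableEquiv.piFinSuccAbove (fun _ => ℂ × ℂ) 0).symm y j).1) =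
        logDefect (ζ 0) y.1 • (∏ j, logDefect (ζ' j) (y.2 j)) •
          iterLap (fun v => lapAlong (Pi.single 0 1) (Pi.single 0 Complex.I) g
            (Fin.cons y.1.1 v)) (fun j => (y.2 j).1) := by
      have hv : (MeasurableEquiv.piFinSuccAbove (fun _ : Fin (m + 1) => ℂ × ℂ) 0).symm y =
          Fin.cons y.1 y.2 := by
        simp [MeasurableEquiv.piFinSuccAbove, Fin.insertNthEquiv]
      rw [hv, Fin.prod_univ_succ, ← iterLap_succ hg, mul_smul]
      have hfst : (fun j => ((Fin.cons y.1 y.2 : Fin (m + 1) → ℂ × ℂ) j).1) =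
          (Fin.cons y.1.1 fun j => (y.2 j).1 : Fin (m + 1) → ℂ) := by
        funext j
        refine Fin.cases ?_ (fun j => ?_) j <;> simp
      rw [hfst]
      simp [ζ']
    simp only [hcomp]
    have hint : Integrable (fun y : (ℂ × ℂ) × (Fin m → ℂ × ℂ) =>
        logDefect (ζ 0) y.1 • (∏ j, logDefect (ζ' j) (y.2 j)) •
          iterLap (fun v => lapAlong (Pi.single 0 1) (Pi.single 0 Complex.I) g
            (Fin.cons y.1.1 v)) (fun j => (y.2 j).1))
        ((sampleMeasure (w 0) R).prod (tupleMeasure w' R)) := by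
      have h1 : Integrable (fun y : Fin m → ℂ × ℂ => ∏ j, logDefect (ζ' j) (y j))
          (tupleMeasure w' R) :=
        Integrable.fintype_prod_dep fun j => integrable_logDefect hR (w' j) (ζ' j)
      have h2 := ((integrable_logDefect hR (w 0) (ζ 0)).mul_prod h1).norm.mul_const M
      simp only [← iterLap_succ hg]
      refine h2.mono' ?_ (Filter.Eventually.of_forall fun y => ?_)
      · have hP : Measurable fun y : (ℂ × ℂ) × (Fin m → ℂ × ℂ) =>
            ∏ j, logDefect (ζ' j) (y.2 j) :=
          Finset.measurable_prod _ fun j _ => (measurable_logDefect _).comp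
            ((measurable_pi_apply j).comp measurable_snd)
        have hI : Continuous fun y : (ℂ × ℂ) × (Fin m → ℂ × ℂ) =>
            iterLap g (Fin.cons y.1.1 fun j => (y.2 j).1) := by
          refine hlap.comp (continuous_pi fun j => Fin.cases ?_ (fun j => ?_) j)
          · simp only [Fin.cons_zero]; fun_prop
          · simp only [Fin.cons_succ]; fun_prop
        exact ((measurable_logDefect (ζ 0)).comp measurable_fst).aestronglyMeasurable.smul
          (hP.aestronglyMeasurable.smul hI.aestronglyMeasurable)
      · rw [smul_smul, norm_smul]
        gcongr
        exact hM _
    change ∫ y, _ ∂((sampleMeasure (w 0) R).prod (tupleMeasure w' R)) = _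
    rw [integral_prod _ hint]
    have hG := slice_right (hg.lapAlong (Pi.single 0 1) (Pi.single 0 Complex.I))
      ((tsupport_lapAlong_subset _ _ _).trans hs)
    have hin (y₀ : ℂ × ℂ) : ∫ y, logDefect (ζ 0) y₀ • (∏ j, logDefect (ζ' j) (y j)) •
          iterLap (fun v => lapAlong (Pi.single 0 1) (Pi.single 0 Complex.I) g
            (Fin.cons y₀.1 v)) (fun j => (y j).1) ∂(tupleMeasure w' R) =
        (2 * Real.pi * Real.pi) ^ m • logDefect (ζ 0) y₀ •
          lapAlong 1 Complex.I (fun t => g (Fin.cons t ζ')) y₀.1 := by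
      rw [integral_smul, ih (hG y₀.1).1 (hG y₀.1).2, smul_comm, lapAlong_zero_cons hg]
    have hL := slice_left hg hs ζ'
    have hζ0 : g (Fin.cons (ζ 0) ζ') = g ζ := congrArg g (Fin.cons_self_tail ζ)
    rw [integral_congr_ae (Filter.Eventually.of_forall hin), integral_smul,
      integral_logDefect_smul_lapAlong hL.1 hR hL.2, smul_smul, pow_succ, hζ0]

end Defect

/-! ### Sums over tuples of zeros -/

section Combinatorics

/-- A sum over injective tuples is an integral combination of sums over all tuples, with some of
the indices identified: expand `∏_{s<t} (1 - 1[i_s = i_t])`. -/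
theorem exists_sum_embedding_eq (k : ℕ) :
    ∃ (m : Finset (Fin k × Fin k) → ℕ) (π : ∀ e, Fin k → Fin (m e)) (c : Finset (Fin k × Fin k) → ℤ),
      (∀ e, Function.Surjective (π e)) ∧
      ∀ (I : Type) [Fintype I] [Fintype (Fin k ↪ I)] (F : (Fin k → I) → ℂ),
        ∑ i : Fin k ↪ I, F i = ∑ e, (c e : ℂ) * ∑ i : Fin (m e) → I, F (i ∘ π e) := by
  classical
  let r : Finset (Fin k × Fin k) → Setoid (Fin k) := fun e =>
    Relation.EqvGen.setoid fun s t => (s, t) ∈ e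
  let m : Finset (Fin k × Fin k) → ℕ := fun e => Fintype.card (Quotient (r e))
  let π : ∀ e, Fin k → Fin (m e) := fun e s => Fintype.equivFin (Quotient (r e)) (Quotient.mk (r e) s)
  let Q : Finset (Fin k × Fin k) := Finset.univ.filter fun x => x.1 < x.2
  have hπ : ∀ e, Function.Surjective (π e) := fun e =>
    (Fintype.equivFin _).surjective.comp Quotient.mk_surjective
  refine ⟨m, π, fun e => if e ⊆ Q then (-1) ^ e.card else 0, hπ, fun I _ _ F => ?_⟩
  have hinj (i : Fin k → I) : (if Function.Injective i then (1 : ℂ) else 0) =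
      ∑ e ∈ Q.powerset, (-1) ^ e.card * if ∀ x ∈ e, i x.1 = i x.2 then (1 : ℂ) else 0 := by
    have h1 : (if Function.Injective i then (1 : ℂ) else 0) =
        ∏ x ∈ Q, (1 + -(if i x.1 = i x.2 then (1 : ℂ) else 0)) := by
      by_cases h : Function.Injective i
      · rw [if_pos h, Finset.prod_eq_one]
        intro x hx
        have hx' : x.1 < x.2 := by simpa [Q] using hx
        rw [if_neg fun hc => hx'.ne (h hc)]
        simp
      · rw [if_neg h]
        symm
        simp only [Function.Injective, not_forall] at h
        obtain ⟨s, t, hst, hne⟩ := h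
        rcases lt_or_gt_of_ne hne with hlt | hlt
        · exact Finset.prod_eq_zero (i := (s, t)) (by simp [Q, hlt]) (by simp [hst])
        · exact Finset.prod_eq_zero (i := (t, s)) (by simp [Q, hlt]) (by simp [hst])
    rw [h1, Finset.prod_one_add]
    refine Finset.sum_congr rfl fun e _ => ?_
    rw [Finset.prod_neg, Finset.prod_ite_zero]
    simp
  have hfac (e : Finset (Fin k × Fin k)) : ∑ i : Fin (m e) → I, F (i ∘ π e) =
      ∑ i : Fin k → I, (if ∀ x ∈ e, i x.1 = i x.2 then (1 : ℂ) else 0) * F i := by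
    simp only [ite_mul, one_mul, zero_mul]
    rw [← Finset.sum_filter]
    refine Finset.sum_bij (fun i _ => i ∘ π e) ?_ ?_ ?_ ?_
    · intro i _
      simp only [Finset.mem_filter, Finset.mem_univ, true_and]
      intro x hx
      have : π e x.1 = π e x.2 := by
        simp only [π, EmbeddingLike.apply_eq_iff_eq]
        exact Quotient.sound (Relation.EqvGen.rel _ _ hx)
      simp [this]
    · intro i _ i' _ h
      exact (hπ e).injective_comp_right h
    · intro i hi
      simp only [Finset.mem_filter, Finset.mem_univ, true_and] at hi
      have hker : ∀ s t, (r e) s t → i s = i t := by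
        intro s t hst
        induction hst with
        | rel s t h => exact hi _ h
        | refl s => rfl
        | symm s t _ ih => exact ih.symm
        | trans s t u _ _ h1 h2 => exact h1.trans h2
      refine ⟨fun q => Quotient.lift i hker ((Fintype.equivFin (Quotient (r e))).symm q),
        Finset.mem_univ _, ?_⟩
      funext s
      simp [π]
    · intro i _
      rfl
  have hstart : ∑ i : Fin k ↪ I, F i =
      ∑ i : Fin k → I, (if Function.Injective i then (1 : ℂ) else 0) * F i := by
    simp only [ite_mul, one_mul, zero_mul]
    rw [← Finset.sum_filter]
    refine Finset.sum_bij (fun i _ => i) ?_ ?_ ?_ ?_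
    · intro i _; simpa using i.injective
    · intro i _ i' _ h; exact DFunLike.coe_injective h
    · intro i hi
      exact ⟨⟨i, by simpa using hi⟩, Finset.mem_univ _, rfl⟩
    · intro i _; rfl
  rw [hstart]
  simp only [hinj, Finset.sum_mul]
  rw [Finset.sum_comm]
  have hsub : (Finset.univ : Finset (Finset (Fin k × Fin k))).filter (fun e => e ⊆ Q) =
      Q.powerset := by ext e; simp
  rw [← hsub, Finset.sum_filter]
  refine Finset.sum_congr rfl fun e _ => ?_
  split_ifs with he
  · rw [hfac e, Finset.mul_sum]
    refine Finset.sum_congr rfl fun i _ => ?_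
    push_cast
    ring
  · simp

lemma card_le_of_surjective_fin {k m : ℕ} {π : Fin k → Fin m} (h : Function.Surjective π) : m ≤ k := by
  simpa using Fintype.card_le_of_surjective π h

lemma sum_fin_succ_pi {I E : Type*} [Fintype I] [AddCommMonoid E] {m : ℕ}
    (F : (Fin (m + 1) → I) → E) :
    ∑ i, F i = ∑ a, ∑ i : Fin m → I, F (Fin.cons a i) := by
  rw [← Fintype.sum_prod_type' (f := fun a (i : Fin m → I) => F (Fin.cons a i))]
  exact ((Fin.consEquiv fun _ => I).sum_comp F).symm

/-- Change of the index set of a sum over all tuples, one coordinate at a time. -/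
lemma sum_tuple_change {I J α β : Type*} [Fintype I] [Fintype J] (ζ : I → α) (ξ : J → β) {m : ℕ}
    (φ : Fin m → β → α) (P : Fin m → α → Prop) [∀ q a, Decidable (P q a)]
    (h : ∀ q, ∀ f : α → ℂ, ∑ j, f (φ q (ξ j)) = ∑ i, if P q (ζ i) then f (ζ i) else 0)
    (F : (Fin m → α) → ℂ) :
    ∑ j : Fin m → J, F (fun q => φ q (ξ (j q))) =
      ∑ i : Fin m → I, if ∀ q, P q (ζ (i q)) then F (fun q => ζ (i q)) else 0 := by
  induction m with
  | zero =>
    have : ∀ j : Fin 0 → J, ∀ i : Fin 0 → I,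
        (fun q => φ q (ξ (j q))) = fun q => ζ (i q) := fun j i => Subsingleton.elim _ _
    simp [this _ default]
  | succ m ih =>
    rw [sum_fin_succ_pi, sum_fin_succ_pi]
    have h1 (a : J) : ∑ j : Fin m → J, F (fun q => φ q (ξ ((Fin.cons a j : Fin (m + 1) → J) q))) =
        ∑ i : Fin m → I, if ∀ q : Fin m, P q.succ (ζ (i q)) then
          F (Fin.cons (φ 0 (ξ a)) fun q => ζ (i q)) else 0 := by
      have := ih (fun q => φ q.succ) (fun q => P q.succ) (fun q => h q.succ)
        (fun v => F (Fin.cons (φ 0 (ξ a)) v))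
      rw [← this]
      refine Finset.sum_congr rfl fun j _ => ?_
      congr 1
      funext q
      refine Fin.cases ?_ (fun q => ?_) q <;> simp
    simp only [h1]
    rw [Finset.sum_comm]
    have h2 (i : Fin m → I) := h 0 (fun a => if ∀ q : Fin m, P q.succ (ζ (i q)) then
          F (Fin.cons a fun q => ζ (i q)) else 0)
    simp only [h2]
    rw [Finset.sum_comm]
    refine Finset.sum_congr rfl fun a _ => Finset.sum_congr rfl fun i _ => ?_
    have h3 : (fun q => ζ ((Fin.cons a i : Fin (m + 1) → I) q)) =
        Fin.cons (ζ a) fun q => ζ (i q) := by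
      funext q
      refine Fin.cases ?_ (fun q => ?_) q <;> simp
    simp only [h3, Fin.forall_fin_succ, Fin.cons_zero, Fin.cons_succ]
    by_cases h4 : P 0 (ζ a) <;> simp [h4]

lemma sum_coe_multiset {α E : Type*} [DecidableEq α] [AddCommMonoid E] (s : Multiset α) (f : α → E) :
    ∑ x : s, f x.1 = (s.map f).sum := by
  rw [Finset.sum, Multiset.map_univ]

lemma sum_map_ite_zero {α : Type*} (s : Multiset α) (P : α → Prop) [DecidablePred P] (f : α → ℂ) :
    (s.map fun a => if P a then f a else 0).sum = ((s.filter P).map f).sum := by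
  induction s using Multiset.induction_on with
  | empty => simp
  | cons a s ih =>
    by_cases h : P a <;> simp [h, ih]

end Combinatorics

section Roots

/-- The index set enumerating the complex zeros of `p` with multiplicity. -/
abbrev RootIdx (p : ℝ[X]) : Type := ↥(p.aroots ℂ)

/-- The sum of `h` over all (not necessarily injective) `m`-tuples of complex zeros of `p`. -/
def rootSum {m : ℕ} (h : (Fin m → ℂ) → ℂ) (p : ℝ[X]) : ℂ :=
  ∑ i : Fin m → RootIdx p, h fun q => (i q).1

lemma mem_aroots_of_rootIdx {p : ℝ[X]} (i : RootIdx p) : i.1 ∈ p.aroots ℂ := Multiset.coe_mem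

lemma card_rootIdx_le {p : ℝ[X]} {n : ℕ} (hp : p.natDegree ≤ n) : Fintype.card (RootIdx p) ≤ n := by
  rw [Multiset.card_coe]
  exact ((Polynomial.card_roots' _).trans Polynomial.natDegree_map_le).trans hp

lemma aroots_filter_real (p : ℝ[X]) :
    (p.aroots ℂ).filter (fun z => z.im = 0) = p.roots.map (fun x : ℝ => (x : ℂ)) := by
  ext z
  by_cases hz : z.im = 0
  · obtain ⟨x, rfl⟩ : ∃ x : ℝ, (x : ℂ) = z := ⟨z.re, Complex.ext rfl (by simp [hz])⟩
    rw [Multiset.count_filter_of_pos (by simp),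
      Multiset.count_map_eq_count' _ _ Complex.ofReal_injective,
      Polynomial.count_roots, Polynomial.count_roots]
    exact (Polynomial.eq_rootMultiplicity_map (f := algebraMap ℝ ℂ)
      (algebraMap ℝ ℂ).injective x).symm
  · rw [Multiset.count_filter_of_neg (p := fun z : ℂ => z.im = 0) hz, Multiset.count_eq_zero_of_notMem]
    intro h
    obtain ⟨x, -, rfl⟩ := Multiset.mem_map.1 h
    simp at hz

lemma aroots_map_conj (p : ℝ[X]) : (p.aroots ℂ).map (starRingEnd ℂ) = p.aroots ℂ := by
  have hmap : (p.map (algebraMap ℝ ℂ)).map (starRingEnd ℂ) = p.map (algebraMap ℝ ℂ) := by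
    rw [Polynomial.map_map]
    congr 1
    ext x
    simp
  ext z
  obtain ⟨u, rfl⟩ : ∃ u, (starRingEnd ℂ) u = z := ⟨(starRingEnd ℂ) z, by simp⟩
  rw [Multiset.count_map_eq_count' _ _ (starRingEnd ℂ).injective, Polynomial.count_roots,
    Polynomial.count_roots]
  conv_rhs => rw [← hmap]
  exact Polynomial.eq_rootMultiplicity_map (f := starRingEnd ℂ) (starRingEnd ℂ).injective u

lemma sum_roots_eq (p : ℝ[X]) (f : ℂ → ℂ) :
    ∑ j : p.roots, f ((j.1 : ℝ) : ℂ) = ∑ i : RootIdx p, if i.1.im = 0 then f i.1 else 0 := by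
  rw [sum_coe_multiset p.roots (fun x : ℝ => f (x : ℂ)),
    sum_coe_multiset (p.aroots ℂ) (fun z : ℂ => if z.im = 0 then f z else 0),
    sum_map_ite_zero, aroots_filter_real, Multiset.map_map]
  rfl

/-- Conjugation if `ε` is true. -/
def conjIf (ε : Bool) (z : ℂ) : ℂ := bif ε then (starRingEnd ℂ) z else z

@[simp] lemma conjIf_conjIf (ε : Bool) (z : ℂ) : conjIf ε (conjIf ε z) = z := by
  cases ε <;> simp [conjIf]

lemma sum_upperZeros_eq (p : ℝ[X]) (ε : Bool) (f : ℂ → ℂ) :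
    ∑ j : upperZeros p, f (conjIf ε j.1) =
      ∑ i : RootIdx p, if 0 < (conjIf ε i.1).im then f i.1 else 0 := by
  rw [sum_coe_multiset (upperZeros p) (fun z : ℂ => f (conjIf ε z)),
    sum_coe_multiset (p.aroots ℂ) (fun z : ℂ => if 0 < (conjIf ε z).im then f z else 0),
    sum_map_ite_zero]
  have h0 : upperZeros p = (p.aroots ℂ).filter (fun z => 0 < z.im) := by
    unfold upperZeros
    congr
  rw [h0]
  cases ε
  · rfl
  · have key : (p.aroots ℂ).filter (fun z => 0 < (conjIf true z).im) =
        ((p.aroots ℂ).filter (fun z => 0 < z.im)).map (starRingEnd ℂ) := by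
      conv_lhs => rw [← aroots_map_conj p]
      rw [Multiset.filter_map]
      congr 1
      exact Multiset.filter_congr fun z _ => by simp [conjIf]
    rw [key, Multiset.map_map]
    rfl

end Roots

/-! ### The logarithm of a polynomial and its zeros -/

section PolyLog

/-- The interpolation defect of `log |p|`. -/
def polyDefect (p : ℝ[X]) : ℂ × ℂ → ℝ := interpDefect fun z => Real.log ‖p.aeval z‖

lemma mem_aroots_iff_aeval {p : ℝ[X]} (hp : p ≠ 0) (z : ℂ) : z ∈ p.aroots ℂ ↔ p.aeval z = 0 :=
  Polynomial.mem_aroots.trans (and_iff_right hp)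

lemma log_norm_aeval {p : ℝ[X]} {z : ℂ} (hz : p.aeval z ≠ 0) :
    Real.log ‖p.aeval z‖ =
      Real.log |p.leadingCoeff| + ∑ i : RootIdx p, Real.log ‖z - i.1‖ := by
  have hp : p ≠ 0 := by rintro rfl; simp at hz
  have hprod : p.aeval z = (p.leadingCoeff : ℂ) * ∏ i : RootIdx p, (z - i.1) := by
    rw [(IsAlgClosed.splits (p.map (algebraMap ℝ ℂ))).aeval_eq_prod_aroots]
    congr 1
    rw [Finset.prod, Multiset.map_univ (p.aroots ℂ) fun a => z - a]
  have hne : ∀ i ∈ (Finset.univ : Finset (RootIdx p)), ‖z - i.1‖ ≠ 0 := by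
    intro i _ h
    rw [norm_eq_zero, sub_eq_zero] at h
    exact hz ((mem_aroots_iff_aeval hp z).1 (h ▸ mem_aroots_of_rootIdx i))
  rw [hprod, norm_mul, Complex.norm_real, Real.norm_eq_abs, norm_prod, Real.log_mul, Real.log_prod hne]
  · simpa using hp
  · exact Finset.prod_ne_zero_iff.2 hne

lemma polyDefect_eq_sum {p : ℝ[X]} {y : ℂ × ℂ} (hy : ∀ q, p.aeval (samplePoint y q) ≠ 0) :
    polyDefect p y = ∑ i : RootIdx p, logDefect i.1 y := by
  have h1 : polyDefect p y = interpDefect (fun z => (Real.log |p.leadingCoeff| + 0 * z.re + 0 * z.im) +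
      ∑ i : RootIdx p, Real.log ‖z - i.1‖) y := by
    simp only [polyDefect, interpDefect]
    refine Finset.sum_congr rfl fun q _ => ?_
    rw [log_norm_aeval (hy q)]
    ring
  rw [h1, interpDefect_add, interpDefect_affine, zero_add, interpDefect_sum]
  rfl

@[simp] lemma polyDefect_zero (y : ℂ × ℂ) : polyDefect 0 y = 0 := by
  simp [polyDefect, interpDefect]

lemma ae_samplePoint_ne (w : ℂ) (R : ℝ) (ζ : ℂ) (q : Fin 4) :
    ∀ᵐ y ∂(sampleMeasure w R), samplePoint y q ≠ ζ := by
  have hsnd (u : ℂ) : ∀ᵐ y ∂(sampleMeasure w R), y.2 ≠ u := by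
    refine Measure.quasiMeasurePreserving_snd.ae (p := fun z => z ≠ u) ?_
    exact ae_restrict_of_ae (compl_mem_ae_iff.2 (measure_singleton u))
  fin_cases q
  · refine Measure.quasiMeasurePreserving_fst.ae (p := fun z => z ≠ ζ) ?_
    exact ae_restrict_of_ae (compl_mem_ae_iff.2 (measure_singleton ζ))
  · simpa [samplePoint] using hsnd ζ
  · filter_upwards [hsnd (ζ - 1)] with y hy h
    exact hy (by simp [samplePoint] at h; linear_combination h)
  · filter_upwards [hsnd (ζ - Complex.I)] with y hy h
    exact hy (by simp [samplePoint] at h; linear_combination h)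

lemma ae_aeval_samplePoint_ne {p : ℝ[X]} (hp : p ≠ 0) (w : ℂ) (R : ℝ) :
    ∀ᵐ y ∂(sampleMeasure w R), ∀ q, p.aeval (samplePoint y q) ≠ 0 := by
  have h : ∀ᵐ y ∂(sampleMeasure w R), ∀ q, ∀ i : RootIdx p, samplePoint y q ≠ i.1 :=
    ae_all_iff.2 fun q => ae_all_iff.2 fun i => ae_samplePoint_ne w R i.1 q
  filter_upwards [h] with y hy q h0
  have hmem := (mem_aroots_iff_aeval hp _).2 h0
  obtain ⟨x, hx⟩ : ∃ i : RootIdx p, i.1 = samplePoint y q :=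
    ⟨⟨samplePoint y q, ⟨0, Multiset.count_pos.2 hmem⟩⟩, rfl⟩
  exact hy q x hx.symm

lemma ae_tuple {m : ℕ} (w : Fin m → ℂ) (R : ℝ) {P : Fin m → ℂ × ℂ → Prop}
    (h : ∀ j, ∀ᵐ y ∂(sampleMeasure (w j) R), P j y) :
    ∀ᵐ y ∂(tupleMeasure w R), ∀ j, P j (y j) :=
  ae_all_iff.2 fun j =>
    (Measure.quasiMeasurePreserving_eval (fun j => sampleMeasure (w j) R) j).ae (h j)

@[simp] lemma rootSum_zero {m : ℕ} (hm : m ≠ 0) (h : (Fin m → ℂ) → ℂ) : rootSum h 0 = 0 := by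
  have : IsEmpty (RootIdx 0) := by
    rw [← Fintype.card_eq_zero_iff, Multiset.card_coe]; simp
  have : Nonempty (Fin m) := ⟨⟨0, Nat.pos_of_ne_zero hm⟩⟩
  simp [rootSum]

/-- The sum of a test function over all tuples of zeros is a multilinear integral of `log |p|`. -/
theorem integral_prod_polyDefect_smul_iterLap {R : ℝ} (hR : 1 ≤ R) {m : ℕ} (hm : m ≠ 0)
    {g : (Fin m → ℂ) → ℂ} (hg : ContDiff ℝ ∞ g) {w : Fin m → ℂ} (hs : tsupport g ⊆ polyBall w R)
    (p : ℝ[X]) :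
    ∫ y, (∏ j, polyDefect p (y j)) • iterLap g (fun j => (y j).1) ∂(tupleMeasure w R) =
      (2 * Real.pi * Real.pi) ^ m • rootSum g p := by
  rcases eq_or_ne p 0 with rfl | hp
  · simp [hm]
  have hc := hasCompactSupport_of_tsupport_subset_polyBall hs
  have hlap := hg.iterLap.continuous
  have hlapc : HasCompactSupport (iterLap g) :=
    hc.of_isClosed_subset (isClosed_tsupport _) (tsupport_iterLap_subset g)
  obtain ⟨M, hM⟩ := hlap.bounded_above_of_compact_support hlapc
  have hint (i : Fin m → RootIdx p) : Integrable (fun y : Fin m → ℂ × ℂ =>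
      (∏ j, logDefect (i j).1 (y j)) • iterLap g (fun j => (y j).1)) (tupleMeasure w R) := by
    have h1 : Integrable (fun y : Fin m → ℂ × ℂ => ∏ j, logDefect (i j).1 (y j))
        (tupleMeasure w R) :=
      Integrable.fintype_prod_dep fun j => integrable_logDefect hR (w j) (i j).1
    refine (h1.norm.mul_const M).mono' ?_ (Filter.Eventually.of_forall fun y => ?_)
    · have hI : Continuous fun y : Fin m → ℂ × ℂ => iterLap g (fun j => (y j).1) :=
        hlap.comp (by fun_prop)
      exact h1.aestronglyMeasurable.smul hI.aestronglyMeasurable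
    · rw [norm_smul]
      gcongr
      exact hM _
  have hae : ∀ᵐ y ∂(tupleMeasure w R), (∏ j, polyDefect p (y j)) • iterLap g (fun j => (y j).1) =
      ∑ i : Fin m → RootIdx p, (∏ j, logDefect (i j).1 (y j)) • iterLap g (fun j => (y j).1) := by
    filter_upwards [ae_tuple w R fun j => ae_aeval_samplePoint_ne hp (w j) R] with y hy
    simp only [polyDefect_eq_sum (hy _)]
    rw [Finset.prod_univ_sum, Fintype.piFinset_univ, Finset.sum_smul]
  rw [integral_congr_ae hae, integral_finsetSum _ fun i _ => hint i, rootSum, Finset.smul_sum]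
  exact Finset.sum_congr rfl fun i _ => integral_prod_logDefect_smul_iterLap hR hg hs _

end PolyLog

/-! ### Measurability of the zeros -/

section Measurability

variable {Ω : Type*} [MeasurableSpace Ω] {n : ℕ} {f : Ω → ℝ[X]}

lemma RandomZeros.IsRandomPoly.measurable_aeval (hf : IsRandomPoly n f) :
    Measurable fun x : Ω × ℂ => (f x.1).aeval x.2 := by
  have h : (fun x : Ω × ℂ => (f x.1).aeval x.2) = fun x : Ω × ℂ =>
      ∑ i ∈ Finset.range (n + 1), (f x.1).coeff i • x.2 ^ i := by
    funext x
    exact Polynomial.aeval_eq_sum_range' (Nat.lt_succ_of_le (hf.natDegree_le x.1)) x.2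
  rw [h]
  refine Finset.measurable_sum _ fun i _ => ?_
  exact ((hf.measurable_coeff i).comp measurable_fst).smul (measurable_snd.pow_const i)

lemma RandomZeros.IsRandomPoly.measurable_polyDefect (hf : IsRandomPoly n f) :
    Measurable fun x : Ω × (ℂ × ℂ) => polyDefect (f x.1) x.2 := by
  unfold polyDefect interpDefect
  refine Finset.measurable_sum _ fun q _ => ?_
  refine ((measurable_sampleCoeff q).comp measurable_snd).mul ?_
  exact (hf.measurable_aeval.comp
    (measurable_fst.prodMk ((measurable_samplePoint q).comp measurable_snd))).norm.log

lemma RandomZeros.IsRandomPoly.measurable_polyDefect_comp (hf : IsRandomPoly n f) {X : Type*}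
    [MeasurableSpace X] {a : X → Ω} {b : X → ℂ × ℂ} (ha : Measurable a) (hb : Measurable b) :
    Measurable fun x => polyDefect (f (a x)) (b x) := by
  have h := hf.measurable_polyDefect.comp (ha.prodMk hb)
  exact h

/-- Measurability holds because Green's formula writes the sum over the zeros as a parametric
integral of `log |p|`; no measurable enumeration of the zeros is used. -/
lemma RandomZeros.IsRandomPoly.measurable_rootSum (hf : IsRandomPoly n f) {R : ℝ} (hR : 1 ≤ R) {m : ℕ}
    (hm : m ≠ 0) {g : (Fin m → ℂ) → ℂ} (hg : ContDiff ℝ ∞ g) {w : Fin m → ℂ}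
    (hs : tsupport g ⊆ polyBall w R) : Measurable fun η => rootSum g (f η) := by
  have h1 : (fun η => rootSum g (f η)) = fun η => ((2 * Real.pi * Real.pi) ^ m)⁻¹ •
      ∫ y, (∏ j, polyDefect (f η) (y j)) • iterLap g (fun j => (y j).1) ∂(tupleMeasure w R) := by
    funext η
    rw [integral_prod_polyDefect_smul_iterLap hR hm hg hs, smul_smul, inv_mul_cancel₀, one_smul]
    have := Real.pi_pos
    positivity
  rw [h1]
  have hP : Measurable fun x : Ω × (Fin m → ℂ × ℂ) => ∏ j, polyDefect (f x.1) (x.2 j) := by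
    refine Finset.measurable_prod _ fun j _ => ?_
    exact hf.measurable_polyDefect_comp measurable_fst
      ((measurable_pi_apply j).comp measurable_snd)
  have hL : Measurable (iterLap g) := hg.iterLap.continuous.measurable
  have hv : Measurable fun x : Ω × (Fin m → ℂ × ℂ) => fun j => (x.2 j).1 :=
    measurable_pi_lambda _ fun j =>
      measurable_fst.comp ((measurable_pi_apply j).comp measurable_snd)
  have hI : Measurable fun x : Ω × (Fin m → ℂ × ℂ) => iterLap g (fun j => (x.2 j).1) :=
    hL.comp hv
  have hS : Measurable fun x : Ω × (Fin m → ℂ × ℂ) =>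
      (∏ j, polyDefect (f x.1) (x.2 j)) • iterLap g (fun j => (x.2 j).1) := hP.smul hI
  have h2 := (hS.stronglyMeasurable.integral_prod_right'
    (ν := tupleMeasure w R)).measurable
  exact h2.const_smul (((2 * Real.pi * Real.pi) ^ m)⁻¹)

/-- The counting measure of the complex zeros of `p`. -/
def rootMeasure (p : ℝ[X]) : Measure ℂ := ∑ i : RootIdx p, Measure.dirac i.1

lemma rootMeasure_apply (p : ℝ[X]) {S : Set ℂ} (hS : MeasurableSet S) :
    rootMeasure p S = ∑ i : RootIdx p, S.indicator 1 i.1 := by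
  simp [rootMeasure, Measure.dirac_apply' _ hS]

instance (p : ℝ[X]) : IsFiniteMeasure (rootMeasure p) := by
  refine ⟨?_⟩
  rw [rootMeasure_apply p MeasurableSet.univ]
  exact ENNReal.sum_lt_top.2 fun i _ => by simp

/-- The indicator function of an open set is an increasing limit of smooth functions, to which
`measurable_rootSum` applies. -/
lemma RandomZeros.IsRandomPoly.measurable_rootMeasure_of_isOpen (hf : IsRandomPoly n f) {O : Set ℂ}
    (hO : IsOpen O) (hb : Bornology.IsBounded O) : Measurable fun η => rootMeasure (f η) O := by
  obtain ⟨g, hgs, hg, hg01⟩ := hO.exists_contDiff_support_eq (n := ⊤)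
  obtain ⟨R, hR⟩ := hb.closure.subset_ball 0
  let θ : ℕ → ℂ → ℝ := fun N z => Real.smoothTransition (N * g z)
  have hθs (N : ℕ) : Function.support (θ N) ⊆ O := by
    intro z hz
    by_contra hzO
    rw [← hgs, Function.notMem_support] at hzO
    exact hz (by simp [θ, hzO, Real.smoothTransition.zero_of_nonpos])
  have hmeas (N : ℕ) : Measurable fun η =>
      rootSum (fun v : Fin 1 → ℂ => ((θ N (v 0) : ℝ) : ℂ)) (f η) := by
    refine hf.measurable_rootSum (R := max R 1) (le_max_right _ _) one_ne_zero (w := fun _ => 0) ?_ ?_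
    · refine Complex.ofRealCLM.contDiff.comp (Real.smoothTransition.contDiff.comp ?_)
      exact contDiff_const.mul (hg.comp (contDiff_apply ℝ ℂ (0 : Fin 1)))
    · have hsub : (tsupport fun v : Fin 1 → ℂ => ((θ N (v 0) : ℝ) : ℂ)) ⊆
          (fun v : Fin 1 → ℂ => v 0) ⁻¹' closure O := by
        refine closure_minimal (fun v hv => ?_) (isClosed_closure.preimage (continuous_apply 0))
        exact subset_closure (hθs N (by simpa using hv))
      intro v hv j
      rw [Subsingleton.elim j 0]
      exact Metric.ball_subset_ball (le_max_left _ _) (hR (hsub hv))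
  have hlim : Measurable fun η => ∑ i : RootIdx (f η), O.indicator (1 : ℂ → ℂ) i.1 := by
    refine measurable_of_tendsto_metrizable hmeas (tendsto_pi_nhds.2 fun η => ?_)
    have h1 : ∀ N, rootSum (fun v : Fin 1 → ℂ => ((θ N (v 0) : ℝ) : ℂ)) (f η) =
        ∑ i : RootIdx (f η), ((θ N i.1 : ℝ) : ℂ) := by
      intro N
      rw [rootSum]
      exact (Equiv.funUnique (Fin 1) (RootIdx (f η))).sum_comp
        (fun i => ((θ N i.1 : ℝ) : ℂ))
    simp only [h1]
    refine tendsto_finsetSum _ fun i _ => ?_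
    by_cases hi : i.1 ∈ O
    · rw [Set.indicator_of_mem hi]
      have hpos : 0 < g i.1 := by
        refine lt_of_le_of_ne (hg01 ⟨i.1, rfl⟩).1 (Ne.symm ?_)
        rw [← hgs] at hi
        exact hi
      obtain ⟨N₀, hN₀⟩ := exists_nat_ge (1 / g i.1)
      refine tendsto_const_nhds.congr' ?_
      filter_upwards [Filter.eventually_ge_atTop N₀] with N hN
      have : 1 ≤ (N : ℝ) * g i.1 := by
        rw [div_le_iff₀ hpos] at hN₀
        have hcast : (N₀ : ℝ) ≤ N := by exact_mod_cast hN
        nlinarith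
      simp [θ, Real.smoothTransition.one_of_one_le this]
    · rw [Set.indicator_of_notMem hi]
      have : ∀ N, θ N i.1 = 0 := fun N => by
        by_contra h
        exact hi (hθs N h)
      simp [this]
  have heq : (fun η => rootMeasure (f η) O) = fun η =>
      ENNReal.ofReal (∑ i : RootIdx (f η), O.indicator (1 : ℂ → ℂ) i.1).re := by
    funext η
    rw [rootMeasure_apply _ hO.measurableSet, Complex.re_sum, ENNReal.ofReal_sum_of_nonneg]
    · refine Finset.sum_congr rfl fun i _ => ?_
      by_cases hi : i.1 ∈ O <;> simp [hi]
    · intro i _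
      by_cases hi : i.1 ∈ O <;> simp [hi]
  rw [heq]
  exact (Complex.measurable_re.comp hlim).ennreal_ofReal

/-- The zeros of a random polynomial form a measurable random measure. -/
theorem RandomZeros.IsRandomPoly.measurable_rootMeasure (hf : IsRandomPoly n f) :
    Measurable fun η => rootMeasure (f η) := by
  have hopen (O : Set ℂ) (hO : IsOpen O) : Measurable fun η => rootMeasure (f η) O := by
    have h1 : (fun η => rootMeasure (f η) O) =
        fun η => ⨆ N : ℕ, rootMeasure (f η) (O ∩ Metric.ball 0 (N : ℝ)) := by
      funext η
      rw [← Monotone.measure_iUnion]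
      · congr 1
        rw [← Set.inter_iUnion, Metric.iUnion_ball_nat, Set.inter_univ]
      · intro a b hab
        exact Set.inter_subset_inter_right _ (Metric.ball_subset_ball (by exact_mod_cast hab))
    rw [h1]
    exact Measurable.iSup fun N => hf.measurable_rootMeasure_of_isOpen
      (hO.inter Metric.isOpen_ball) (Metric.isBounded_ball.subset Set.inter_subset_right)
  exact Measurable.measure_of_isPiSystem (BorelSpace.measurable_eq (α := ℂ)) isPiSystem_isOpen hopen (hopen _ isOpen_univ)

lemma RandomZeros.IsRandomPoly.measurable_sum_indicator (hf : IsRandomPoly n f) {S : Set ℂ}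
    (hS : MeasurableSet S) :
    Measurable fun η => ∑ i : RootIdx (f η), S.indicator (1 : ℂ → ℂ) i.1 := by
  have h := ((Measure.measurable_coe hS).comp hf.measurable_rootMeasure).ennreal_toReal
  have h2 := Complex.measurable_ofReal.comp h
  convert h2 using 1
  funext η
  simp only [Function.comp_apply]
  rw [rootMeasure_apply _ hS, ENNReal.toReal_sum, Complex.ofReal_sum]
  · refine Finset.sum_congr rfl fun i _ => ?_
    by_cases hi : i.1 ∈ S <;> simp [hi]
  · intro i _
    by_cases hi : i.1 ∈ S <;> simp [hi]

end Measurability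

/-! ### Measurability of the point process of tuples of zeros -/

section Tuples

variable {Ω : Type*} [MeasurableSpace Ω] {n : ℕ} {f : Ω → ℝ[X]}

/-- Measurability passes from counts of single points to counts of injective tuples in boxes. -/
lemma measurable_sum_embedding {α : Type*} [MeasurableSpace α] {I : Ω → Type}
    [∀ η, Fintype (I η)] (ξ : ∀ η, I η → α)
    (H : ∀ S : Set α, MeasurableSet S → Measurable fun η => ∑ j, S.indicator (1 : α → ℂ) (ξ η j))
    (k : ℕ) [∀ η, Fintype (Fin k ↪ I η)] (S : Fin k → Set α) (hS : ∀ s, MeasurableSet (S s)) :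
    Measurable fun η => ∑ i : Fin k ↪ I η, ∏ s, (S s).indicator (1 : α → ℂ) (ξ η (i s)) := by
  classical
  obtain ⟨m, π, c, -, hexp⟩ := exists_sum_embedding_eq k
  have h1 (η : Ω) := hexp (I η) (fun i => ∏ s, (S s).indicator (1 : α → ℂ) (ξ η (i s)))
  simp only [h1]
  refine Finset.measurable_sum _ fun e _ => Measurable.const_mul ?_ _
  have h2 (η : Ω) : ∑ i : Fin (m e) → I η, ∏ s, (S s).indicator (1 : α → ℂ) (ξ η ((i ∘ π e) s)) =
      ∏ q, ∑ a : I η, (⋂ s ∈ {s | π e s = q}, S s).indicator (1 : α → ℂ) (ξ η a) := by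
    rw [Finset.prod_univ_sum, Fintype.piFinset_univ]
    refine Finset.sum_congr rfl fun i _ => ?_
    rw [← Finset.prod_fiberwise Finset.univ (π e)]
    refine Finset.prod_congr rfl fun q _ => ?_
    by_cases h : ∀ s, π e s = q → ξ η (i q) ∈ S s
    · rw [Set.indicator_of_mem (by simpa using h), Finset.prod_eq_one]
      · rfl
      intro s hs
      have hs' : π e s = q := by simpa using hs
      simp only [Function.comp_apply, hs']
      rw [Set.indicator_of_mem (h s hs')]
      rfl
    · rw [Set.indicator_of_notMem (by simpa using h)]
      push Not at h
      obtain ⟨s, hs, hns⟩ := h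
      refine Finset.prod_eq_zero (i := s) (by simpa using hs) ?_
      simp only [Function.comp_apply, hs]
      exact Set.indicator_of_notMem hns _
  simp only [h2]
  exact Finset.measurable_prod _ fun q _ =>
    H _ (MeasurableSet.biInter (Set.to_countable _) fun s _ => hS s)

lemma zeroTuples_apply (k l : ℕ) (p : ℝ[X]) {B : Set ((Fin k → ℝ) × (Fin l → ℂ))}
    (hB : MeasurableSet B) :
    zeroTuples k l p B = ∑ i : Fin k ↪ p.roots, ∑ j : Fin l ↪ upperZeros p, ∑ σ : Fin l → Bool,
      B.indicator 1 (fun s => (i s).1, conjCoords σ fun t => (j t).1) := by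
  simp only [zeroTuples, Measure.coe_finsetSum, Finset.sum_apply, Measure.dirac_apply' _ hB]

lemma card_roots_le {p : ℝ[X]} {n : ℕ} (hp : p.natDegree ≤ n) : Fintype.card p.roots ≤ n := by
  rw [Multiset.card_coe]
  exact (Polynomial.card_roots' p).trans hp

lemma card_upperZeros_le {p : ℝ[X]} {n : ℕ} (hp : p.natDegree ≤ n) :
    Fintype.card (upperZeros p) ≤ n := by
  rw [Multiset.card_coe]
  refine le_trans ?_ (card_rootIdx_le hp)
  rw [Multiset.card_coe]
  exact Multiset.card_le_card (Multiset.filter_le _ _)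

lemma card_embedding_le {I : Type} [Fintype I] {k n : ℕ} [Fintype (Fin k ↪ I)]
    (h : Fintype.card I ≤ n) : Fintype.card (Fin k ↪ I) ≤ n ^ k := by
  classical
  calc Fintype.card (Fin k ↪ I) ≤ Fintype.card (Fin k → I) :=
        Fintype.card_le_of_injective (fun i => (i : Fin k → I)) DFunLike.coe_injective
    _ = Fintype.card I ^ k := by simp
    _ ≤ n ^ k := Nat.pow_le_pow_left h k

lemma zeroTuples_univ_le (k l : ℕ) {p : ℝ[X]} (hp : p.natDegree ≤ n) :
    zeroTuples k l p Set.univ ≤ (n ^ k * n ^ l * 2 ^ l : ℕ) := by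
  rw [zeroTuples_apply k l p MeasurableSet.univ]
  simp only [Set.indicator_univ, Pi.one_apply, Finset.sum_const, Finset.card_univ,
    nsmul_eq_mul, mul_one, Fintype.card_pi, Fintype.card_bool, Finset.prod_const, Fintype.card_fin]
  have h1 := card_embedding_le (k := k) (card_roots_le hp)
  have h2 := card_embedding_le (k := l) (card_upperZeros_le hp)
  rw [mul_assoc]
  exact_mod_cast Nat.mul_le_mul h1 (Nat.mul_le_mul_right _ h2)

instance (k l : ℕ) (p : ℝ[X]) : IsFiniteMeasure (zeroTuples k l p) :=
  ⟨(zeroTuples_univ_le k l le_rfl).trans_lt (ENNReal.natCast_lt_top _)⟩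

lemma conjCoords_apply {l : ℕ} (σ : Fin l → Bool) (w : Fin l → ℂ) (t : Fin l) :
    conjCoords σ w t = conjIf (σ t) (w t) := rfl

lemma continuous_conjIf (ε : Bool) : Continuous (conjIf ε) := by
  cases ε
  · exact continuous_id
  · exact Complex.continuous_conj

lemma zeroTuples_box (k l : ℕ) (p : ℝ[X]) {S : Fin k → Set ℝ} {T : Fin l → Set ℂ}
    (hS : ∀ s, MeasurableSet (S s)) (hT : ∀ t, MeasurableSet (T t)) :
    zeroTuples k l p (Set.univ.pi S ×ˢ Set.univ.pi T) = ENNReal.ofReal (∑ σ : Fin l → Bool,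
      (∑ i : Fin k ↪ p.roots, ∏ s, (S s).indicator (1 : ℝ → ℂ) (i s).1) *
      ∑ j : Fin l ↪ upperZeros p, ∏ t, (conjIf (σ t) ⁻¹' T t).indicator (1 : ℂ → ℂ) (j t).1).re := by
  have hone {α ι : Type} [Fintype ι] (A : ι → Set α) (x : ι → α) :
      ∏ s, (A s).indicator (1 : α → ℂ) (x s) = (({x | ∀ s, x s ∈ A s} : Set (ι → α)).indicator 1 x : ℝ) := by
    by_cases h : ∀ s, x s ∈ A s
    · rw [Set.indicator_of_mem (by exact h), Finset.prod_eq_one]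
      · simp
      · intro s _; rw [Set.indicator_of_mem (h s)]; rfl
    · rw [Set.indicator_of_notMem (by exact h)]
      push Not at h
      obtain ⟨s, hs⟩ := h
      rw [Finset.prod_eq_zero (Finset.mem_univ s) (Set.indicator_of_notMem hs _)]
      simp
  have hnn {α : Type} (A : Set α) (x : α) : 0 ≤ A.indicator (1 : α → ℝ) x :=
    Set.indicator_nonneg (fun _ _ => zero_le_one) _
  rw [zeroTuples_apply _ _ _ ((MeasurableSet.univ_pi hS).prod (MeasurableSet.univ_pi hT))]
  simp only [hone]
  simp only [← Complex.ofReal_sum, ← Complex.ofReal_mul, Complex.ofReal_re]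
  simp only [Finset.sum_mul_sum]
  rw [Finset.sum_comm (s := (Finset.univ : Finset (Fin l → Bool)))]
  rw [ENNReal.ofReal_sum_of_nonneg fun i _ => Finset.sum_nonneg fun j _ =>
    Finset.sum_nonneg fun σ _ => mul_nonneg (hnn _ _) (hnn _ _)]
  refine Finset.sum_congr rfl fun i _ => ?_
  rw [Finset.sum_comm, ENNReal.ofReal_sum_of_nonneg fun σ _ =>
    Finset.sum_nonneg fun j _ => mul_nonneg (hnn _ _) (hnn _ _)]
  refine Finset.sum_congr rfl fun σ _ => ?_
  rw [ENNReal.ofReal_sum_of_nonneg fun j _ => mul_nonneg (hnn _ _) (hnn _ _)]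
  refine Finset.sum_congr rfl fun j _ => ?_
  by_cases h1 : ∀ s, (i s).1 ∈ S s <;>
  by_cases h2 : ∀ t, conjIf (σ t) (j t).1 ∈ T t <;>
  simp [Set.indicator, h1, h2, conjCoords_apply, Set.mem_pi]

/-- The tuples of zeros form a measurable random measure; boxes are a generating π-system on which
the counts of tuples are polynomials in counts of single zeros. -/
lemma RandomZeros.IsRandomPoly.measurable_zeroTuples (hf : IsRandomPoly n f) (k l : ℕ) :
    Measurable fun η => zeroTuples k l (f η) := by
  have hreal (S : Set ℝ) (hS : MeasurableSet S) :
      Measurable fun η => ∑ j : (f η).roots, S.indicator (1 : ℝ → ℂ) j.1 := by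
    have h := hf.measurable_sum_indicator (S := {z : ℂ | z.im = 0} ∩ Complex.re ⁻¹' S)
      ((measurableSet_eq_fun Complex.measurable_im measurable_const).inter
        (Complex.measurable_re hS))
    convert h using 1
    funext η
    have h1 := sum_roots_eq (f η) (fun z => S.indicator (1 : ℝ → ℂ) z.re)
    simp only [Complex.ofReal_re] at h1
    rw [h1]
    refine Finset.sum_congr rfl fun i _ => ?_
    simp only [Set.indicator, Set.mem_inter_iff, Set.mem_ofPred_eq, Set.mem_preimage, Pi.one_apply]
    split_ifs <;> simp_all
  have hupper (T : Set ℂ) (hT : MeasurableSet T) :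
      Measurable fun η => ∑ j : upperZeros (f η), T.indicator (1 : ℂ → ℂ) j.1 := by
    have h := hf.measurable_sum_indicator (S := {z : ℂ | 0 < z.im} ∩ T)
      ((measurableSet_lt measurable_const Complex.measurable_im).inter hT)
    convert h using 1
    funext η
    have h1 := sum_upperZeros_eq (f η) false (fun z => T.indicator (1 : ℂ → ℂ) z)
    simp only [conjIf, cond_false] at h1
    rw [h1]
    refine Finset.sum_congr rfl fun i _ => ?_
    by_cases h2 : 0 < i.1.im <;> by_cases h3 : i.1 ∈ T <;> simp [h2, h3]
  have hbox (S : Fin k → Set ℝ) (T : Fin l → Set ℂ) (hS : ∀ s, MeasurableSet (S s))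
      (hT : ∀ t, MeasurableSet (T t)) :
      Measurable fun η => zeroTuples k l (f η) (Set.univ.pi S ×ˢ Set.univ.pi T) := by
    simp only [zeroTuples_box k l _ hS hT]
    refine (Complex.measurable_re.comp ?_).ennreal_ofReal
    refine Finset.measurable_sum _ fun σ _ => ?_
    exact (measurable_sum_embedding _ hreal k S hS).mul
      (measurable_sum_embedding _ hupper l _ fun t =>
        (continuous_conjIf _).measurable (hT t))
  have hspan {ι : Type} {α : Type} [MeasurableSpace α] : IsCountablySpanning
      (Set.univ.pi '' Set.univ.pi fun _ : ι => {s : Set α | MeasurableSet s}) :=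
    ⟨fun _ => Set.univ, fun _ => ⟨fun _ => Set.univ, fun _ _ => MeasurableSet.univ,
      Set.pi_univ _⟩, Set.iUnion_const _⟩
  have hgen := generateFrom_prod_eq (hspan (ι := Fin k) (α := ℝ)) (hspan (ι := Fin l) (α := ℂ))
  rw [generateFrom_pi, generateFrom_pi] at hgen
  refine Measurable.measure_of_isPiSystem hgen (isPiSystem_pi.prod isPiSystem_pi) ?_ ?_
  · rintro _ ⟨_, ⟨S, hS, rfl⟩, _, ⟨T, hT, rfl⟩, rfl⟩
    exact hbox S T (fun s => hS s trivial) (fun t => hT t trivial)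
  · have := hbox (fun _ => Set.univ) (fun _ => Set.univ) (fun _ => MeasurableSet.univ)
      fun _ => MeasurableSet.univ
    simpa using this

/-- Integrals against the mixed correlation measure are expected sums over tuples of zeros. -/
lemma integral_mixedCorr {P : Measure Ω} [IsProbabilityMeasure P] (hf : IsRandomPoly n f)
    {k l : ℕ} {G : (Fin k → ℝ) × (Fin l → ℂ) → ℂ} (hG : Continuous G) {M : ℝ}
    (hM : ∀ q, ‖G q‖ ≤ M) :
    ∫ q, G q ∂(mixedCorr P f k l) = ∫ η, ∫ q, G q ∂(zeroTuples k l (f η)) ∂P := by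
  let κ : ProbabilityTheory.Kernel Ω ((Fin k → ℝ) × (Fin l → ℂ)) :=
    ⟨fun η => zeroTuples k l (f η), hf.measurable_zeroTuples k l⟩
  have hfin : IsFiniteMeasure (mixedCorr P f k l) := by
    refine ⟨?_⟩
    rw [mixedCorr, Measure.bind_apply MeasurableSet.univ (hf.measurable_zeroTuples k l).aemeasurable]
    calc _ ≤ ∫⁻ _, ((n ^ k * n ^ l * 2 ^ l : ℕ) : ℝ≥0∞) ∂P :=
          lintegral_mono fun η => zeroTuples_univ_le k l (hf.natDegree_le η)
      _ < ⊤ := by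
        rw [lintegral_const, measure_univ, mul_one]
        exact ENNReal.natCast_lt_top _
  have hcomp : (κ.comp (ProbabilityTheory.Kernel.const Unit P)) () = mixedCorr P f k l := by
    rw [ProbabilityTheory.Kernel.comp_apply]
    rfl
  have hint : Integrable G ((κ.comp (ProbabilityTheory.Kernel.const Unit P)) ()) := by
    rw [hcomp]
    exact (integrable_const (μ := mixedCorr P f k l) M).mono' hG.aestronglyMeasurable
      (Filter.Eventually.of_forall hM)
  have h := ProbabilityTheory.Kernel.integral_comp hint
  rw [hcomp] at h
  exact h

lemma measurable_integral_zeroTuples (hf : IsRandomPoly n f)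
    {k l : ℕ} {G : (Fin k → ℝ) × (Fin l → ℂ) → ℂ} (hG : Continuous G) :
    StronglyMeasurable fun η => ∫ q, G q ∂(zeroTuples k l (f η)) := by
  let κ : ProbabilityTheory.Kernel Ω ((Fin k → ℝ) × (Fin l → ℂ)) :=
    ⟨fun η => zeroTuples k l (f η), hf.measurable_zeroTuples k l⟩
  have : ProbabilityTheory.IsFiniteKernel κ := ⟨(n ^ k * n ^ l * 2 ^ l : ℕ), ENNReal.natCast_lt_top _,
    fun η => zeroTuples_univ_le k l (hf.natDegree_le η)⟩
  exact StronglyMeasurable.integral_kernel (κ := κ) hG.stronglyMeasurable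

lemma integral_zeroTuples (k l : ℕ) (p : ℝ[X]) {G : (Fin k → ℝ) × (Fin l → ℂ) → ℂ}
    (hG : Continuous G) :
    ∫ q, G q ∂(zeroTuples k l p) = ∑ i : Fin k ↪ p.roots, ∑ j : Fin l ↪ upperZeros p,
      ∑ σ : Fin l → Bool, G (fun s => (i s).1, conjCoords σ fun t => (j t).1) := by
  have hd (x : (Fin k → ℝ) × (Fin l → ℂ)) : Integrable G (Measure.dirac x) :=
    (integrable_const ‖G x‖).mono' hG.aestronglyMeasurable
      ((ae_dirac_iff (measurableSet_le hG.norm.measurable measurable_const)).2 le_rfl)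
  rw [zeroTuples, integral_finsetSum_measure]
  · refine Finset.sum_congr (by ext; simp) fun i _ => ?_
    rw [integral_finsetSum_measure]
    · refine Finset.sum_congr (by ext; simp) fun j _ => ?_
      rw [integral_finsetSum_measure fun σ _ => hd _]
      exact Finset.sum_congr (by ext; simp) fun σ _ => integral_dirac _ _
    · exact fun j _ => integrable_finsetSum_measure.2 fun σ _ => hd _
  · exact fun i _ => integrable_finsetSum_measure.2 fun j _ =>
      integrable_finsetSum_measure.2 fun σ _ => hd _

end Tuples

/-! ### Truncation of the logarithm -/

section Truncation

/-- A smooth cutoff on the line, equal to `1` on `[-1,1]` and supported in `(-2,2)`. -/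
def cutoff : ContDiffBump (0 : ℝ) := ⟨1, 2, one_pos, one_lt_two⟩

lemma cutoff_of_abs_le {t : ℝ} (h : |t| ≤ 1) : cutoff t = 1 :=
  cutoff.one_of_mem_closedBall (by simpa [cutoff] using h)

lemma cutoff_of_two_le {t : ℝ} (h : 2 ≤ |t|) : cutoff t = 0 :=
  cutoff.zero_of_le_dist (by simpa [cutoff] using h)

lemma smoothBdd_cutoff : SmoothBdd fun t : ℝ => (cutoff t : ℂ) :=
  SmoothBdd.of_hasCompactSupport (Complex.ofRealCLM.contDiff.comp cutoff.contDiff)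
    (cutoff.hasCompactSupport.comp_left Complex.ofReal_zero)

/-- Smooth truncation of a real number at height `T`. -/
def trunc (T t : ℝ) : ℝ := t * cutoff (t / T)

lemma abs_trunc_le_abs (T t : ℝ) : |trunc T t| ≤ |t| := by
  rw [trunc, abs_mul, abs_of_nonneg cutoff.nonneg]
  exact mul_le_of_le_one_right (abs_nonneg _) cutoff.le_one

lemma abs_trunc_le {T : ℝ} (hT : 0 < T) (t : ℝ) : |trunc T t| ≤ 2 * T := by
  rcases le_or_gt |t| (2 * T) with h | h
  · exact (abs_trunc_le_abs T t).trans h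
  · rw [trunc, cutoff_of_two_le, mul_zero, abs_zero]
    · positivity
    · rw [abs_div, abs_of_pos hT, le_div_iff₀ hT]
      exact h.le

lemma abs_sub_trunc_le {T : ℝ} (hT : 0 < T) (q : ℕ) (t : ℝ) :
    |t - trunc T t| ≤ |t| ^ (q + 1) / T ^ q := by
  rcases le_or_gt |t| T with h | h
  · rw [trunc, cutoff_of_abs_le, mul_one, sub_self, abs_zero]
    · positivity
    · rw [abs_div, abs_of_pos hT, div_le_one hT]
      exact h
  · have h1 : |t - trunc T t| ≤ |t| := by
      have : t - trunc T t = t * (1 - cutoff (t / T)) := by rw [trunc]; ring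
      rw [this, abs_mul]
      refine mul_le_of_le_one_right (abs_nonneg _) ?_
      rw [abs_of_nonneg (by linarith [cutoff.le_one (x := t / T)])]
      linarith [cutoff.nonneg (x := t / T)]
    rw [le_div_iff₀ (by positivity), pow_succ']
    gcongr

lemma continuous_trunc (T : ℝ) : Continuous (trunc T) :=
  continuous_id.mul (cutoff.continuous.comp (continuous_id.div_const T))

@[simp] lemma trunc_zero (T : ℝ) : trunc T 0 = 0 := by simp [trunc]

lemma trunc_eq_smul {T : ℝ} (hT : T ≠ 0) (t : ℝ) : trunc T t = T * trunc 1 (t / T) := by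
  simp only [trunc, div_one]
  field_simp

lemma abs_prod_sub_prod_le {ι : Type*} [DecidableEq ι] (s : Finset ι) (a b : ι → ℝ)
    (h : ∀ i, |b i| ≤ |a i|) :
    |∏ i ∈ s, a i - ∏ i ∈ s, b i| ≤
      ∑ j ∈ s, ∏ i ∈ s, if i = j then |a i - b i| else |a i| := by
  induction s using Finset.induction_on with
  | empty => simp
  | insert x s hx ih =>
    rw [Finset.prod_insert hx, Finset.prod_insert hx, Finset.sum_insert hx]
    have h1 : ∏ i ∈ insert x s, (if i = x then |a i - b i| else |a i|) =
        |a x - b x| * ∏ i ∈ s, |a i| := by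
      rw [Finset.prod_insert hx, if_pos rfl]
      congr 1
      refine Finset.prod_congr rfl fun i hi => ?_
      rw [if_neg]
      rintro rfl
      exact hx hi
    have h2 : ∑ j ∈ s, ∏ i ∈ insert x s, (if i = j then |a i - b i| else |a i|) =
        |a x| * ∑ j ∈ s, ∏ i ∈ s, if i = j then |a i - b i| else |a i| := by
      rw [Finset.mul_sum]
      refine Finset.sum_congr rfl fun j hj => ?_
      rw [Finset.prod_insert hx, if_neg]
      rintro rfl
      exact hx hj
    rw [h1, h2]
    have h3 : a x * ∏ i ∈ s, a i - b x * ∏ i ∈ s, b i =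
        (a x - b x) * ∏ i ∈ s, a i + b x * (∏ i ∈ s, a i - ∏ i ∈ s, b i) := by ring
    rw [h3]
    refine (abs_add_le _ _).trans (add_le_add ?_ ?_)
    · rw [abs_mul, Finset.abs_prod]
    · rw [abs_mul]
      exact mul_le_mul (h x) ih (abs_nonneg _) (abs_nonneg _)

/-- The total weight of the zeros of `p` as seen from `w`. It controls all moments of the
interpolation defect of `log |p|` around `w`. -/
def zeroWeight (w : ℂ) (p : ℝ[X]) : ℝ := ∑ i : RootIdx p, decayWeight w i.1

lemma zeroWeight_nonneg (w : ℂ) (p : ℝ[X]) : 0 ≤ zeroWeight w p :=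
  Finset.sum_nonneg fun _ _ => (decayWeight_pos _ _).le

lemma measurable_interpDefect_poly (p : ℝ[X]) : Measurable (polyDefect p) :=
  measurable_interpDefect (p.continuous_aeval.norm.measurable.log)

lemma exists_integral_abs_polyDefect_pow_le (n : ℕ) (hn : n ≠ 0) (R : ℝ) (hR : 1 ≤ R) :
    ∃ D : ℝ, 0 ≤ D ∧ ∀ (p : ℝ[X]) (w : ℂ),
      Integrable (fun y => |polyDefect p y| ^ n) (sampleMeasure w R) ∧
      ∫ y, |polyDefect p y| ^ n ∂(sampleMeasure w R) ≤ D * zeroWeight w p ^ n := by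
  obtain ⟨D, hD, h⟩ := exists_integral_abs_sum_logDefect_pow_le n hn R hR
  refine ⟨D, hD, fun p w => ?_⟩
  rcases eq_or_ne p 0 with rfl | hp
  · simp only [polyDefect_zero, abs_zero, zero_pow hn, integral_zero]
    exact ⟨integrable_zero _ _ _, mul_nonneg hD (pow_nonneg (zeroWeight_nonneg _ _) _)⟩
  · have hae : ∀ᵐ y ∂(sampleMeasure w R),
        |∑ i : RootIdx p, logDefect i.1 y| ^ n = |polyDefect p y| ^ n := by
      filter_upwards [ae_aeval_samplePoint_ne hp w R] with y hy
      rw [polyDefect_eq_sum hy]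
    obtain ⟨h1, h2⟩ := h (fun i : RootIdx p => i.1) w
    refine ⟨h1.congr hae, ?_⟩
    rw [← integral_congr_ae hae]
    exact h2

/-- Truncating each factor of the multilinear integral of `log |p|` at height `T` costs little,
since high moments are available. -/
lemma exists_norm_integral_prod_sub_trunc_le (m q : ℕ) (R : ℝ) (hR : 1 ≤ R) :
    ∃ D : ℝ, 0 ≤ D ∧ ∀ (p : ℝ[X]) (w : Fin (m + 1) → ℂ) (Q T B : ℝ)
      (H : (Fin (m + 1) → ℂ × ℂ) → ℂ),
      0 < T → (∀ j, zeroWeight (w j) p ≤ Q) → Continuous H → (∀ y, ‖H y‖ ≤ B) →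
      ‖(∫ y, (∏ j, polyDefect p (y j)) • H y ∂(tupleMeasure w R)) -
          ∫ y, (∏ j, trunc T (polyDefect p (y j))) • H y ∂(tupleMeasure w R)‖ ≤
        D * B * (Q ^ (m + 1 + q) / T ^ q) := by
  obtain ⟨D₁, hD₁, h₁⟩ := exists_integral_abs_polyDefect_pow_le 1 one_ne_zero R hR
  obtain ⟨D₂, hD₂, h₂⟩ := exists_integral_abs_polyDefect_pow_le (q + 1) (Nat.succ_ne_zero q) R hR
  refine ⟨(m + 1) * (D₂ * D₁ ^ m), by positivity, fun p w Q T B H hT hQ hH hB => ?_⟩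
  have hQ0 : 0 ≤ Q := (zeroWeight_nonneg _ _).trans (hQ 0)
  have hB0 : 0 ≤ B := (norm_nonneg _).trans (hB default)
  have hVm := measurable_interpDefect_poly p
  have hi1 (j : Fin (m + 1)) : Integrable (polyDefect p) (sampleMeasure (w j) R) := by
    have := (h₁ p (w j)).1
    simp only [pow_one] at this
    exact (integrable_norm_iff hVm.aestronglyMeasurable).1 this
  have hit (j : Fin (m + 1)) : Integrable (fun y => trunc T (polyDefect p y))
      (sampleMeasure (w j) R) := by
    refine (hi1 j).mono ((continuous_trunc T).measurable.comp hVm).aestronglyMeasurable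
      (Filter.Eventually.of_forall fun y => ?_)
    exact abs_trunc_le_abs T _
  have hsm {F : (Fin (m + 1) → ℂ × ℂ) → ℝ} (hF : Integrable F (tupleMeasure w R)) :
      Integrable (fun y => F y • H y) (tupleMeasure w R) := by
    refine (hF.norm.mul_const B).mono' (hF.aestronglyMeasurable.smul hH.aestronglyMeasurable)
      (Filter.Eventually.of_forall fun y => ?_)
    rw [norm_smul]
    gcongr
    exact hB y
  have hI1 : Integrable (fun y : Fin (m + 1) → ℂ × ℂ => ∏ j, polyDefect p (y j))
      (tupleMeasure w R) := Integrable.fintype_prod_dep hi1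
  have hI2 : Integrable (fun y : Fin (m + 1) → ℂ × ℂ => ∏ j, trunc T (polyDefect p (y j)))
      (tupleMeasure w R) :=
    Integrable.fintype_prod_dep (f := fun _ y => trunc T (polyDefect p y)) hit
  rw [← integral_sub (hsm hI1) (hsm hI2)]
  let g : Fin (m + 1) → Fin (m + 1) → ℂ × ℂ → ℝ := fun j i y =>
    if i = j then |polyDefect p y| ^ (q + 1) / T ^ q else |polyDefect p y|
  have hgi (j i : Fin (m + 1)) : Integrable (g j i) (sampleMeasure (w i) R) := by
    by_cases hij : i = j
    · simp only [g, if_pos hij]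
      exact (h₂ p (w i)).1.div_const _
    · simp only [g, if_neg hij]
      exact (hi1 i).abs
  have hgprod (j : Fin (m + 1)) : Integrable (fun y : Fin (m + 1) → ℂ × ℂ => ∏ i, g j i (y i))
      (tupleMeasure w R) := Integrable.fintype_prod_dep (hgi j)
  have hpt (y : Fin (m + 1) → ℂ × ℂ) :
      ‖(∏ j, polyDefect p (y j)) • H y - (∏ j, trunc T (polyDefect p (y j))) • H y‖ ≤
        B * ∑ j, ∏ i, g j i (y i) := by
    rw [← sub_smul, norm_smul, mul_comm]
    refine mul_le_mul (hB y) ?_ (norm_nonneg _) hB0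
    refine (abs_prod_sub_prod_le _ _ _ fun i => abs_trunc_le_abs T _).trans ?_
    refine Finset.sum_le_sum fun j _ => Finset.prod_le_prod (fun i _ => ?_) fun i _ => ?_
    · split_ifs <;> positivity
    · simp only [g]
      split_ifs
      · exact abs_sub_trunc_le hT q _
      · exact le_rfl
  refine (norm_integral_le_of_norm_le ((integrable_finsetSum _ fun j _ => hgprod j).const_mul B)
    (Filter.Eventually.of_forall hpt)).trans ?_
  rw [integral_const_mul, integral_finsetSum _ fun j _ => hgprod j]
  have hj (j : Fin (m + 1)) : ∫ y, ∏ i, g j i (y i) ∂(tupleMeasure w R) ≤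
      (D₂ * Q ^ (q + 1) / T ^ q) * (D₁ * Q) ^ m := by
    rw [tupleMeasure, integral_fintype_prod_eq_prod]
    rw [← Finset.mul_prod_erase _ _ (Finset.mem_univ j)]
    have hnn (i : Fin (m + 1)) : 0 ≤ ∫ y, g j i y ∂(sampleMeasure (w i) R) := by
      refine integral_nonneg fun y => ?_
      simp only [g]
      split_ifs <;> positivity
    refine mul_le_mul ?_ ?_ (Finset.prod_nonneg fun i _ => hnn i) (by positivity)
    · simp only [g, if_true]
      rw [integral_div]
      gcongr
      refine ((h₂ p (w j)).2).trans ?_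
      gcongr
      · exact zeroWeight_nonneg _ _
      · exact hQ j
    · have hcard : (Finset.univ.erase j).card = m := by simp
      have hpow : (D₁ * Q) ^ m = ∏ _i ∈ Finset.univ.erase j, (D₁ * Q) := by
        rw [Finset.prod_const, hcard]
      rw [hpow]
      refine Finset.prod_le_prod (fun i _ => hnn i) fun i hi => ?_
      simp only [g, if_neg (Finset.ne_of_mem_erase hi)]
      have := (h₁ p (w i)).2
      simp only [pow_one] at this
      refine this.trans ?_
      gcongr
      exact hQ i
  calc B * ∑ j, ∫ y, ∏ i, g j i (y i) ∂(tupleMeasure w R)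
      ≤ B * ∑ _j : Fin (m + 1), (D₂ * Q ^ (q + 1) / T ^ q) * (D₁ * Q) ^ m := by
        gcongr with j
        exact hj j
    _ = _ := by
        rw [Finset.sum_const, Finset.card_univ, Fintype.card_fin, nsmul_eq_mul, mul_pow]
        push_cast
        ring

end Truncation

/-! ### Test statistics of the log-magnitudes -/

section Statistic

/-- The product of the truncated coordinates. -/
def truncProd (m : ℕ) (t : Fin m → ℝ) : ℂ := ∏ j, (trunc 1 (t j) : ℂ)

lemma smoothBdd_truncProd (m : ℕ) : SmoothBdd (truncProd m) := by
  have h1 : SmoothBdd fun t : ℝ => (trunc 1 t : ℂ) := by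
    have hs : ContDiff ℝ ∞ (trunc 1) := by
      have : trunc 1 = fun t => t * cutoff t := by funext t; simp [trunc]
      rw [this]
      exact contDiff_id.mul cutoff.contDiff
    refine SmoothBdd.of_hasCompactSupport (Complex.ofRealCLM.contDiff.comp hs) ?_
    refine HasCompactSupport.comp_left (g := Complex.ofReal) ?_ Complex.ofReal_zero
    have : trunc 1 = fun t => t * cutoff t := by funext t; simp [trunc]
    rw [this]
    exact cutoff.hasCompactSupport.mul_left
  exact SmoothBdd.prod Finset.univ fun j _ =>
    h1.comp_clm (ContinuousLinearMap.proj (R := ℝ) (φ := fun _ : Fin m => ℝ) j)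

/-- The linear map taking the values of `log |p|` at the sample points of the tuple `y` to the
interpolation defects, divided by `T`. -/
def defectMap {m : ℕ} (T : ℝ) (y : Fin m → ℂ × ℂ) : (Fin (m * 4) → ℂ) →L[ℝ] (Fin m → ℝ) :=
  ContinuousLinearMap.pi fun j => T⁻¹ • ∑ q, sampleCoeff (y j) q •
    Complex.reCLM.comp (ContinuousLinearMap.proj (R := ℝ) (φ := fun _ : Fin (m * 4) => ℂ)
      (finProdFinEquiv (j, q)))

/-- All sample points of the tuple `y`. -/
def tuplePoints {m : ℕ} (y : Fin m → ℂ × ℂ) : Fin (m * 4) → ℂ := fun s =>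
  samplePoint (y (finProdFinEquiv.symm s).1) (finProdFinEquiv.symm s).2

lemma norm_defectMap_le {m : ℕ} {w : Fin m → ℂ} {R T : ℝ} (hR : 1 ≤ R) (hT : 1 ≤ T)
    {y : Fin m → ℂ × ℂ} (hy : ∀ j, (y j).1 ∈ Metric.ball (w j) R ∧ (y j).2 ∈ Metric.ball (w j) 1) :
    ‖defectMap T y‖ ≤ 4 * (2 * R + 3) := by
  have hR0 : 0 ≤ 4 * (2 * R + 3) := by linarith
  refine ContinuousLinearMap.opNorm_le_bound _ hR0 fun v => ?_
  refine (pi_norm_le_iff_of_nonneg (mul_nonneg hR0 (norm_nonneg _))).2 fun j => ?_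
  simp only [defectMap, ContinuousLinearMap.coe_pi', _root_.smul_apply,
    _root_.sum_apply, ContinuousLinearMap.comp_apply, ContinuousLinearMap.proj_apply,
    Complex.reCLM_apply, smul_eq_mul]
  rw [norm_mul, Real.norm_eq_abs, abs_of_nonneg (by positivity)]
  have h1 : ‖∑ q, sampleCoeff (y j) q * (v (finProdFinEquiv (j, q))).re‖ ≤
      ∑ _q : Fin 4, (2 * R + 3) * ‖v‖ := by
    refine (norm_sum_le _ _).trans (Finset.sum_le_sum fun q _ => ?_)
    rw [norm_mul]
    refine mul_le_mul (abs_sampleCoeff_le hR (hy j).1 (hy j).2 q) ?_ (norm_nonneg _) (by linarith)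
    exact (Complex.abs_re_le_norm _).trans (norm_le_pi_norm v _)
  have hT1 : T⁻¹ ≤ 1 := inv_le_one_of_one_le₀ hT
  calc _ ≤ 1 * ∑ _q : Fin 4, (2 * R + 3) * ‖v‖ := by gcongr
    _ = _ := by
      rw [Finset.sum_const, Finset.card_univ, Fintype.card_fin, nsmul_eq_mul]
      push_cast
      ring

/-- The product of the truncated interpolation defects is a test statistic of the log-magnitudes at
the `4 m` sample points; the normalisation by `T` makes the test function independent of `T` up to
a linear change of variables of bounded norm. -/
lemma logStat_truncProd {m : ℕ} {T : ℝ} (hT : 0 < T) (y : Fin m → ℂ × ℂ) {p : ℝ[X]}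
    (hp : ∀ j q, p.aeval (samplePoint (y j) q) ≠ 0) :
    ((T ^ m : ℝ) : ℂ) * logStat (fun v => truncProd m (defectMap T y v)) (tuplePoints y) p =
      ((∏ j, trunc T (polyDefect p (y j)) : ℝ) : ℂ) := by
  have hs : ∀ s, p.aeval (tuplePoints y s) ≠ 0 := fun s => hp _ _
  rw [logStat, if_pos hs]
  simp only [truncProd]
  have h1 (j : Fin m) : defectMap T y
      (fun s => (Real.log ‖p.aeval (tuplePoints y s)‖ : ℂ)) j = polyDefect p (y j) / T := by
    simp only [defectMap, ContinuousLinearMap.coe_pi', _root_.smul_apply,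
      _root_.sum_apply, ContinuousLinearMap.comp_apply,
      ContinuousLinearMap.proj_apply, Complex.reCLM_apply, smul_eq_mul, Complex.ofReal_re,
      tuplePoints, Equiv.symm_apply_apply]
    rw [polyDefect, interpDefect, div_eq_inv_mul]
  simp only [h1]
  rw [← Complex.ofReal_prod, ← Complex.ofReal_mul]
  congr 1
  have h2 : T ^ m = ∏ _j : Fin m, T := by simp
  rw [h2, ← Finset.prod_mul_distrib]
  exact Finset.prod_congr rfl fun j _ => (trunc_eq_smul hT.ne' _).symm

lemma norm_complexBasis_le (m : ℕ) (i : Σ _ : Fin m, Fin 2) : ‖complexBasis m i‖ ≤ 1 := by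
  obtain ⟨j, e⟩ := i
  rw [complexBasis, Pi.basis_apply]
  refine norm_single_le_one j ?_
  fin_cases e <;> simp

lemma gradNorm_complexBasis_le {m a : ℕ} {F : (Fin m → ℂ) → ℂ} {w : Fin m → ℂ} {B : ℝ}
    (h : ‖iteratedFDeriv ℝ a F w‖ ≤ B) :
    gradNorm (complexBasis m) a F w ≤ ((2 * m + 1 : ℕ) : ℝ) ^ a * B := by
  have hB : 0 ≤ B := (norm_nonneg _).trans h
  have hterm (i : Fin a → (Σ _ : Fin m, Fin 2)) :
      ‖iteratedFDeriv ℝ a F w (fun j => complexBasis m (i j))‖ ≤ B := by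
    refine ((iteratedFDeriv ℝ a F w).le_opNorm _).trans ?_
    have : ∏ j, ‖complexBasis m (i j)‖ ≤ 1 :=
      Finset.prod_le_one (fun _ _ => norm_nonneg _) fun j _ => norm_complexBasis_le m _
    calc _ ≤ B * 1 := by gcongr
      _ = B := mul_one B
  rw [gradNorm]
  refine Real.sqrt_le_iff.2 ⟨by positivity, ?_⟩
  calc _ ≤ ∑ _i : Fin a → (Σ _ : Fin m, Fin 2), B ^ 2 := by
        gcongr with i
        exact hterm i
    _ = ((2 * m : ℕ) : ℝ) ^ a * B ^ 2 := by
        simp [mul_comm]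
    _ ≤ ((2 * m + 1 : ℕ) : ℝ) ^ (a * 2) * B ^ 2 := by
        gcongr ?_ * _
        calc ((2 * m : ℕ) : ℝ) ^ a ≤ ((2 * m + 1 : ℕ) : ℝ) ^ a := by
              gcongr
              exact Nat.le_succ _
          _ ≤ ((2 * m + 1 : ℕ) : ℝ) ^ (a * 2) := by
              refine pow_le_pow_right₀ ?_ (by omega)
              exact_mod_cast Nat.le_add_left 1 (2 * m)
    _ = _ := by rw [mul_pow, ← pow_mul]

end Statistic

/-! ### Comparison of smooth linear statistics -/

section Comparison

lemma measurable_decayWeight (w : ℂ) : Measurable (decayWeight w) := by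
  unfold decayWeight; fun_prop

lemma RandomZeros.IsRandomPoly.measurable_zeroWeight {Ω : Type*} [MeasurableSpace Ω] {n : ℕ}
    {f : Ω → ℝ[X]} (hf : IsRandomPoly n f) (w : ℂ) : Measurable fun η => zeroWeight w (f η) := by
  have hm : Measurable fun ζ => ENNReal.ofReal (decayWeight w ζ) :=
    (measurable_decayWeight w).ennreal_ofReal
  have h := ((Measure.measurable_lintegral hm).comp hf.measurable_rootMeasure).ennreal_toReal
  convert h using 1
  funext η
  simp only [Function.comp_apply]
  rw [rootMeasure, lintegral_finsetSum_measure]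
  simp only [lintegral_dirac' _ hm]
  rw [ENNReal.toReal_sum fun _ _ => ENNReal.ofReal_ne_top]
  exact Finset.sum_congr rfl fun i _ => (ENNReal.toReal_ofReal (decayWeight_pos _ _).le).symm

lemma norm_rootSum_le {m n : ℕ} {h : (Fin m → ℂ) → ℂ} {B : ℝ} (hB : ∀ v, ‖h v‖ ≤ B) {p : ℝ[X]}
    (hp : p.natDegree ≤ n) : ‖rootSum h p‖ ≤ (n : ℝ) ^ m * B := by
  have hB0 : 0 ≤ B := (norm_nonneg _).trans (hB 0)
  refine (norm_sum_le _ _).trans ((Finset.sum_le_sum fun i _ => hB _).trans ?_)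
  rw [Finset.sum_const, Finset.card_univ, Fintype.card_pi, Finset.prod_const, Finset.card_univ,
    Fintype.card_fin, nsmul_eq_mul]
  push_cast
  gcongr
  exact card_rootIdx_le hp

lemma logStat_const_mul {m : ℕ} (c : ℂ) (F : (Fin m → ℂ) → ℂ) (u : Fin m → ℂ) (p : ℝ[X]) :
    logStat (fun v => c * F v) u p = c * logStat F u p := by
  unfold logStat
  split_ifs <;> simp

/-- Divided by a constant `D`, the product of truncated defects has derivatives bounded by `1`, so
that the comparability of the log-magnitudes applies to it. -/
lemma exists_norm_integral_logStat_sub_le (m a₀ : ℕ) (R : ℝ) (hR : 1 ≤ R) :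
    ∃ D : ℝ, 0 < D ∧ ∀ {Ω Ω' : Type*} [MeasurableSpace Ω] [MeasurableSpace Ω']
      {P : Measure Ω} {P' : Measure Ω'} {f : Ω → ℝ[X]} {f' : Ω' → ℝ[X]} {n : ℕ} {C c₀ : ℝ}
      {U : Set ℂ} (w : Fin (m + 1) → ℂ) (y : Fin (m + 1) → ℂ × ℂ) (T : ℝ),
      1 ≤ n → 0 ≤ c₀ →
      LogComparable P P' f f' n C c₀ a₀ U → (((m + 1) * 4 : ℕ) : ℝ) ≤ (n : ℝ) ^ c₀ →
      (∀ j, Metric.ball (w j) (R + 2) ⊆ U) →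
      (∀ j, (y j).1 ∈ Metric.ball (w j) R ∧ (y j).2 ∈ Metric.ball (w j) 1) → 1 ≤ T →
      ‖(∫ η, logStat (fun v => truncProd (m + 1) (defectMap T y v)) (tuplePoints y) (f η) ∂P) -
          ∫ η, logStat (fun v => truncProd (m + 1) (defectMap T y v)) (tuplePoints y) (f' η) ∂P'‖ ≤
        D * (C * (n : ℝ) ^ (-c₀)) := by
  obtain ⟨B, hB1, hB⟩ := (smoothBdd_truncProd (m + 1)).exists_derivLE a₀
  set c : ℝ := 4 * (2 * R + 3) with hc
  have hc1 : 1 ≤ c := by rw [hc]; linarith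
  set D : ℝ := ((2 * ((m + 1) * 4) + 1 : ℕ) : ℝ) ^ a₀ * (B * c ^ a₀) with hD
  have hD0 : 0 < D := by positivity
  refine ⟨D, hD0, ?_⟩
  intro Ω Ω' _ _ P P' f f' n C c₀ U w y T hn hc₀ hcomp hmn hU hy hT
  have hsm := (smoothBdd_truncProd (m + 1)).1
  have hder : DerivLE a₀ (B * c ^ a₀) fun v => truncProd (m + 1) (defectMap T y v) := by
    have := DerivLE.comp_affine hsm hB (defectMap T y) hc1 (norm_defectMap_le hR hT hy) 0
    simpa using this
  let F : (Fin ((m + 1) * 4) → ℂ) → ℂ := fun v =>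
    ((D⁻¹ : ℝ) : ℂ) * truncProd (m + 1) (defectMap T y v)
  have hF0 : ContDiff ℝ ∞ fun v => truncProd (m + 1) (defectMap T y v) :=
    hsm.comp (defectMap T y).contDiff
  have hFs : ContDiff ℝ ∞ F := contDiff_const.mul hF0
  have hFg : ∀ a ≤ a₀, ∀ v, gradNorm (complexBasis _) a F v ≤ (n : ℝ) ^ c₀ := by
    intro a ha v
    have h1 : ‖iteratedFDeriv ℝ a F v‖ ≤ D⁻¹ * (B * c ^ a₀) := by
      have : F = (D⁻¹ : ℝ) • fun v => truncProd (m + 1) (defectMap T y v) := by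
        funext v; simp [F]
      rw [this, iteratedFDeriv_const_smul_apply (hF0.contDiffAt.of_le (by exact_mod_cast le_top)),
        norm_smul, Real.norm_of_nonneg (by positivity)]
      gcongr
      exact hder a ha v
    refine (gradNorm_complexBasis_le h1).trans ?_
    have hb1 : (1 : ℝ) ≤ ((2 * ((m + 1) * 4) + 1 : ℕ) : ℝ) := by
      exact_mod_cast Nat.le_add_left 1 _
    calc _ ≤ ((2 * ((m + 1) * 4) + 1 : ℕ) : ℝ) ^ a₀ * (D⁻¹ * (B * c ^ a₀)) := by
          gcongr
      _ = D⁻¹ * D := by rw [hD]; ring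
      _ = 1 := inv_mul_cancel₀ hD0.ne'
      _ ≤ (n : ℝ) ^ c₀ := Real.one_le_rpow (by exact_mod_cast hn) hc₀
  have hpts : ∀ s, tuplePoints y s ∈ U := fun s =>
    hU _ (samplePoint_mem_ball hR (hy _).1 (hy _).2 _)
  have key := hcomp ((m + 1) * 4) (by omega) hmn (tuplePoints y) hpts F hFs hFg
  simp only [F, logStat_const_mul, integral_const_mul] at key
  rw [← mul_sub, norm_mul, Complex.norm_real, Real.norm_of_nonneg (by positivity),
    inv_mul_le_iff₀ hD0] at key
  exact key

/-- At almost every sample tuple, the logarithms at the sample points are almost surely defined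
unless the polynomial vanishes identically. -/
lemma RandomZeros.IsRandomPoly.ae_tuple_ae {Ω : Type*} [MeasurableSpace Ω] {n : ℕ}
    {f : Ω → ℝ[X]} (hf : IsRandomPoly n f) (P : Measure Ω) [IsProbabilityMeasure P] {m : ℕ}
    (w : Fin m → ℂ) (R : ℝ) :
    ∀ᵐ y ∂(tupleMeasure w R), ∀ᵐ η ∂P,
      f η = 0 ∨ ∀ j q, (f η).aeval (samplePoint (y j) q) ≠ 0 := by
  have h1 : ∀ᵐ η ∂P, ∀ᵐ y ∂(tupleMeasure w R),
      f η = 0 ∨ ∀ j q, (f η).aeval (samplePoint (y j) q) ≠ 0 := by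
    refine Filter.Eventually.of_forall fun η => ?_
    rcases eq_or_ne (f η) 0 with h | h
    · simp [h]
    · filter_upwards [ae_tuple w R fun j => ae_aeval_samplePoint_ne h (w j) R] with y hy
      exact Or.inr hy
  refine (Measure.ae_ae_comm ?_).1 h1
  have h2 : MeasurableSet {x : Ω × (Fin m → ℂ × ℂ) | f x.1 = 0} := by
    have : {x : Ω × (Fin m → ℂ × ℂ) | f x.1 = 0} = ⋂ i : ℕ, {x | (f x.1).coeff i = 0} := by
      ext x
      simp [Polynomial.ext_iff]
    rw [this]
    exact MeasurableSet.iInter fun i =>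
      ((hf.measurable_coeff i).comp measurable_fst) (measurableSet_singleton 0)
  have h3 : MeasurableSet {x : Ω × (Fin m → ℂ × ℂ) |
      ∀ j q, (f x.1).aeval (samplePoint (x.2 j) q) ≠ 0} := by
    simp only [Set.ofPred_forall]
    refine MeasurableSet.iInter fun j => MeasurableSet.iInter fun q => ?_
    have hm : Measurable fun x : Ω × (Fin m → ℂ × ℂ) =>
        (f x.1).aeval (samplePoint (x.2 j) q) :=
      hf.measurable_aeval.comp (measurable_fst.prodMk
        ((measurable_samplePoint q).comp ((measurable_pi_apply j).comp measurable_snd)))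
    exact hm (measurableSet_singleton 0).compl
  exact h2.union h3

/-- The truncated multilinear integral of `log |p|` against `H`. -/
def truncStat {m : ℕ} (w : Fin m → ℂ) (R T : ℝ) (H : (Fin m → ℂ × ℂ) → ℂ) (p : ℝ[X]) : ℂ :=
  ∫ y, (∏ j, trunc T (polyDefect p (y j))) • H y ∂(tupleMeasure w R)

lemma abs_prod_trunc_le {m : ℕ} {T : ℝ} (hT : 0 < T) (p : ℝ[X]) (y : Fin m → ℂ × ℂ) :
    |∏ j, trunc T (polyDefect p (y j))| ≤ (2 * T) ^ m := by
  rw [Finset.abs_prod]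
  calc _ ≤ ∏ _j : Fin m, 2 * T :=
        Finset.prod_le_prod (fun _ _ => abs_nonneg _) fun j _ => abs_trunc_le hT _
    _ = _ := by simp

lemma norm_truncStat_le {m : ℕ} {w : Fin m → ℂ} {R T B : ℝ} {H : (Fin m → ℂ × ℂ) → ℂ}
    (hT : 0 < T) (hB : ∀ y, ‖H y‖ ≤ B) (p : ℝ[X]) :
    ‖truncStat w R T H p‖ ≤ (2 * T) ^ m * B * (tupleMeasure w R).real Set.univ := by
  refine norm_integral_le_of_norm_le_const (Filter.Eventually.of_forall fun y => ?_)
  rw [norm_smul]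
  exact mul_le_mul (abs_prod_trunc_le hT p y) (hB y) (norm_nonneg _) (by positivity)

lemma RandomZeros.IsRandomPoly.measurable_prod_trunc {Ω : Type*} [MeasurableSpace Ω] {n : ℕ}
    {f : Ω → ℝ[X]} (hf : IsRandomPoly n f) {m : ℕ} (T : ℝ) :
    Measurable fun x : Ω × (Fin m → ℂ × ℂ) => ∏ j, trunc T (polyDefect (f x.1) (x.2 j)) := by
  refine Finset.measurable_prod _ fun j _ => ?_
  have h := hf.measurable_polyDefect_comp (X := Ω × (Fin m → ℂ × ℂ)) measurable_fst
      ((measurable_pi_apply j).comp measurable_snd)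
  exact (continuous_trunc T).measurable.comp h

lemma RandomZeros.IsRandomPoly.measurable_truncStat {Ω : Type*} [MeasurableSpace Ω] {n : ℕ}
    {f : Ω → ℝ[X]} (hf : IsRandomPoly n f) {m : ℕ} (w : Fin m → ℂ) (R T : ℝ)
    {H : (Fin m → ℂ × ℂ) → ℂ} (hH : Continuous H) :
    Measurable fun η => truncStat w R T H (f η) := by
  have h1 : Measurable fun x : Ω × (Fin m → ℂ × ℂ) =>
      (∏ j, trunc T (polyDefect (f x.1) (x.2 j))) • H x.2 :=
    (hf.measurable_prod_trunc T).smul (hH.measurable.comp measurable_snd)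
  exact (h1.stronglyMeasurable.integral_prod_right' (ν := tupleMeasure w R)).measurable

lemma RandomZeros.IsRandomPoly.integral_truncStat {Ω : Type*} [MeasurableSpace Ω] {n : ℕ}
    {f : Ω → ℝ[X]} (hf : IsRandomPoly n f) (P : Measure Ω) [IsProbabilityMeasure P] {m : ℕ}
    (w : Fin (m + 1) → ℂ) (R : ℝ) {T B : ℝ} (hT : 0 < T)
    {H : (Fin (m + 1) → ℂ × ℂ) → ℂ} (hH : Continuous H) (hB : ∀ y, ‖H y‖ ≤ B) :
    Integrable (fun y => ((T ^ (m + 1) : ℝ) : ℂ) *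
      (∫ η, logStat (fun v => truncProd (m + 1) (defectMap T y v)) (tuplePoints y) (f η) ∂P) * H y)
        (tupleMeasure w R) ∧
    ∫ η, truncStat w R T H (f η) ∂P = ∫ y, ((T ^ (m + 1) : ℝ) : ℂ) *
      (∫ η, logStat (fun v => truncProd (m + 1) (defectMap T y v)) (tuplePoints y) (f η) ∂P) * H y
        ∂(tupleMeasure w R) := by
  have h1 : Measurable fun x : Ω × (Fin (m + 1) → ℂ × ℂ) =>
      (∏ j, trunc T (polyDefect (f x.1) (x.2 j))) • H x.2 :=
    (hf.measurable_prod_trunc T).smul (hH.measurable.comp measurable_snd)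
  have hi : Integrable (fun x : Ω × (Fin (m + 1) → ℂ × ℂ) =>
      (∏ j, trunc T (polyDefect (f x.1) (x.2 j))) • H x.2) (P.prod (tupleMeasure w R)) := by
    refine Integrable.of_bound h1.aestronglyMeasurable ((2 * T) ^ (m + 1) * B)
      (Filter.Eventually.of_forall fun x => ?_)
    rw [norm_smul]
    exact mul_le_mul (abs_prod_trunc_le hT _ _) (hB _) (norm_nonneg _) (by positivity)
  have hae : (fun y => ∫ η, (∏ j, trunc T (polyDefect (f η) (y j))) • H y ∂P)
      =ᵐ[tupleMeasure w R] fun y => ((T ^ (m + 1) : ℝ) : ℂ) *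
        (∫ η, logStat (fun v => truncProd (m + 1) (defectMap T y v)) (tuplePoints y) (f η) ∂P) *
          H y := by
    filter_upwards [hf.ae_tuple_ae P w R] with y hy
    rw [← integral_const_mul, ← integral_mul_const]
    refine integral_congr_ae ?_
    filter_upwards [hy] with η hη
    rw [Complex.real_smul]
    congr 1
    rcases hη with h0 | hne
    · have : ¬ ∀ s : Fin ((m + 1) * 4), (0 : ℝ[X]).aeval (tuplePoints y s) ≠ 0 := by
        push Not
        exact ⟨finProdFinEquiv (0, 0), by simp⟩
      rw [h0, logStat, if_neg this, mul_zero]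
      simp [polyDefect_zero]
    · exact (logStat_truncProd hT y hne).symm
  refine ⟨hi.integral_prod_right.congr hae, ?_⟩
  simp only [truncStat]
  rw [integral_integral_swap hi]
  exact integral_congr_ae hae

lemma tupleMeasure_real_univ {m : ℕ} (w : Fin m → ℂ) {R : ℝ} (hR : 0 ≤ R) :
    (tupleMeasure w R).real Set.univ = (Real.pi * R ^ 2 * Real.pi) ^ m := by
  rw [tupleMeasure, Measure.real, Measure.pi_univ, ENNReal.toReal_prod]
  have h (j : Fin m) : (sampleMeasure (w j) R Set.univ).toReal = Real.pi * R ^ 2 * Real.pi :=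
    sampleMeasure_real_univ (w j) hR
  simp [h]

/-- A difference that is small on a likely event and bounded always has small expectation. -/
lemma norm_integral_sub_le_of_event {Ω E : Type*} [MeasurableSpace Ω] [NormedAddCommGroup E]
    [NormedSpace ℝ E] {P : Measure Ω} [IsProbabilityMeasure P] {X Y : Ω → E}
    (hX : Integrable X P) (hY : Integrable Y P) {S : Set Ω} (hS : MeasurableSet S) {a b δ : ℝ}
    (ha : 0 ≤ a) (hb : 0 ≤ b) (h1 : ∀ η ∉ S, ‖X η - Y η‖ ≤ a) (h2 : ∀ η, ‖X η - Y η‖ ≤ b)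
    (hδ : P.real S ≤ δ) : ‖(∫ η, X η ∂P) - ∫ η, Y η ∂P‖ ≤ a + b * δ := by
  rw [← integral_sub hX hY]
  have hi : Integrable (S.indicator fun _ => b) P := (integrable_const b).indicator hS
  refine (norm_integral_le_of_norm_le ((integrable_const a).add hi)
    (Filter.Eventually.of_forall fun η => ?_)).trans ?_
  · show ‖X η - Y η‖ ≤ a + S.indicator (fun _ => b) η
    by_cases h : η ∈ S
    · rw [Set.indicator_of_mem h]
      linarith [h2 η]
    · rw [Set.indicator_of_notMem h]
      linarith [h1 η h]
  · have : ∫ η, ((fun _ => a) + S.indicator (fun _ => b) : Ω → ℝ) η ∂P = a + P.real S * b := by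
      rw [integral_add' (integrable_const a) hi, integral_indicator_const b hS]
      simp
    rw [this, mul_comm]
    gcongr

/-- On average the zero statistic is close to its truncated integral representation. -/
lemma exists_norm_integral_truncStat_sub_le (m q : ℕ) (R : ℝ) (hR : 1 ≤ R) :
    ∃ D : ℝ, 0 < D ∧ ∀ {Ω : Type*} [MeasurableSpace Ω] {P : Measure Ω} [IsProbabilityMeasure P]
      {f : Ω → ℝ[X]} {n : ℕ} (w : Fin (m + 1) → ℂ) (T Q B δ : ℝ) (h : (Fin (m + 1) → ℂ) → ℂ),
      IsRandomPoly n f → 0 ≤ Q → 1 ≤ T → ContDiff ℝ ∞ h →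
      tsupport h ⊆ polyBall w R → (∀ v, ‖h v‖ ≤ B) → (∀ v, ‖iterLap h v‖ ≤ B) →
      P.real {η | ¬ ∀ j, zeroWeight (w j) (f η) ≤ Q} ≤ δ →
      ‖(∫ η, truncStat w R T (fun y => iterLap h fun j => (y j).1) (f η) ∂P) -
          ∫ η, (2 * Real.pi * Real.pi) ^ (m + 1) • rootSum h (f η) ∂P‖ ≤
        D * B * (Q ^ (m + 1 + q) / T ^ q + ((n : ℝ) ^ (m + 1) + T ^ (m + 1)) * δ) := by
  obtain ⟨D₂, hD₂, htr⟩ := exists_norm_integral_prod_sub_trunc_le m q R hR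
  set Γ : ℝ := (2 * Real.pi * Real.pi) ^ (m + 1) with hΓ
  have hΓ0 : 0 < Γ := by positivity
  set V : ℝ := (Real.pi * R ^ 2 * Real.pi) ^ (m + 1) with hV
  have hV0 : 0 ≤ V := by positivity
  refine ⟨D₂ + (2 ^ (m + 1) * V + Γ), by positivity, ?_⟩
  intro Ω _ P _ f n w T Q B δ h hf hQ hT hh hhs hhB hlB hδ
  have hT0 : 0 < T := by linarith
  have hB0 : 0 ≤ B := (norm_nonneg _).trans (hhB 0)
  have hδ0 : 0 ≤ δ := measureReal_nonneg.trans hδ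
  set H : (Fin (m + 1) → ℂ × ℂ) → ℂ := fun y => iterLap h fun j => (y j).1 with hHdef
  have hHc : Continuous H := hh.iterLap.continuous.comp (by fun_prop)
  have hHB : ∀ y, ‖H y‖ ≤ B := fun y => hlB _
  set E : ℝ := D₂ * B * (Q ^ (m + 1 + q) / T ^ q) with hE
  set b : ℝ := (2 ^ (m + 1) * V + Γ) * B * ((n : ℝ) ^ (m + 1) + T ^ (m + 1)) with hb
  have hE0 : 0 ≤ E := by positivity
  have hb0 : 0 ≤ b := by positivity
  have hn1 (η : Ω) : ‖truncStat w R T H (f η)‖ ≤ (2 * T) ^ (m + 1) * B * V := by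
    have := norm_truncStat_le (w := w) (R := R) hT0 hHB (f η)
    rwa [tupleMeasure_real_univ w (by linarith)] at this
  have hn2 (η : Ω) : ‖Γ • rootSum h (f η)‖ ≤ Γ * ((n : ℝ) ^ (m + 1) * B) := by
    rw [norm_smul, Real.norm_of_nonneg hΓ0.le]
    gcongr
    exact norm_rootSum_le hhB (hf.natDegree_le η)
  have hX : Integrable (fun η => truncStat w R T H (f η)) P :=
    Integrable.of_bound (hf.measurable_truncStat w R T hHc).aestronglyMeasurable _
      (Filter.Eventually.of_forall hn1)
  have hY : Integrable (fun η => Γ • rootSum h (f η)) P :=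
    Integrable.of_bound ((hf.measurable_rootSum hR (Nat.succ_ne_zero m) hh hhs).const_smul
      Γ).aestronglyMeasurable _ (Filter.Eventually.of_forall hn2)
  have key : ‖(∫ η, truncStat w R T H (f η) ∂P) - ∫ η, Γ • rootSum h (f η) ∂P‖ ≤ E + b * δ := by
    refine norm_integral_sub_le_of_event hX hY (S := {η | ¬ ∀ j, zeroWeight (w j) (f η) ≤ Q})
      ?_ hE0 hb0 (fun η hη => ?_) (fun η => ?_) hδ
    · refine MeasurableSet.compl (s := {η | ∀ j, zeroWeight (w j) (f η) ≤ Q}) ?_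
      rw [Set.ofPred_forall]
      exact MeasurableSet.iInter fun j => hf.measurable_zeroWeight (w j) measurableSet_Iic
    · have hη' : ∀ j, zeroWeight (w j) (f η) ≤ Q := by simpa using hη
      rw [← integral_prod_polyDefect_smul_iterLap hR (Nat.succ_ne_zero m) hh hhs, norm_sub_rev]
      exact htr (f η) w Q T B H hT0 hη' hHc hHB
    · refine (norm_sub_le _ _).trans ((add_le_add (hn1 η) (hn2 η)).trans ?_)
      have e1 : 0 ≤ 2 ^ (m + 1) * V * B * (n : ℝ) ^ (m + 1) := by positivity
      have e2 : 0 ≤ Γ * B * T ^ (m + 1) := by positivity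
      rw [hb, mul_pow]
      linarith
  refine key.trans ?_
  set t2 := Q ^ (m + 1 + q) / T ^ q with ht2
  set t3 := ((n : ℝ) ^ (m + 1) + T ^ (m + 1)) * δ with ht3
  have p2 : 0 ≤ t2 := by positivity
  have p3 : 0 ≤ t3 := by positivity
  have e : E + b * δ = D₂ * (B * t2) + (2 ^ (m + 1) * V + Γ) * (B * t3) := by
    rw [hE, hb, ht3]; ring
  have e2 : (D₂ + (2 ^ (m + 1) * V + Γ)) * B * (t2 + t3) = D₂ * (B * t2) +
      (2 ^ (m + 1) * V + Γ) * (B * t3) + (D₂ * (B * t3) + (2 ^ (m + 1) * V + Γ) * (B * t2)) := by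
    ring
  rw [e, e2]
  have : 0 ≤ D₂ * (B * t3) + (2 ^ (m + 1) * V + Γ) * (B * t2) := by positivity
  linarith

/-- The expectations of a smooth statistic of the zero tuples of two random polynomials are close
when the log-magnitudes are comparable and clustering of zeros is unlikely. -/
theorem exists_norm_integral_rootSum_sub_le (m q a₀ : ℕ) (R : ℝ) (hR : 1 ≤ R) :
    ∃ D : ℝ, 0 < D ∧ ∀ {Ω Ω' : Type*} [MeasurableSpace Ω] [MeasurableSpace Ω']
      {P : Measure Ω} {P' : Measure Ω'} [IsProbabilityMeasure P] [IsProbabilityMeasure P']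
      {f : Ω → ℝ[X]} {f' : Ω' → ℝ[X]} {n : ℕ} {C c₀ : ℝ}
      {U : Set ℂ} (w : Fin (m + 1) → ℂ) (T Q B δ : ℝ) (h : (Fin (m + 1) → ℂ) → ℂ),
      IsRandomPoly n f → IsRandomPoly n f' → 1 ≤ n → 0 ≤ c₀ → 0 ≤ C → 0 ≤ Q →
      LogComparable P P' f f' n C c₀ a₀ U → (((m + 1) * 4 : ℕ) : ℝ) ≤ (n : ℝ) ^ c₀ →
      (∀ j, Metric.ball (w j) (R + 2) ⊆ U) → 1 ≤ T → ContDiff ℝ ∞ h →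
      tsupport h ⊆ polyBall w R → (∀ v, ‖h v‖ ≤ B) → (∀ v, ‖iterLap h v‖ ≤ B) →
      P.real {η | ¬ ∀ j, zeroWeight (w j) (f η) ≤ Q} ≤ δ →
      P'.real {η | ¬ ∀ j, zeroWeight (w j) (f' η) ≤ Q} ≤ δ →
      ‖(∫ η, rootSum h (f η) ∂P) - ∫ η, rootSum h (f' η) ∂P'‖ ≤
        D * B * (T ^ (m + 1) * (C * (n : ℝ) ^ (-c₀)) + Q ^ (m + 1 + q) / T ^ q +
          ((n : ℝ) ^ (m + 1) + T ^ (m + 1)) * δ) := by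
  obtain ⟨D₁, hD₁, hlog⟩ := exists_norm_integral_logStat_sub_le m a₀ R hR
  -- one constant for each of the universes of the two probability spaces
  obtain ⟨D₂, hD₂, htr⟩ := exists_norm_integral_truncStat_sub_le m q R hR
  obtain ⟨D₃, hD₃, htr'⟩ := exists_norm_integral_truncStat_sub_le m q R hR
  set Γ : ℝ := (2 * Real.pi * Real.pi) ^ (m + 1) with hΓ
  have hpi := Real.pi_gt_three
  have hΓ1 : 1 ≤ Γ := one_le_pow₀ (by nlinarith)
  have hΓ0 : 0 < Γ := by linarith
  set V : ℝ := (Real.pi * R ^ 2 * Real.pi) ^ (m + 1) with hV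
  have hV0 : 0 ≤ V := by positivity
  refine ⟨V * D₁ + (D₂ + D₃), by positivity, ?_⟩
  intro Ω Ω' _ _ P P' _ _ f f' n C c₀ U w T Q B δ h hf hf' hn hc₀ hC hQ hcomp hmn hU hT hh hhs hhB
    hlB hδ hδ'
  have hT0 : 0 < T := by linarith
  have hB0 : 0 ≤ B := (norm_nonneg _).trans (hhB 0)
  have hδ0 : 0 ≤ δ := measureReal_nonneg.trans hδ
  have h1 := htr w T Q B δ h hf hQ hT hh hhs hhB hlB hδ
  have h2 := htr' w T Q B δ h hf' hQ hT hh hhs hhB hlB hδ'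
  set H : (Fin (m + 1) → ℂ × ℂ) → ℂ := fun y => iterLap h fun j => (y j).1 with hHdef
  have hHc : Continuous H := hh.iterLap.continuous.comp (by fun_prop)
  have hHB : ∀ y, ‖H y‖ ≤ B := fun y => hlB _
  set t1 := T ^ (m + 1) * (C * (n : ℝ) ^ (-c₀)) with ht1
  set t2 := Q ^ (m + 1 + q) / T ^ q + ((n : ℝ) ^ (m + 1) + T ^ (m + 1)) * δ with ht2
  have p1 : 0 ≤ t1 := by positivity
  have p2 : 0 ≤ t2 := by positivity
  have hmid : ‖(∫ η, truncStat w R T H (f η) ∂P) - ∫ η, truncStat w R T H (f' η) ∂P'‖ ≤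
      D₁ * t1 * B * V := by
    obtain ⟨i1, e1⟩ := hf.integral_truncStat P w R hT0 hHc hHB
    obtain ⟨i2, e2⟩ := hf'.integral_truncStat P' w R hT0 hHc hHB
    rw [e1, e2, ← integral_sub i1 i2, hV,
      ← tupleMeasure_real_univ w (show 0 ≤ R by linarith)]
    refine norm_integral_le_of_norm_le_const ?_
    filter_upwards [ae_tuple w R fun j => ae_sampleMeasure (w j) R] with y hy
    rw [← sub_mul, ← mul_sub, norm_mul, norm_mul, Complex.norm_real,
      Real.norm_of_nonneg (by positivity)]
    refine mul_le_mul ?_ (hHB y) (norm_nonneg _) (by positivity)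
    rw [ht1]
    calc _ ≤ T ^ (m + 1) * (D₁ * (C * (n : ℝ) ^ (-c₀))) := by
          gcongr
          exact hlog w y T hn hc₀ hcomp hmn hU hy hT
      _ = _ := by ring
  have h3 : Γ * ‖(∫ η, rootSum h (f η) ∂P) - ∫ η, rootSum h (f' η) ∂P'‖ ≤
      D₁ * t1 * B * V + (D₂ + D₃) * B * t2 := by
    rw [integral_smul] at h1 h2
    have : Γ * ‖(∫ η, rootSum h (f η) ∂P) - ∫ η, rootSum h (f' η) ∂P'‖ =
        ‖Γ • (∫ η, rootSum h (f η) ∂P) - Γ • ∫ η, rootSum h (f' η) ∂P'‖ := by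
      rw [← smul_sub, norm_smul, Real.norm_of_nonneg hΓ0.le]
    rw [this]
    calc _ = ‖-((∫ η, truncStat w R T H (f η) ∂P) - Γ • ∫ η, rootSum h (f η) ∂P) +
          ((∫ η, truncStat w R T H (f η) ∂P) - ∫ η, truncStat w R T H (f' η) ∂P') +
          ((∫ η, truncStat w R T H (f' η) ∂P') - Γ • ∫ η, rootSum h (f' η) ∂P')‖ := by
          congr 1; abel
      _ ≤ _ := by
          refine (norm_add₃_le).trans ?_
          rw [norm_neg]
          linarith
  refine ((le_mul_of_one_le_left (norm_nonneg _) hΓ1).trans h3).trans ?_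
  have e2 : (V * D₁ + (D₂ + D₃)) * B * (t1 + t2) = D₁ * t1 * B * V + (D₂ + D₃) * B * t2 +
      (V * D₁ * B * t2 + (D₂ + D₃) * B * t1) := by ring
  rw [add_assoc, e2]
  have : 0 ≤ V * D₁ * B * t2 + (D₂ + D₃) * B * t1 := by positivity
  linarith

end Comparison

/-! ### Non-clustering bounds the total weight of the zeros -/

section Clustering

lemma zeroCount_eq_sum (p : ℝ[X]) (w : ℂ) (r : ℝ) :
    (zeroCount p w r : ℝ) =
      ∑ i : RootIdx p, (Metric.ball w r).indicator (fun _ => (1 : ℝ)) i.1 := by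
  classical
  rw [zeroCount, sum_coe_multiset (p.aroots ℂ) ((Metric.ball w r).indicator fun _ => (1 : ℝ))]
  generalize p.aroots ℂ = s
  induction s using Multiset.induction_on with
  | empty => simp
  | cons a s ih =>
    rw [Multiset.countP_cons, Multiset.map_cons, Multiset.sum_cons]
    push_cast
    rw [ih, add_comm]
    by_cases h : a ∈ Metric.ball w r <;> simp [h]

lemma RandomZeros.IsRandomPoly.measurable_zeroCount {Ω : Type*} [MeasurableSpace Ω] {n : ℕ}
    {f : Ω → ℝ[X]} (hf : IsRandomPoly n f) (w : ℂ) (r : ℝ) :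
    Measurable fun η => (zeroCount (f η) w r : ℝ) := by
  have h := Complex.measurable_re.comp
    (hf.measurable_sum_indicator (Metric.isOpen_ball (x := w) (ε := r)).measurableSet)
  convert h using 1
  funext η
  simp only [Function.comp_apply]
  rw [zeroCount_eq_sum, Complex.re_sum]
  refine Finset.sum_congr rfl fun i _ => ?_
  by_cases hi : (i.1 : ℂ) ∈ Metric.ball w r <;> simp [hi]

/-- Dyadic decomposition of `decayWeight`, the last term accounting for points at distance at least
`2 ^ L`. -/
lemma decayWeight_le_sum (w ζ : ℂ) (L : ℕ) :
    decayWeight w ζ ≤ (∑ j ∈ Finset.range (L + 1),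
      4 * ((4 : ℝ) ^ j)⁻¹ * (Metric.ball w (2 ^ j)).indicator (fun _ => (1 : ℝ)) ζ) +
        ((4 : ℝ) ^ L)⁻¹ := by
  have hnn : ∀ j ∈ Finset.range (L + 1),
      0 ≤ 4 * ((4 : ℝ) ^ j)⁻¹ * (Metric.ball w (2 ^ j)).indicator (fun _ => (1 : ℝ)) ζ :=
    fun j _ => mul_nonneg (by positivity) (Set.indicator_nonneg (fun _ _ => zero_le_one) _)
  have hfar {j : ℕ} (h : (2 : ℝ) ^ j ≤ ‖ζ - w‖) : decayWeight w ζ ≤ ((4 : ℝ) ^ j)⁻¹ := by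
    rw [decayWeight]
    gcongr
    calc (4 : ℝ) ^ j = (2 ^ j) ^ 2 := by rw [← pow_mul, mul_comm, pow_mul]; norm_num
      _ ≤ _ := by
        gcongr
        exact h.trans (le_max_right _ _)
  by_cases hL : ‖ζ - w‖ < 2 ^ L
  · classical
    have hex : ∃ j : ℕ, ‖ζ - w‖ < 2 ^ j := ⟨L, hL⟩
    set j := Nat.find hex with hj
    have hj1 : ‖ζ - w‖ < 2 ^ j := Nat.find_spec hex
    have hjL : j ≤ L := Nat.find_min' hex hL
    have hle : decayWeight w ζ ≤ 4 * ((4 : ℝ) ^ j)⁻¹ := by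
      rcases Nat.eq_zero_or_pos j with h0 | h0
      · rw [h0, decayWeight]
        have : ((max 1 ‖ζ - w‖) ^ 2)⁻¹ ≤ 1 :=
          inv_le_one_of_one_le₀ (one_le_pow₀ (le_max_left _ _))
        norm_num
        linarith
      · have h1 : (2 : ℝ) ^ (j - 1) ≤ ‖ζ - w‖ := by
          have := Nat.find_min hex (show j - 1 < j by omega)
          exact not_lt.1 this
        refine (hfar h1).trans (le_of_eq ?_)
        obtain ⟨i, hi⟩ : ∃ i, j = i + 1 := ⟨j - 1, by omega⟩
        rw [hi, Nat.add_sub_cancel, pow_succ]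
        field_simp
    have hsingle := Finset.single_le_sum hnn (Finset.mem_range.2 (Nat.lt_succ_of_le hjL))
    have hmem : ζ ∈ Metric.ball w (2 ^ j) := by rwa [mem_ball_iff_norm]
    rw [Set.indicator_of_mem hmem, mul_one] at hsingle
    have : (0 : ℝ) ≤ ((4 : ℝ) ^ L)⁻¹ := by positivity
    linarith
  · have := hfar (not_lt.1 hL)
    have := Finset.sum_nonneg hnn
    linarith

/-- Since `n ≤ 2 ^ L`, the at most `n` zeros at distance at least `2 ^ L` have total weight at most
`n * 4 ^ (-L) ≤ 1`. -/
lemma zeroWeight_le_of_zeroCount_le {p : ℝ[X]} {n L : ℕ} (hp : p.natDegree ≤ n) (hL : n ≤ 2 ^ L)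
    {w : ℂ} {a : ℝ} (h : ∀ j ≤ L, (zeroCount p w (2 ^ j) : ℝ) ≤ a * (2 ^ j) ^ 2) :
    zeroWeight w p ≤ 4 * a * (L + 1) + 1 := by
  have h1 : zeroWeight w p ≤ (∑ j ∈ Finset.range (L + 1),
      4 * ((4 : ℝ) ^ j)⁻¹ * (zeroCount p w (2 ^ j) : ℝ)) + n * ((4 : ℝ) ^ L)⁻¹ := by
    refine (Finset.sum_le_sum fun i _ => decayWeight_le_sum w i.1 L).trans ?_
    rw [Finset.sum_add_distrib, Finset.sum_comm, Finset.sum_const, Finset.card_univ, nsmul_eq_mul]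
    gcongr with j
    · rw [zeroCount_eq_sum, Finset.mul_sum]
    · exact card_rootIdx_le hp
  have h2 : (n : ℝ) * ((4 : ℝ) ^ L)⁻¹ ≤ 1 := by
    rw [← div_eq_mul_inv, div_le_one (by positivity)]
    have hn : (n : ℝ) ≤ 2 ^ L := by exact_mod_cast hL
    exact hn.trans (by gcongr; norm_num)
  have h3 : ∑ j ∈ Finset.range (L + 1), 4 * ((4 : ℝ) ^ j)⁻¹ * (zeroCount p w (2 ^ j) : ℝ) ≤
      ∑ _j ∈ Finset.range (L + 1), 4 * a := by
    refine Finset.sum_le_sum fun j hj => ?_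
    have h4 := h j (Nat.lt_succ_iff.1 (Finset.mem_range.1 hj))
    calc _ ≤ 4 * ((4 : ℝ) ^ j)⁻¹ * (a * (2 ^ j) ^ 2) := by gcongr
      _ = _ := by
        rw [← pow_mul, mul_comm j 2, pow_mul]
        norm_num
        field_simp
  rw [Finset.sum_const, Finset.card_range, nsmul_eq_mul] at h3
  push_cast at h3
  linarith

lemma measureReal_not_le_of_le {Ω : Type*} [MeasurableSpace Ω] {P : Measure Ω}
    [IsProbabilityMeasure P] {s : Set Ω} (hs : MeasurableSet s) {δ : ℝ} (h : 1 - δ ≤ P.real s) :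
    P.real sᶜ ≤ δ := by
  rw [probReal_compl_eq_one_sub hs]
  linarith

lemma clog_add_one_le {n : ℕ} (hn : 1 ≤ n) {A : ℝ} (hA : 1 ≤ A) :
    (Nat.clog 2 n : ℝ) + 1 ≤ 2 * (A + 1) * (n : ℝ) ^ (1 / A) := by
  have hn0 : (0 : ℝ) < n := by exact_mod_cast hn
  have hN1 : 1 ≤ (n : ℝ) ^ (1 / A) := Real.one_le_rpow (by exact_mod_cast hn) (by positivity)
  have hlog : Real.log n ≤ A * (n : ℝ) ^ (1 / A) := by
    have := Real.log_le_rpow_div hn0.le (show 0 < 1 / A by positivity)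
    rw [div_div_eq_mul_div, div_one] at this
    linarith
  rcases Nat.lt_or_ge n 2 with h2 | h2
  · have : n = 1 := by omega
    subst this
    simp
    linarith
  · set L := Nat.clog 2 n with hL
    have hL1 : 1 ≤ L := Nat.clog_pos (by norm_num) h2
    have hlt : 2 ^ (L - 1) < n := Nat.pow_pred_clog_lt_self (by norm_num) (by omega)
    have h3 : ((L : ℝ) - 1) * Real.log 2 ≤ Real.log n := by
      have h4 : ((2 : ℝ) ^ (L - 1)) ≤ n := by exact_mod_cast hlt.le
      have h5 := Real.log_le_log (by positivity) h4
      rw [Real.log_pow, Nat.cast_sub hL1] at h5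
      simpa using h5
    have h6 := Real.log_two_gt_d9
    have h7 : (1 : ℝ) ≤ L := by exact_mod_cast hL1
    nlinarith

/-- Non-clustering at all dyadic scales keeps the total weight of the zeros of order `n^{2/A}`. -/
lemma RandomZeros.NonClusteringAt.measureReal_zeroWeight {Ω : Type*} [MeasurableSpace Ω]
    {P : Measure Ω} [IsProbabilityMeasure P] {n : ℕ} {f : Ω → ℝ[X]} (hf : IsRandomPoly n f)
    (hn : 1 ≤ n) {C A : ℝ} (hC : 0 ≤ C) (hA : 1 ≤ A) {w : ℂ} (h : NonClusteringAt P f n C A w) :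
    P.real {η | ¬ zeroWeight w (f η) ≤ (8 * C * (A + 1) + 1) * ((n : ℝ) ^ (1 / A)) ^ 2} ≤
      2 * (A + 1) * C * (n : ℝ) ^ (1 / A) * (n : ℝ) ^ (-A) := by
  set N : ℝ := (n : ℝ) ^ (1 / A) with hN
  have hN1 : 1 ≤ N := Real.one_le_rpow (by exact_mod_cast hn) (by positivity)
  set L := Nat.clog 2 n with hL
  have hLN : (L : ℝ) + 1 ≤ 2 * (A + 1) * N := clog_add_one_le hn hA
  let S : ℕ → Set Ω := fun j => {η | (zeroCount (f η) w (2 ^ j) : ℝ) ≤ C * N * (2 ^ j) ^ 2}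
  have hS (j : ℕ) : P.real (S j)ᶜ ≤ C * (n : ℝ) ^ (-A) :=
    measureReal_not_le_of_le (hf.measurable_zeroCount w _ measurableSet_Iic)
      (h (2 ^ j) (one_le_pow₀ (by norm_num)))
  have hsub : {η | ¬ zeroWeight w (f η) ≤ (8 * C * (A + 1) + 1) * N ^ 2} ⊆
      ⋃ j ∈ Finset.range (L + 1), (S j)ᶜ := by
    intro η hη
    by_contra hcon
    simp only [Set.mem_iUnion, not_exists, Set.mem_compl_iff, not_not] at hcon
    refine hη ?_
    have := zeroWeight_le_of_zeroCount_le (hf.natDegree_le η) (Nat.le_pow_clog (by norm_num) n)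
      (a := C * N) fun j hj => hcon j (Finset.mem_range.2 (Nat.lt_succ_of_le hj))
    refine this.trans ?_
    have h1 : 4 * (C * N) * ((L : ℝ) + 1) ≤ 4 * (C * N) * (2 * (A + 1) * N) := by gcongr
    nlinarith
  calc _ ≤ P.real (⋃ j ∈ Finset.range (L + 1), (S j)ᶜ) := measureReal_mono hsub (measure_ne_top _ _)
    _ ≤ ∑ j ∈ Finset.range (L + 1), P.real (S j)ᶜ := measureReal_biUnion_finset_le _ _
    _ ≤ ∑ _j ∈ Finset.range (L + 1), C * (n : ℝ) ^ (-A) := Finset.sum_le_sum fun j _ => hS j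
    _ = ((L : ℝ) + 1) * (C * (n : ℝ) ^ (-A)) := by
        rw [Finset.sum_const, Finset.card_range, nsmul_eq_mul]
        push_cast
        ring
    _ ≤ (2 * (A + 1) * N) * (C * (n : ℝ) ^ (-A)) := by gcongr
    _ = _ := by ring

/-- The number of zeros in a disk is controlled by their total weight. -/
lemma sum_indicator_le_zeroWeight (p : ℝ[X]) (w : ℂ) {r : ℝ} (hr : 1 ≤ r) :
    ∑ i : RootIdx p, (Metric.ball w r).indicator (fun _ => (1 : ℝ)) i.1 ≤
      r ^ 2 * zeroWeight w p := by
  rw [zeroWeight, Finset.mul_sum]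
  refine Finset.sum_le_sum fun i _ => ?_
  by_cases hi : (i.1 : ℂ) ∈ Metric.ball w r
  · rw [Set.indicator_of_mem hi, decayWeight, ← div_eq_mul_inv, le_div_iff₀ (by positivity), one_mul]
    gcongr
    exact max_le hr (mem_ball_iff_norm.1 hi).le
  · rw [Set.indicator_of_notMem hi]
    exact mul_nonneg (by positivity) (decayWeight_pos _ _).le

end Clustering

/-! ### Comparison with explicit exponents -/

section Exponents

/-- The hypotheses on a pair of random polynomials `f`, `f'`: clustering of zeros is unlikely
around the points of `W`, the log-magnitudes are comparable on the set `U`, which contains large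
disks around the points of `W`, and the zeros of `f'` repel each other weakly on `U`. -/
structure Replaceable (C r₀ c₀ A : ℝ) (a₀ n : ℕ) {Ω Ω' : Type*} [MeasurableSpace Ω]
    [MeasurableSpace Ω'] (P : Measure Ω) (P' : Measure Ω') (f : Ω → ℝ[X]) (f' : Ω' → ℝ[X])
    (W U : Set ℂ) : Prop where
  one_le : 1 ≤ n
  random : IsRandomPoly n f
  random' : IsRandomPoly n f'
  nonClustering : ∀ w ∈ W, NonClusteringAt P f n C A w
  nonClustering' : ∀ w ∈ W, NonClusteringAt P' f' n C A w
  comparable : LogComparable P P' f f' n C c₀ a₀ U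
  repulsion : WeakLevelRepulsion P' f' C U
  ball_subset : ∀ w ∈ W, Metric.ball w (100 * r₀) ⊆ U

/-- The constants of the replacement principle, for `K` zeros. With `N = n ^ (1 / A)` as unit of
measurement, `n ^ (-c₀)` equals `N ^ (-200 K² (a₀ + 2))`, and `n ^ j * n ^ (-A)` is at most
`N ^ (-(600 K² - j))` for `j ≤ 600 K²` (`rpow_neg_A_le`). -/
structure ReplacementConstants (C r₀ c₀ A : ℝ) (a₀ K : ℕ) : Prop where
  one_le_C : 1 ≤ C
  one_le_r : 1 ≤ r₀
  pos : 0 < c₀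
  le_one : c₀ ≤ 1
  one_le_K : 1 ≤ K
  eq : A = 200 * (K : ℝ) ^ 2 * ((a₀ : ℝ) + 2) / c₀
  one_le_a : 1 ≤ a₀

namespace ReplacementConstants

variable {C r₀ c₀ A : ℝ} {a₀ K : ℕ}

lemma le_A (h : ReplacementConstants C r₀ c₀ A a₀ K) : ((600 * K ^ 2 : ℕ) : ℝ) ≤ A := by
  rw [h.eq, le_div_iff₀ h.pos]
  have h1 : (1 : ℝ) ≤ a₀ := by exact_mod_cast h.one_le_a
  have h2 : (0 : ℝ) ≤ (K : ℝ) ^ 2 := by positivity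
  push_cast
  have h3 := h.le_one
  have h4 : 600 * (K : ℝ) ^ 2 * c₀ ≤ 600 * (K : ℝ) ^ 2 * 1 := by gcongr
  nlinarith

lemma one_le_A (h : ReplacementConstants C r₀ c₀ A a₀ K) : 1 ≤ A := by
  refine le_trans ?_ h.le_A
  have := h.one_le_K
  exact_mod_cast show 1 ≤ 600 * K ^ 2 by nlinarith

lemma one_le_N (h : ReplacementConstants C r₀ c₀ A a₀ K) {n : ℕ} (hn : 1 ≤ n) :
    1 ≤ (n : ℝ) ^ (1 / A) :=
  Real.one_le_rpow (by exact_mod_cast hn) (one_div_nonneg.2 (by linarith [h.one_le_A]))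

lemma N_le (h : ReplacementConstants C r₀ c₀ A a₀ K) {n : ℕ} (hn : 1 ≤ n) :
    (n : ℝ) ^ (1 / A) ≤ n := by
  have h1 := h.one_le_A
  calc (n : ℝ) ^ (1 / A) ≤ (n : ℝ) ^ (1 : ℝ) :=
        Real.rpow_le_rpow_of_exponent_le (by exact_mod_cast hn)
          ((div_le_one (by linarith)).2 h1)
    _ = n := Real.rpow_one _

lemma rpow_neg_c (h : ReplacementConstants C r₀ c₀ A a₀ K) (n : ℕ) :
    (n : ℝ) ^ (-c₀) = (((n : ℝ) ^ (1 / A)) ^ (200 * K ^ 2 * (a₀ + 2)))⁻¹ := by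
  have hA : 0 < A := by linarith [h.one_le_A]
  rw [Real.rpow_neg (Nat.cast_nonneg n), ← Real.rpow_natCast, ← Real.rpow_mul (Nat.cast_nonneg n)]
  congr 2
  have h1 := h.eq
  rw [eq_div_iff h.pos.ne'] at h1
  rw [div_mul_eq_mul_div, one_mul, eq_div_iff hA.ne']
  push_cast
  linarith

lemma rpow_neg_A_le (h : ReplacementConstants C r₀ c₀ A a₀ K) {n : ℕ} (hn : 1 ≤ n) {j : ℕ}
    (hj : j ≤ 600 * K ^ 2) :
    (n : ℝ) ^ j * (n : ℝ) ^ (-A) ≤ (((n : ℝ) ^ (1 / A)) ^ (600 * K ^ 2 - j))⁻¹ := by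
  have hn1 : (1 : ℝ) ≤ n := by exact_mod_cast hn
  have hn0 : (0 : ℝ) < n := by linarith
  have hN := h.one_le_N hn
  have h1 : (n : ℝ) ^ (-A) ≤ ((n : ℝ) ^ (600 * K ^ 2))⁻¹ := by
    rw [Real.rpow_neg hn0.le, ← Real.rpow_natCast]
    gcongr
    exact h.le_A
  calc _ ≤ (n : ℝ) ^ j * ((n : ℝ) ^ (600 * K ^ 2))⁻¹ := by gcongr
    _ = ((n : ℝ) ^ (600 * K ^ 2 - j))⁻¹ := by
        obtain ⟨i, hi⟩ := Nat.exists_eq_add_of_le hj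
        rw [hi, Nat.add_sub_cancel_left, pow_add, mul_inv, ← mul_assoc,
          mul_inv_cancel₀ (by positivity), one_mul]
    _ ≤ _ := by
        gcongr
        exact h.N_le hn

end ReplacementConstants

lemma pow_mul_inv_pow_le {N : ℝ} (hN : 1 ≤ N) {a b p : ℕ} (h : a + p ≤ b) :
    N ^ a * (N ^ b)⁻¹ ≤ (N ^ p)⁻¹ := by
  have h0 : 0 < N := by linarith
  rw [← div_eq_mul_inv, div_le_iff₀ (by positivity), ← div_eq_inv_mul, le_div_iff₀ (by positivity),
    ← pow_add]
  exact pow_le_pow_right₀ hN h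

lemma measureReal_not_forall_zeroWeight_le {Ω : Type*} [MeasurableSpace Ω] {P : Measure Ω}
    [IsProbabilityMeasure P] {n : ℕ} {f : Ω → ℝ[X]} (hf : IsRandomPoly n f) (hn : 1 ≤ n) {C A : ℝ}
    (hC : 0 ≤ C) (hA : 1 ≤ A) {m : ℕ} {w : Fin m → ℂ} (h : ∀ j, NonClusteringAt P f n C A (w j)) :
    P.real {η | ¬ ∀ j, zeroWeight (w j) (f η) ≤
        (8 * C * (A + 1) + 1) * ((n : ℝ) ^ (1 / A)) ^ 2} ≤
      m * (2 * (A + 1) * C * (n : ℝ) ^ (1 / A) * (n : ℝ) ^ (-A)) := by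
  let S : Fin m → Set Ω := fun j => {η | ¬ zeroWeight (w j) (f η) ≤
    (8 * C * (A + 1) + 1) * ((n : ℝ) ^ (1 / A)) ^ 2}
  have hS (j) : P.real (S j) ≤ 2 * (A + 1) * C * (n : ℝ) ^ (1 / A) * (n : ℝ) ^ (-A) :=
    (h j).measureReal_zeroWeight hf hn hC hA
  have hsub : {η | ¬ ∀ j, zeroWeight (w j) (f η) ≤
      (8 * C * (A + 1) + 1) * ((n : ℝ) ^ (1 / A)) ^ 2} ⊆ ⋃ j ∈ Finset.univ, S j := by
    intro η hη
    simpa [S] using hη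
  have h1 := measureReal_mono (μ := P) hsub (measure_ne_top _ _)
  have h2 := measureReal_biUnion_finset_le (μ := P) Finset.univ S
  have h3 := Finset.sum_le_sum fun j (_ : j ∈ Finset.univ) => hS j
  rw [Finset.sum_const, Finset.card_univ, Fintype.card_fin, nsmul_eq_mul] at h3
  exact h1.trans (h2.trans h3)

/-- The zero statistics of two replaceable random polynomials differ by a large negative power of
`N = n^{1/A}`. -/
theorem exists_norm_integral_rootSum_sub_le_pow {C r₀ c₀ A : ℝ} {a₀ K : ℕ}
    (hK : ReplacementConstants C r₀ c₀ A a₀ K) (m : ℕ) (hm : m ≤ K) :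
    ∃ D : ℝ, 0 < D ∧ ∀ {Ω Ω' : Type*} [MeasurableSpace Ω] [MeasurableSpace Ω']
      {P : Measure Ω} {P' : Measure Ω'} [IsProbabilityMeasure P] [IsProbabilityMeasure P']
      {f : Ω → ℝ[X]} {f' : Ω' → ℝ[X]} {n : ℕ} {W U : Set ℂ},
      Replaceable C r₀ c₀ A a₀ n P P' f f' W U →
      ∀ (w : Fin (m + 1) → ℂ) (B : ℝ) (h : (Fin (m + 1) → ℂ) → ℂ), (∀ j, w j ∈ W) →
      ContDiff ℝ ∞ h → tsupport h ⊆ polyBall w (3 * r₀) → (∀ v, ‖h v‖ ≤ B) →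
      (∀ v, ‖iterLap h v‖ ≤ B) →
      ‖(∫ η, rootSum h (f η) ∂P) - ∫ η, rootSum h (f' η) ∂P'‖ ≤
        D * B * (((n : ℝ) ^ (1 / A)) ^ (34 * K ^ 2))⁻¹ := by
  have hr := hK.one_le_r
  have hC := hK.one_le_C
  have hA1 := hK.one_le_A
  have hK1 := hK.one_le_K
  have hKK : K ≤ K ^ 2 := by nlinarith
  obtain ⟨D, hD, hcmp⟩ := exists_norm_integral_rootSum_sub_le m K a₀ (3 * r₀) (by linarith)
  set n₀ : ℝ := (((m + 1) * 4 : ℕ) : ℝ) ^ (1 / c₀) with hn₀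
  set C₁ : ℝ := 8 * C * (A + 1) + 1 with hC₁
  have hC₁0 : 0 < C₁ := by positivity
  set C₂ : ℝ := 2 * (A + 1) * C with hC₂
  have hC₂0 : 0 < C₂ := by positivity
  have hn₀0 : 0 ≤ n₀ := by positivity
  refine ⟨D * (C + C₁ ^ (m + 1 + K) + 2 * ((m + 1) * C₂)) + 2 * n₀ ^ (m + 1) * n₀ ^ (34 * K ^ 2),
    by positivity, ?_⟩
  intro Ω Ω' _ _ P P' _ _ f f' n W U hR w B h hw hh hhs hhB hlB
  have hn := hR.one_le
  have hn1 : (1 : ℝ) ≤ n := by exact_mod_cast hn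
  have hB0 : 0 ≤ B := (norm_nonneg _).trans (hhB 0)
  set N : ℝ := (n : ℝ) ^ (1 / A) with hN
  have hN1 : 1 ≤ N := hK.one_le_N hn
  have hN0 : 0 < N := by linarith
  set ε : ℝ := (N ^ (34 * K ^ 2))⁻¹ with hε
  have hε0 : 0 < ε := by positivity
  by_cases hbig : (((m + 1) * 4 : ℕ) : ℝ) ≤ (n : ℝ) ^ c₀
  · set δ : ℝ := ((m + 1 : ℕ) : ℝ) * (C₂ * N * (n : ℝ) ^ (-A)) with hδ
    have hδ1 := measureReal_not_forall_zeroWeight_le hR.random hn (by linarith) hA1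
      fun j => hR.nonClustering _ (hw j)
    have hδ2 := measureReal_not_forall_zeroWeight_le hR.random' hn (by linarith) hA1
      fun j => hR.nonClustering' _ (hw j)
    have hU (j) : Metric.ball (w j) (3 * r₀ + 2) ⊆ U :=
      (Metric.ball_subset_ball (by linarith)).trans (hR.ball_subset _ (hw j))
    -- Truncate at height `N ^ (40 K)` and use moments of order `m + 1 + K`. Comparability then loses
    -- `N ^ (40 K (m + 1)) ≤ N ^ (80 K²)` against `n ^ (-c₀) ≤ N ^ (-400 K²)`, and the truncation
    -- error is of order `N ^ (2 (m + 1 + K) - 40 K²)`.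
    refine (hcmp w (N ^ (40 * K)) (C₁ * N ^ 2) B δ h hR.random hR.random' hn hK.pos.le (by linarith)
      (by positivity) hR.comparable hbig hU (one_le_pow₀ hN1) hh hhs hhB hlB hδ1 hδ2).trans ?_
    have t1 : (N ^ (40 * K)) ^ (m + 1) * (C * (n : ℝ) ^ (-c₀)) ≤ C * ε := by
      rw [hK.rpow_neg_c, ← pow_mul, mul_left_comm]
      gcongr
      refine pow_mul_inv_pow_le hN1 ?_
      have h1 : 40 * K * (m + 1) ≤ 40 * K * (K + 1) := by gcongr
      have h2 : 200 * K ^ 2 * 2 ≤ 200 * K ^ 2 * (a₀ + 2) := by gcongr; omega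
      nlinarith
    have t2 : (C₁ * N ^ 2) ^ (m + 1 + K) / (N ^ (40 * K)) ^ K ≤ C₁ ^ (m + 1 + K) * ε := by
      rw [mul_pow, ← pow_mul, ← pow_mul, mul_div_assoc, div_eq_mul_inv]
      gcongr
      refine pow_mul_inv_pow_le hN1 ?_
      nlinarith
    have t3 : ((n : ℝ) ^ (m + 1) + (N ^ (40 * K)) ^ (m + 1)) * δ ≤ 2 * ((m + 1) * C₂) * ε := by
      have h1 : (n : ℝ) ^ (m + 1) * (N * (n : ℝ) ^ (-A)) ≤ ε := by
        have h2 : (n : ℝ) ^ (m + 1) * (n : ℝ) ^ (-A) ≤ (N ^ (600 * K ^ 2 - (m + 1)))⁻¹ :=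
          hK.rpow_neg_A_le hn (by nlinarith)
        calc _ = N ^ 1 * ((n : ℝ) ^ (m + 1) * (n : ℝ) ^ (-A)) := by ring
          _ ≤ N ^ 1 * (N ^ (600 * K ^ 2 - (m + 1)))⁻¹ := by gcongr
          _ ≤ ε := pow_mul_inv_pow_le hN1 (by
              have : m + 1 ≤ 2 * K ^ 2 := by nlinarith
              omega)
      have h3 : (N ^ (40 * K)) ^ (m + 1) * (N * (n : ℝ) ^ (-A)) ≤ ε := by
        have h2 : (n : ℝ) ^ 0 * (n : ℝ) ^ (-A) ≤ (N ^ (600 * K ^ 2 - 0))⁻¹ :=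
          hK.rpow_neg_A_le hn (by nlinarith)
        rw [pow_zero, one_mul, Nat.sub_zero] at h2
        calc _ = N ^ (40 * K * (m + 1) + 1) * (n : ℝ) ^ (-A) := by rw [← pow_mul]; ring
          _ ≤ N ^ (40 * K * (m + 1) + 1) * (N ^ (600 * K ^ 2))⁻¹ := by gcongr
          _ ≤ ε := pow_mul_inv_pow_le hN1 (by nlinarith)
      calc _ = ((m + 1) * C₂) * ((n : ℝ) ^ (m + 1) * (N * (n : ℝ) ^ (-A)) +
            (N ^ (40 * K)) ^ (m + 1) * (N * (n : ℝ) ^ (-A))) := by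
            rw [hδ]; push_cast; ring
        _ ≤ ((m + 1) * C₂) * (ε + ε) := by gcongr
        _ = _ := by ring
    calc _ ≤ D * B * (C * ε + C₁ ^ (m + 1 + K) * ε + 2 * ((m + 1) * C₂) * ε) := by gcongr
      _ = D * (C + C₁ ^ (m + 1 + K) + 2 * ((m + 1) * C₂)) * B * ε := by ring
      _ ≤ _ := by
        gcongr
        exact le_add_of_nonneg_right (by positivity)
  · -- Comparability says nothing about `4 (m + 1)` points here, but `n` is bounded, and so are all
    -- statistics.
    have hlt : (n : ℝ) ≤ n₀ := by
      have h1 : (n : ℝ) = ((n : ℝ) ^ c₀) ^ (1 / c₀) := by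
        rw [← Real.rpow_mul (by linarith), mul_one_div_cancel hK.pos.ne', Real.rpow_one]
      rw [h1, hn₀]
      refine Real.rpow_le_rpow (by positivity) (not_le.1 hbig).le ?_
      exact one_div_nonneg.2 hK.pos.le
    have h1 : ‖∫ η, rootSum h (f η) ∂P‖ ≤ n₀ ^ (m + 1) * B := by
      have := norm_integral_le_of_norm_le_const (μ := P) (f := fun η => rootSum h (f η))
        (C := n₀ ^ (m + 1) * B) (Filter.Eventually.of_forall fun η => by
          refine (norm_rootSum_le hhB (hR.random.natDegree_le η)).trans ?_
          gcongr)
      simpa using this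
    have h2 : ‖∫ η, rootSum h (f' η) ∂P'‖ ≤ n₀ ^ (m + 1) * B := by
      have := norm_integral_le_of_norm_le_const (μ := P') (f := fun η => rootSum h (f' η))
        (C := n₀ ^ (m + 1) * B) (Filter.Eventually.of_forall fun η => by
          refine (norm_rootSum_le hhB (hR.random'.natDegree_le η)).trans ?_
          gcongr)
      simpa using this
    have h3 : 1 ≤ n₀ ^ (34 * K ^ 2) * ε := by
      rw [hε, ← div_eq_mul_inv, one_le_div (by positivity)]
      gcongr
      exact (hK.N_le hn).trans hlt
    calc _ ≤ n₀ ^ (m + 1) * B + n₀ ^ (m + 1) * B := (norm_sub_le _ _).trans (add_le_add h1 h2)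
      _ = 2 * n₀ ^ (m + 1) * B * 1 := by ring
      _ ≤ 2 * n₀ ^ (m + 1) * B * (n₀ ^ (34 * K ^ 2) * ε) := by gcongr
      _ = 2 * n₀ ^ (m + 1) * n₀ ^ (34 * K ^ 2) * B * ε := by ring
      _ ≤ _ := by
        gcongr
        exact le_add_of_nonneg_left (by positivity)

end Exponents

/-! ### Pairs of zeros near a real point -/

section Pairs

lemma sum_embedding_two {I : Type} [Fintype I] [DecidableEq I] [Fintype (Fin 2 ↪ I)] (F : I → ℂ) :
    ∑ i : Fin 2 ↪ I, F (i 0) * F (i 1) = (∑ i, F i) ^ 2 - ∑ i, F i ^ 2 := by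
  have h1 : ∑ i : Fin 2 ↪ I, F (i 0) * F (i 1) =
      ∑ g : Fin 2 → I, if g 0 = g 1 then 0 else F (g 0) * F (g 1) := by
    refine Finset.sum_of_injOn (fun i : Fin 2 ↪ I => (i : Fin 2 → I))
      (fun a _ b _ h => DFunLike.coe_injective h) (fun _ _ => Finset.mem_coe.2 (Finset.mem_univ _))
      (fun g _ hg => ?_) (fun i _ => ?_)
    · rw [if_pos]
      by_contra hne
      refine hg ⟨⟨g, fun a b hab => ?_⟩, Finset.mem_coe.2 (Finset.mem_univ _), rfl⟩
      fin_cases a <;> fin_cases b <;> simp_all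
    · rw [if_neg]
      intro h
      exact absurd (i.injective h) (by decide)
  rw [h1]
  simp only [sum_fin_succ_pi]
  have h (a : I) : (∑ b, if a = b then 0 else F a * F b) = F a * ∑ b, F b - F a ^ 2 := by
    rw [Finset.mul_sum, eq_sub_iff_add_eq]
    have : F a ^ 2 = ∑ b, if a = b then F a * F b else 0 := by
      rw [Finset.sum_ite_eq]; simp [sq]
    rw [this, ← Finset.sum_add_distrib]
    exact Finset.sum_congr rfl fun b _ => by split_ifs <;> simp
  calc _ = ∑ a, ∑ b, (if a = b then 0 else F a * F b) := by
        refine Finset.sum_congr rfl fun a _ => Finset.sum_congr rfl fun b _ => ?_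
        simp
    _ = _ := by
        simp only [h]
        rw [Finset.sum_sub_distrib, ← Finset.sum_mul, sq]

/-- The sum of `φ a * φ b` over all ordered pairs of distinct indices, see `pairSum_eq`. -/
def pairSum {I : Type} [Fintype I] (φ : I → ℝ) : ℝ := (∑ i, φ i) ^ 2 - ∑ i, φ i ^ 2

lemma pairSum_eq {I : Type} [Fintype I] [DecidableEq I] (φ : I → ℝ) :
    pairSum φ = ∑ a, ∑ b, if a = b then 0 else φ a * φ b := by
  have h (a : I) : (∑ b, if a = b then 0 else φ a * φ b) = φ a * ∑ b, φ b - φ a ^ 2 := by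
    rw [Finset.mul_sum, eq_sub_iff_add_eq]
    have : φ a ^ 2 = ∑ b, if a = b then φ a * φ b else 0 := by
      rw [Finset.sum_ite_eq]; simp [sq]
    rw [this, ← Finset.sum_add_distrib]
    exact Finset.sum_congr rfl fun b _ => by split_ifs <;> simp
  simp only [h]
  rw [Finset.sum_sub_distrib, ← Finset.sum_mul, pairSum, sq]

lemma pairSum_nonneg {I : Type} [Fintype I] {φ : I → ℝ} (h : ∀ i, 0 ≤ φ i) : 0 ≤ pairSum φ := by
  classical
  rw [pairSum_eq]
  refine Finset.sum_nonneg fun a _ => Finset.sum_nonneg fun b _ => ?_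
  split_ifs
  exacts [le_rfl, mul_nonneg (h a) (h b)]

lemma pairSum_mono {I : Type} [Fintype I] {φ ψ : I → ℝ} (h0 : ∀ i, 0 ≤ φ i) (h : ∀ i, φ i ≤ ψ i) :
    pairSum φ ≤ pairSum ψ := by
  classical
  rw [pairSum_eq, pairSum_eq]
  refine Finset.sum_le_sum fun a _ => Finset.sum_le_sum fun b _ => ?_
  split_ifs
  exacts [le_rfl, mul_le_mul (h a) (h b) (h0 b) ((h0 a).trans (h a))]

lemma mul_le_pairSum {I : Type} [Fintype I] {φ : I → ℝ} (h0 : ∀ i, 0 ≤ φ i) {a b : I} (hab : a ≠ b) :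
    φ a * φ b ≤ pairSum φ := by
  classical
  rw [pairSum_eq]
  have hnn (a b : I) : 0 ≤ if a = b then 0 else φ a * φ b := by
    split_ifs
    exacts [le_rfl, mul_nonneg (h0 a) (h0 b)]
  refine le_trans ?_ (Finset.single_le_sum (f := fun a => ∑ b, if a = b then 0 else φ a * φ b)
    (fun a _ => Finset.sum_nonneg fun b _ => hnn a b) (Finset.mem_univ a))
  refine le_trans ?_ (Finset.single_le_sum (f := fun b => if a = b then 0 else φ a * φ b)
    (fun b _ => hnn a b) (Finset.mem_univ b))
  simp [hab]

/-- The number of real zeros of `p` in `S`. -/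
def realCount (S : Set ℂ) (p : ℝ[X]) : ℝ :=
  open Classical in ∑ i : RootIdx p, if i.1.im = 0 then S.indicator (fun _ => (1 : ℝ)) i.1 else 0

/-- The number of nonreal zeros of `p` in `S`. -/
def nonrealCount (S : Set ℂ) (p : ℝ[X]) : ℝ :=
  open Classical in ∑ i : RootIdx p, if i.1.im = 0 then 0 else S.indicator (fun _ => (1 : ℝ)) i.1

lemma indicator_one_nonneg {α : Type*} (S : Set α) (x : α) : 0 ≤ S.indicator (fun _ => (1 : ℝ)) x :=
  Set.indicator_nonneg (fun _ _ => zero_le_one) _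

lemma realCount_nonneg (S : Set ℂ) (p : ℝ[X]) : 0 ≤ realCount S p :=
  Finset.sum_nonneg fun i _ => by split_ifs; exacts [indicator_one_nonneg S _, le_rfl]

lemma nonrealCount_nonneg (S : Set ℂ) (p : ℝ[X]) : 0 ≤ nonrealCount S p :=
  Finset.sum_nonneg fun i _ => by split_ifs; exacts [le_rfl, indicator_one_nonneg S _]

lemma realCount_add_nonrealCount (S : Set ℂ) (p : ℝ[X]) :
    realCount S p + nonrealCount S p =
      ∑ i : RootIdx p, S.indicator (fun _ => (1 : ℝ)) i.1 := by
  rw [realCount, nonrealCount, ← Finset.sum_add_distrib]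
  exact Finset.sum_congr rfl fun i _ => by split_ifs <;> simp

/-- With `r` real zeros in `S` there are `r² - r` ordered pairs of distinct ones. -/
lemma zeroTuples_two_zero (p : ℝ[X]) {S : Set ℂ} (hS : MeasurableSet S) :
    zeroTuples 2 0 p {q | (q.1 0 : ℂ) ∈ S ∧ (q.1 1 : ℂ) ∈ S} =
      ENNReal.ofReal (realCount S p ^ 2 - realCount S p) := by
  classical
  have hset : {q : (Fin 2 → ℝ) × (Fin 0 → ℂ) | (q.1 0 : ℂ) ∈ S ∧ (q.1 1 : ℂ) ∈ S} =
      Set.univ.pi (fun _ => Complex.ofReal ⁻¹' S) ×ˢ Set.univ.pi fun _ => Set.univ := by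
    ext q
    simp [Set.mem_pi, Fin.forall_fin_two]
  rw [hset, zeroTuples_box 2 0 p (fun _ => Complex.measurable_ofReal hS)
    (fun _ => MeasurableSet.univ)]
  congr 1
  have h1 : ∑ a : p.roots, (Complex.ofReal ⁻¹' S).indicator (1 : ℝ → ℂ) a.1 = realCount S p := by
    have := sum_roots_eq p (S.indicator (1 : ℂ → ℂ))
    rw [realCount, Complex.ofReal_sum]
    refine Eq.trans ?_ (this.trans ?_)
    · exact Finset.sum_congr rfl fun a _ => by
        by_cases h : ((a.1 : ℝ) : ℂ) ∈ S <;> simp [Set.indicator, h]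
    · exact Finset.sum_congr rfl fun a _ => by
        split_ifs <;> [skip; simp]
        by_cases h : (a.1 : ℂ) ∈ S <;> simp [Set.indicator, h]
  have h2 : ∑ i : Fin 2 ↪ p.roots, ∏ s, (Complex.ofReal ⁻¹' S).indicator (1 : ℝ → ℂ) (i s).1 =
      ((realCount S p ^ 2 - realCount S p : ℝ) : ℂ) := by
    simp only [Fin.prod_univ_two]
    rw [sum_embedding_two (fun a : p.roots => (Complex.ofReal ⁻¹' S).indicator (1 : ℝ → ℂ) a.1)]
    have h3 : ∑ a : p.roots, (Complex.ofReal ⁻¹' S).indicator (1 : ℝ → ℂ) a.1 ^ 2 =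
        realCount S p := by
      rw [← h1]
      exact Finset.sum_congr rfl fun a _ => by
        by_cases h : a.1 ∈ Complex.ofReal ⁻¹' S <;> simp [Set.indicator, h]
    rw [h1, h3]
    push_cast
    rfl
  simp only [h2, Fintype.sum_unique, Finset.univ_eq_empty, Finset.prod_empty, mul_one,
    Complex.ofReal_re]

/-- By the extension to the lower half-plane, `zeroTuples 0 1` counts all nonreal zeros. -/
lemma zeroTuples_zero_one (p : ℝ[X]) {S : Set ℂ} (hS : MeasurableSet S) :
    zeroTuples 0 1 p {q | q.2 0 ∈ S} = ENNReal.ofReal (nonrealCount S p) := by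
  classical
  have hset : {q : (Fin 0 → ℝ) × (Fin 1 → ℂ) | q.2 0 ∈ S} =
      Set.univ.pi (fun _ => Set.univ) ×ˢ Set.univ.pi fun _ => S := by
    ext q
    simp [Set.mem_pi]
  rw [hset, zeroTuples_box 0 1 p (fun _ => MeasurableSet.univ) (fun _ => hS)]
  congr 1
  have h1 (σ : Fin 1 → Bool) : ∑ j : Fin 1 ↪ upperZeros p, ∏ t : Fin 1,
      (conjIf (σ t) ⁻¹' S).indicator (1 : ℂ → ℂ) (j t).1 =
      ∑ i : RootIdx p, if 0 < (conjIf (σ 0) i.1).im then S.indicator (1 : ℂ → ℂ) i.1 else 0 := by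
    rw [← sum_upperZeros_eq p (σ 0) (S.indicator (1 : ℂ → ℂ))]
    refine Fintype.sum_bijective (fun j : Fin 1 ↪ upperZeros p => j 0) ⟨fun a b h => ?_, fun a => ?_⟩
      _ _ fun j => ?_
    · ext t
      rw [Subsingleton.elim t 0]
      exact h
    · exact ⟨⟨fun _ => a, fun _ _ _ => Subsingleton.elim _ _⟩, rfl⟩
    · simp [Set.indicator]
  have h2 : ∑ i : Fin 0 ↪ p.roots, ∏ s, (Set.univ : Set ℝ).indicator (1 : ℝ → ℂ) (i s).1 = 1 := by
    simp
  simp only [h1, h2, one_mul]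
  have h3 : ∑ σ : Fin 1 → Bool, ∑ i : RootIdx p,
      (if 0 < (conjIf (σ 0) i.1).im then S.indicator (1 : ℂ → ℂ) i.1 else 0) =
      ((nonrealCount S p : ℝ) : ℂ) := by
    rw [Fintype.sum_bijective (fun σ : Fin 1 → Bool => σ 0) (Equiv.funUnique (Fin 1) Bool).bijective
      _ (fun ε => ∑ i : RootIdx p,
        (if 0 < (conjIf ε i.1).im then S.indicator (1 : ℂ → ℂ) i.1 else 0)) fun _ => rfl]
    rw [Fintype.sum_bool, ← Finset.sum_add_distrib, nonrealCount, Complex.ofReal_sum]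
    refine Finset.sum_congr rfl fun i _ => ?_
    have hS1 : ((S.indicator (fun _ => (1 : ℝ)) i.1 : ℝ) : ℂ) = S.indicator (1 : ℂ → ℂ) i.1 := by
      by_cases h : (i.1 : ℂ) ∈ S <;> simp [Set.indicator, h]
    rcases lt_trichotomy (i.1 : ℂ).im 0 with h | h | h
    · rw [if_neg h.ne, hS1]
      simp [conjIf, h, h.not_gt]
    · simp [conjIf, h]
    · rw [if_neg h.ne', hS1]
      simp [conjIf, h, h.not_gt]
  rw [h3, Complex.ofReal_re]

lemma measure_le_of_hasDensityLEOn {E : Type*} [MeasureSpace E] {μ : Measure E} {S B : Set E}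
    {C : ℝ} (h : HasDensityLEOn μ S C) (hBS : B ⊆ S) (hB : MeasurableSet B) :
    μ B ≤ ENNReal.ofReal C * volume B := by
  obtain ⟨ρ, hρ, hμ, hC⟩ := h
  have h1 : μ B = μ.restrict S B := by
    rw [Measure.restrict_apply hB, Set.inter_eq_left.2 hBS]
  rw [h1, hμ, withDensity_apply _ hB, Measure.restrict_restrict hB, Set.inter_eq_left.2 hBS]
  calc ∫⁻ q in B, ρ q ≤ ∫⁻ _ in B, ENNReal.ofReal C :=
        setLIntegral_mono measurable_const fun q hq => hC q (hBS hq)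
    _ = _ := by simp

end Pairs

/-! ### Weak repulsion bounds the number of close pairs -/

section ClosePairs

/-- A smooth cutoff on the plane, equal to `1` on the disk of radius `2` and supported in the disk
of radius `4`. -/
def diskBump : ContDiffBump (0 : ℂ) := ⟨2, 4, two_pos, by norm_num⟩

lemma diskBump_of_norm_le {z : ℂ} (h : ‖z‖ ≤ 2) : diskBump z = 1 :=
  diskBump.one_of_mem_closedBall (by simpa [diskBump] using h)

lemma diskBump_of_le_norm {z : ℂ} (h : 4 ≤ ‖z‖) : diskBump z = 0 :=
  diskBump.zero_of_le_dist (by simpa [diskBump] using h)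

lemma smoothBdd_diskBump : SmoothBdd fun z : ℂ => (diskBump z : ℂ) :=
  SmoothBdd.of_hasCompactSupport (Complex.ofRealCLM.contDiff.comp diskBump.contDiff)
    (diskBump.hasCompactSupport.comp_left Complex.ofReal_zero)

/-- The smoothed number of ordered pairs of zeros at distance of order `γ` from `x`. -/
def closePairs (x : ℂ) (γ : ℝ) (p : ℝ[X]) : ℝ :=
  pairSum fun i : RootIdx p => diskBump (γ⁻¹ • (i.1 - x))

lemma closePairs_nonneg (x : ℂ) (γ : ℝ) (p : ℝ[X]) : 0 ≤ closePairs x γ p :=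
  pairSum_nonneg fun _ => diskBump.nonneg

/-- The function `H` rescaled by `γ` around `(x, …, x)`. -/
def rescale {m : ℕ} (x : ℂ) (γ : ℝ) (H : (Fin m → ℂ) → ℂ) (v : Fin m → ℂ) : ℂ :=
  H fun j => γ⁻¹ • (v j - x)

/-- The tensor square of the cutoff. -/
def bumpPair (v : Fin 2 → ℂ) : ℂ := ∏ j, (diskBump (v j) : ℂ)

/-- The pointwise square of the cutoff. -/
def bumpSq (v : Fin 1 → ℂ) : ℂ := (diskBump (v 0) : ℂ) * diskBump (v 0)

lemma smoothBdd_bumpPair : SmoothBdd bumpPair :=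
  SmoothBdd.prod Finset.univ fun j _ => smoothBdd_diskBump.comp_clm
    (ContinuousLinearMap.proj (R := ℝ) (φ := fun _ : Fin 2 => ℂ) j)

lemma smoothBdd_bumpSq : SmoothBdd bumpSq := by
  have h := smoothBdd_diskBump.comp_clm
    (ContinuousLinearMap.proj (R := ℝ) (φ := fun _ : Fin 1 => ℂ) 0)
  exact h.mul h

lemma bumpPair_eq_zero (v : Fin 2 → ℂ) (h : ∃ j, 4 ≤ ‖v j‖) : bumpPair v = 0 := by
  obtain ⟨j, hj⟩ := h
  exact Finset.prod_eq_zero (Finset.mem_univ j) (by rw [diskBump_of_le_norm hj, Complex.ofReal_zero])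

lemma bumpSq_eq_zero (v : Fin 1 → ℂ) (h : ∃ j, 4 ≤ ‖v j‖) : bumpSq v = 0 := by
  obtain ⟨j, hj⟩ := h
  rw [Subsingleton.elim j 0] at hj
  rw [bumpSq, diskBump_of_le_norm hj, Complex.ofReal_zero, mul_zero]

lemma closePairs_eq (x : ℂ) (γ : ℝ) (p : ℝ[X]) :
    ((closePairs x γ p : ℝ) : ℂ) =
      rootSum (rescale x γ bumpPair) p - rootSum (rescale x γ bumpSq) p := by
  rw [closePairs, pairSum, rootSum, rootSum]
  simp only [sum_fin_succ_pi, rescale, bumpPair, bumpSq, Fin.prod_univ_two, Fin.cons_zero]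
  push_cast
  congr 1
  · rw [sq, Finset.sum_mul_sum]
    refine Finset.sum_congr rfl fun a _ => Finset.sum_congr rfl fun b _ => ?_
    simp
  · refine Finset.sum_congr rfl fun a _ => ?_
    simp [sq]

lemma rescale_eq {m : ℕ} (x : ℂ) (γ : ℝ) (H : (Fin m → ℂ) → ℂ) :
    rescale x γ H = fun v => H ((γ⁻¹ • ContinuousLinearMap.id ℝ (Fin m → ℂ)) v +
      fun _ => -(γ⁻¹ • x)) := by
  funext v
  simp only [rescale]
  congr 1
  funext j
  simp [sub_eq_add_neg]

lemma exists_rescale_bound {m : ℕ} {H : (Fin m → ℂ) → ℂ} (hH : SmoothBdd H) :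
    ∃ B : ℝ, 0 < B ∧ ∀ (x : ℂ) (γ : ℝ), 0 < γ → γ ≤ 1 → ContDiff ℝ ∞ (rescale x γ H) ∧
      (∀ v, ‖rescale x γ H v‖ ≤ B * (γ⁻¹) ^ (2 * m)) ∧
      ∀ v, ‖iterLap (rescale x γ H) v‖ ≤ B * (γ⁻¹) ^ (2 * m) := by
  obtain ⟨B, hB1, hB⟩ := hH.exists_derivLE (2 * m)
  refine ⟨2 ^ m * B, by positivity, fun x γ hγ hγ1 => ?_⟩
  have hc : 1 ≤ γ⁻¹ := (one_le_inv₀ hγ).2 hγ1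
  have hL : ‖γ⁻¹ • ContinuousLinearMap.id ℝ (Fin m → ℂ)‖ ≤ γ⁻¹ := by
    rw [norm_smul, Real.norm_of_nonneg (by positivity)]
    exact mul_le_of_le_one_right (by positivity) ContinuousLinearMap.norm_id_le
  have hd := DerivLE.comp_affine hH.1 hB _ hc hL (fun _ => -(γ⁻¹ • x))
  have hs : ContDiff ℝ ∞ (rescale x γ H) := by
    rw [rescale_eq]
    exact hH.1.comp ((ContinuousLinearMap.contDiff _).add contDiff_const)
  rw [← rescale_eq] at hd
  refine ⟨hs, fun v => ?_, fun v => ?_⟩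
  · have h0 := hd 0 (Nat.zero_le _) v
    rw [norm_iteratedFDeriv_zero] at h0
    refine h0.trans ?_
    rw [mul_assoc]
    exact le_mul_of_one_le_left (by positivity) (one_le_pow₀ one_le_two)
  · have := hd.norm_iterLap_le hs v
    rwa [← mul_assoc] at this

lemma tsupport_rescale_subset {m : ℕ} {H : (Fin m → ℂ) → ℂ} (hH : ∀ v, (∃ j, 4 ≤ ‖v j‖) → H v = 0)
    {x w : ℂ} {γ R : ℝ} (hγ : 0 < γ) (hR : ‖x - w‖ + 4 * γ < R) :
    tsupport (rescale x γ H) ⊆ polyBall (fun _ => w) R := by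
  have hsub : tsupport (rescale x γ H) ⊆ {v | ∀ j, v j ∈ Metric.closedBall x (4 * γ)} := by
    refine closure_minimal (fun v hv j => ?_) ?_
    · by_contra hj
      refine hv (hH _ ⟨j, ?_⟩)
      rw [mem_closedBall_iff_norm, not_le] at hj
      rw [norm_smul, Real.norm_of_nonneg (by positivity), inv_mul_eq_div, le_div_iff₀ hγ]
      exact hj.le
    · rw [Set.ofPred_forall]
      exact isClosed_iInter fun j => Metric.isClosed_closedBall.preimage (continuous_apply j)
  intro v hv j
  rw [mem_ball_iff_norm]
  have h1 := mem_closedBall_iff_norm.1 (hsub hv j)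
  calc ‖v j - w‖ = ‖(v j - x) + (x - w)‖ := by congr 1; ring
    _ ≤ 4 * γ + ‖x - w‖ := (norm_add_le _ _).trans (by gcongr)
    _ < R := by linarith

lemma volume_two_zero (x r : ℝ) (hr : 0 < r) :
    volume {q : (Fin 2 → ℝ) × (Fin 0 → ℂ) | (q.1 0 : ℂ) ∈ Metric.ball (x : ℂ) r ∧
      (q.1 1 : ℂ) ∈ Metric.ball (x : ℂ) r} = ENNReal.ofReal ((2 * r) ^ 2) := by
  have h : {q : (Fin 2 → ℝ) × (Fin 0 → ℂ) | (q.1 0 : ℂ) ∈ Metric.ball (x : ℂ) r ∧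
      (q.1 1 : ℂ) ∈ Metric.ball (x : ℂ) r} = Metric.ball (fun _ => x) r ×ˢ Set.univ := by
    ext q
    simp only [Set.mem_ofPred_eq, mem_ball_iff_norm, Set.mem_prod, Set.mem_univ, and_true,
      ← Complex.ofReal_sub, Complex.norm_real]
    rw [pi_norm_lt_iff hr, Fin.forall_fin_two]
    rfl
  rw [h, Measure.volume_eq_prod, Measure.prod_prod, Real.volume_pi_ball _ hr, Fintype.card_fin]
  have : volume (Set.univ : Set (Fin 0 → ℂ)) = 1 := by simp [volume_pi]
  rw [this, mul_one]

lemma volume_zero_one (x : ℂ) (r : ℝ) (hr : 0 < r) :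
    volume {q : (Fin 0 → ℝ) × (Fin 1 → ℂ) | q.2 0 ∈ Metric.ball x r} =
      ENNReal.ofReal (Real.pi * r ^ 2) := by
  have h : {q : (Fin 0 → ℝ) × (Fin 1 → ℂ) | q.2 0 ∈ Metric.ball x r} =
      Set.univ ×ˢ Set.univ.pi fun _ => Metric.ball x r := by
    ext q
    simp [Set.mem_pi]
  have h1 : volume (Set.univ : Set (Fin 0 → ℝ)) = 1 := by simp [volume_pi]
  rw [h, Measure.volume_eq_prod, Measure.prod_prod, h1, one_mul, volume_pi, Measure.pi_pi,
    Fin.prod_univ_one, Complex.volume_ball, mul_comm, ENNReal.ofReal_mul Real.pi_pos.le,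
    ENNReal.ofReal_pow hr.le]
  congr 1
  rw [ENNReal.ofReal, Real.toNNReal_of_nonneg Real.pi_pos.le]
  rfl

/-- In a pair of close zeros either both are real, or one of them is nonreal. -/
lemma closePairs_le (x : ℂ) {γ : ℝ} (hγ : 0 < γ) (p : ℝ[X]) :
    closePairs x γ p ≤ (realCount (Metric.ball x (4 * γ)) p ^ 2 -
        realCount (Metric.ball x (4 * γ)) p) +
      2 * nonrealCount (Metric.ball x (4 * γ)) p *
        ∑ i : RootIdx p, (Metric.ball x (4 * γ)).indicator (fun _ => (1 : ℝ)) i.1 := by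
  set S := Metric.ball x (4 * γ) with hS
  have h1 : closePairs x γ p ≤ pairSum fun i : RootIdx p => S.indicator (fun _ => (1 : ℝ)) i.1 := by
    refine pairSum_mono (fun _ => diskBump.nonneg) fun i => ?_
    by_cases hi : (i.1 : ℂ) ∈ S
    · rw [Set.indicator_of_mem hi]
      exact diskBump.le_one
    · rw [Set.indicator_of_notMem hi, diskBump_of_le_norm]
      rw [hS, mem_ball_iff_norm, not_lt] at hi
      rw [norm_smul, Real.norm_of_nonneg (by positivity), inv_mul_eq_div, le_div_iff₀ hγ]
      exact hi
  refine h1.trans ?_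
  have h2 : ∑ i : RootIdx p, S.indicator (fun _ => (1 : ℝ)) i.1 ^ 2 =
      ∑ i : RootIdx p, S.indicator (fun _ => (1 : ℝ)) i.1 :=
    Finset.sum_congr rfl fun i _ => by by_cases h : (i.1 : ℂ) ∈ S <;> simp [h]
  rw [pairSum, h2, ← realCount_add_nonrealCount]
  have := realCount_nonneg S p
  have := nonrealCount_nonneg S p
  nlinarith [mul_self_nonneg (nonrealCount S p)]

lemma RandomZeros.IsRandomPoly.measurable_rootSum_rescale {Ω : Type*} [MeasurableSpace Ω] {n : ℕ}
    {f : Ω → ℝ[X]} (hf : IsRandomPoly n f) (x : ℂ) {γ : ℝ} (hγ : 0 < γ) {m : ℕ} (hm : m ≠ 0)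
    {H : (Fin m → ℂ) → ℂ} (hH : SmoothBdd H) (h0 : ∀ v, (∃ j, 4 ≤ ‖v j‖) → H v = 0) :
    Measurable fun η => rootSum (rescale x γ H) (f η) := by
  refine hf.measurable_rootSum (R := 4 * γ + 1) (by linarith) hm (w := fun _ => x) ?_
    (tsupport_rescale_subset h0 hγ (by simp))
  rw [rescale_eq]
  exact hH.1.comp ((ContinuousLinearMap.contDiff _).add contDiff_const)

lemma RandomZeros.IsRandomPoly.measurable_closePairs {Ω : Type*} [MeasurableSpace Ω] {n : ℕ}
    {f : Ω → ℝ[X]} (hf : IsRandomPoly n f) (x : ℂ) {γ : ℝ} (hγ : 0 < γ) :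
    Measurable fun η => closePairs x γ (f η) := by
  have h := Complex.measurable_re.comp
    ((hf.measurable_rootSum_rescale x hγ two_ne_zero smoothBdd_bumpPair bumpPair_eq_zero).sub
      (hf.measurable_rootSum_rescale x hγ one_ne_zero smoothBdd_bumpSq bumpSq_eq_zero))
  convert h using 1
  funext η
  simp only [Function.comp_apply, Pi.sub_apply]
  rw [← closePairs_eq, Complex.ofReal_re]

lemma closePairs_le_sq (x : ℂ) (γ : ℝ) {p : ℝ[X]} {n : ℕ} (hp : p.natDegree ≤ n) :
    closePairs x γ p ≤ (n : ℝ) ^ 2 := by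
  have h0 : 0 ≤ ∑ i : RootIdx p, diskBump (γ⁻¹ • (i.1 - x)) :=
    Finset.sum_nonneg fun _ _ => diskBump.nonneg
  have h1 : ∑ i : RootIdx p, diskBump (γ⁻¹ • (i.1 - x)) ≤ n := by
    calc _ ≤ ∑ _i : RootIdx p, (1 : ℝ) := Finset.sum_le_sum fun _ _ => diskBump.le_one
      _ ≤ n := by
        rw [Finset.sum_const, Finset.card_univ, nsmul_eq_mul, mul_one]
        exact_mod_cast card_rootIdx_le hp
  have h2 : 0 ≤ ∑ i : RootIdx p, diskBump (γ⁻¹ • (i.1 - x)) ^ 2 :=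
    Finset.sum_nonneg fun _ _ => sq_nonneg _
  rw [closePairs, pairSum]
  nlinarith

/-- Level repulsion makes close pairs of zeros unlikely near a real point. -/
lemma RandomZeros.WeakLevelRepulsion.integral_closePairs_le {Ω : Type*} [MeasurableSpace Ω]
    {P : Measure Ω} [IsProbabilityMeasure P] {n : ℕ} {f : Ω → ℝ[X]} (hf : IsRandomPoly n f)
    {C : ℝ} {U : Set ℂ} (h : WeakLevelRepulsion P f C U) (hC : 0 < C) (x : ℝ) {γ : ℝ} (hγ : 0 < γ)
    (hγC : 8 * γ ≤ 1 / C) (hU : Metric.ball (x : ℂ) (4 * γ) ⊆ U) {Q δ : ℝ} (hQ : 0 ≤ Q)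
    (hδ : P.real {η | ¬ ∑ i : RootIdx (f η),
      (Metric.ball (x : ℂ) (4 * γ)).indicator (fun _ => (1 : ℝ)) i.1 ≤ Q} ≤ δ) :
    ∫ η, closePairs x γ (f η) ∂P ≤ 64 * C * (1 + 2 * Q) * γ ^ 2 + (n : ℝ) ^ 2 * δ := by
  set S := Metric.ball (x : ℂ) (4 * γ) with hS
  have hSm : MeasurableSet S := Metric.isOpen_ball.measurableSet
  set bad : Set Ω := {η | ¬ ∑ i : RootIdx (f η), S.indicator (fun _ => (1 : ℝ)) i.1 ≤ Q} with hbad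
  have hδ0 : 0 ≤ δ := measureReal_nonneg.trans hδ
  set B₂ : Set ((Fin 2 → ℝ) × (Fin 0 → ℂ)) := {q | (q.1 0 : ℂ) ∈ S ∧ (q.1 1 : ℂ) ∈ S} with hB₂
  set B₁ : Set ((Fin 0 → ℝ) × (Fin 1 → ℂ)) := {q | q.2 0 ∈ S} with hB₁
  have hB₂m : MeasurableSet B₂ := by
    have e0 : Measurable fun q : (Fin 2 → ℝ) × (Fin 0 → ℂ) => ((q.1 0 : ℝ) : ℂ) := by fun_prop
    have e1 : Measurable fun q : (Fin 2 → ℝ) × (Fin 0 → ℂ) => ((q.1 1 : ℝ) : ℂ) := by fun_prop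
    exact (e0 hSm).inter (e1 hSm)
  have hB₁m : MeasurableSet B₁ := by
    have e0 : Measurable fun q : (Fin 0 → ℝ) × (Fin 1 → ℂ) => q.2 0 := by fun_prop
    exact e0 hSm
  have hreal {t : ℝ} (ht : (t : ℂ) ∈ S) : |t - x| < 4 * γ := by
    rwa [hS, mem_ball_iff_norm, ← Complex.ofReal_sub, Complex.norm_real, Real.norm_eq_abs] at ht
  have hm₂ : mixedCorr P f 2 0 B₂ ≤ ENNReal.ofReal (64 * C * γ ^ 2) := by
    refine (measure_le_of_hasDensityLEOn (B := B₂) h.1 (fun q hq => ⟨hU hq.1, hU hq.2, ?_⟩) hB₂m).trans ?_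
    · have h1 := hreal hq.1
      have h2 := hreal hq.2
      calc |q.1 0 - q.1 1| = |(q.1 0 - x) - (q.1 1 - x)| := by congr 1; ring
        _ ≤ |q.1 0 - x| + |q.1 1 - x| := abs_sub _ _
        _ ≤ 1 / C := by linarith
    · rw [hB₂, hS, volume_two_zero x _ (by positivity), ← ENNReal.ofReal_mul hC.le]
      exact ENNReal.ofReal_le_ofReal (by nlinarith)
  have hm₁ : mixedCorr P f 0 1 B₁ ≤ ENNReal.ofReal (64 * C * γ ^ 2) := by
    refine (measure_le_of_hasDensityLEOn (B := B₁) h.2 (fun q hq => ⟨hU hq, ?_⟩) hB₁m).trans ?_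
    · have h1 : ‖q.2 0 - x‖ < 4 * γ := mem_ball_iff_norm.1 hq
      have h2 := Complex.abs_im_le_norm (q.2 0 - x)
      rw [Complex.sub_im, Complex.ofReal_im, sub_zero] at h2
      linarith
    · rw [hB₁, hS, volume_zero_one _ _ (by positivity), ← ENNReal.ofReal_mul hC.le]
      refine ENNReal.ofReal_le_ofReal ?_
      have := Real.pi_lt_four
      have e : 0 ≤ C * γ ^ 2 := by positivity
      nlinarith
  rw [mixedCorr, Measure.bind_apply hB₂m (hf.measurable_zeroTuples 2 0).aemeasurable] at hm₂
  rw [mixedCorr, Measure.bind_apply hB₁m (hf.measurable_zeroTuples 0 1).aemeasurable] at hm₁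
  have hpt (η : Ω) : ENNReal.ofReal (closePairs x γ (f η)) ≤ zeroTuples 2 0 (f η) B₂ +
      ENNReal.ofReal (2 * Q) * zeroTuples 0 1 (f η) B₁ +
        (toMeasurable P bad).indicator (fun _ => ENNReal.ofReal ((n : ℝ) ^ 2)) η := by
    by_cases hη : η ∈ toMeasurable P bad
    · rw [Set.indicator_of_mem hη]
      refine le_add_left (ENNReal.ofReal_le_ofReal ?_)
      exact closePairs_le_sq _ _ (hf.natDegree_le η)
    · have hη' : ∑ i : RootIdx (f η), S.indicator (fun _ => (1 : ℝ)) i.1 ≤ Q := by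
        by_contra hcon
        exact hη (subset_toMeasurable P bad hcon)
      rw [Set.indicator_of_notMem hη, add_zero, zeroTuples_two_zero _ hSm, zeroTuples_zero_one _ hSm,
        ← ENNReal.ofReal_mul (by positivity)]
      refine le_trans (ENNReal.ofReal_le_ofReal ?_) ENNReal.ofReal_add_le
      refine (closePairs_le (x : ℂ) hγ (f η)).trans ?_
      have := nonrealCount_nonneg S (f η)
      rw [← hS]
      nlinarith
  have hlin : ∫⁻ η, ENNReal.ofReal (closePairs x γ (f η)) ∂P ≤
      ENNReal.ofReal (64 * C * (1 + 2 * Q) * γ ^ 2 + (n : ℝ) ^ 2 * δ) := by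
    have hz₂ : Measurable fun η => zeroTuples 2 0 (f η) B₂ :=
      (Measure.measurable_coe hB₂m).comp (hf.measurable_zeroTuples 2 0)
    have hz₁ : Measurable fun η => zeroTuples 0 1 (f η) B₁ :=
      (Measure.measurable_coe hB₁m).comp (hf.measurable_zeroTuples 0 1)
    calc _ ≤ ∫⁻ η, (zeroTuples 2 0 (f η) B₂ +
          ENNReal.ofReal (2 * Q) * zeroTuples 0 1 (f η) B₁ +
            (toMeasurable P bad).indicator (fun _ => ENNReal.ofReal ((n : ℝ) ^ 2)) η) ∂P :=
          lintegral_mono hpt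
      _ = (∫⁻ η, zeroTuples 2 0 (f η) B₂ ∂P) +
          ENNReal.ofReal (2 * Q) * (∫⁻ η, zeroTuples 0 1 (f η) B₁ ∂P) +
            ENNReal.ofReal ((n : ℝ) ^ 2) * P bad := by
          have hz : Measurable fun η => zeroTuples 2 0 (f η) B₂ +
            ENNReal.ofReal (2 * Q) * zeroTuples 0 1 (f η) B₁ := hz₂.add (hz₁.const_mul _)
          rw [lintegral_add_left hz, lintegral_add_left hz₂,
            lintegral_const_mul _ hz₁, lintegral_indicator_const (measurableSet_toMeasurable _ _),
            measure_toMeasurable]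
      _ ≤ ENNReal.ofReal (64 * C * γ ^ 2) + ENNReal.ofReal (2 * Q) *
          ENNReal.ofReal (64 * C * γ ^ 2) + ENNReal.ofReal ((n : ℝ) ^ 2) * ENNReal.ofReal δ := by
          gcongr
          rw [← ofReal_measureReal]
          exact ENNReal.ofReal_le_ofReal hδ
      _ = _ := by
          rw [← ENNReal.ofReal_mul (by positivity), ← ENNReal.ofReal_mul (by positivity),
            ← ENNReal.ofReal_add (by positivity) (by positivity),
            ← ENNReal.ofReal_add (by positivity) (by positivity)]
          congr 1
          ring
  rw [integral_eq_lintegral_of_nonneg_ae (Filter.Eventually.of_forall fun η => closePairs_nonneg _ _ _)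
    (hf.measurable_closePairs x hγ).aestronglyMeasurable]
  exact ENNReal.toReal_le_of_le_ofReal (by positivity) hlin

/-- A nonreal zero near a real point forms a close pair with its conjugate. -/
lemma one_le_closePairs {p : ℝ[X]} {ζ : ℂ} (hζ : ζ ∈ p.aroots ℂ) (him : ζ.im ≠ 0) {x γ : ℝ}
    (hγ : 0 < γ) (h : ‖ζ - x‖ ≤ 2 * γ) : 1 ≤ closePairs x γ p := by
  have hζ' : (starRingEnd ℂ) ζ ∈ p.aroots ℂ := by
    rw [← aroots_map_conj]
    exact Multiset.mem_map_of_mem _ hζ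
  let i : RootIdx p := ⟨ζ, ⟨0, Multiset.count_pos.2 hζ⟩⟩
  let j : RootIdx p := ⟨(starRingEnd ℂ) ζ, ⟨0, Multiset.count_pos.2 hζ'⟩⟩
  have hij : i ≠ j := by
    intro hcon
    have h1 : ζ = (starRingEnd ℂ) ζ := congrArg Sigma.fst hcon
    exact him (Complex.conj_eq_iff_im.1 h1.symm)
  have hone {ξ : ℂ} (hξ : ‖ξ - x‖ ≤ 2 * γ) : diskBump (γ⁻¹ • (ξ - x)) = 1 := by
    refine diskBump_of_norm_le ?_
    rwa [norm_smul, Real.norm_of_nonneg (by positivity), inv_mul_eq_div, div_le_iff₀ hγ]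
  have hj : ‖(starRingEnd ℂ) ζ - x‖ ≤ 2 * γ := by
    have : (starRingEnd ℂ) ζ - x = (starRingEnd ℂ) (ζ - x) := by simp
    rwa [this, Complex.norm_conj]
  have := mul_le_pairSum (φ := fun i : RootIdx p => diskBump (γ⁻¹ • (i.1 - x)))
    (fun _ => diskBump.nonneg) hij
  rw [show diskBump (γ⁻¹ • (i.1 - (x : ℂ))) = 1 from hone h,
    show diskBump (γ⁻¹ • (j.1 - (x : ℂ))) = 1 from hone hj, one_mul] at this
  exact this

end ClosePairs

/-! ### Nonreal zeros near the real axis are unlikely -/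

section Strip

lemma RandomZeros.IsRandomPoly.integrable_rootSum_rescale {Ω : Type*} [MeasurableSpace Ω]
    {P : Measure Ω} [IsProbabilityMeasure P] {n : ℕ} {f : Ω → ℝ[X]} (hf : IsRandomPoly n f) (x : ℂ)
    {γ : ℝ} (hγ : 0 < γ) {m : ℕ} (hm : m ≠ 0) {H : (Fin m → ℂ) → ℂ} (hH : SmoothBdd H)
    (h0 : ∀ v, (∃ j, 4 ≤ ‖v j‖) → H v = 0) :
    Integrable (fun η => rootSum (rescale x γ H) (f η)) P := by
  obtain ⟨B, hB1, hB⟩ := hH.exists_derivLE 0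
  refine Integrable.of_bound (hf.measurable_rootSum_rescale x hγ hm hH h0).aestronglyMeasurable
    ((n : ℝ) ^ m * B) (Filter.Eventually.of_forall fun η =>
      norm_rootSum_le (fun v => ?_) (hf.natDegree_le η))
  have := hB 0 le_rfl fun j => γ⁻¹ • (v j - x)
  rwa [norm_iteratedFDeriv_zero] at this

lemma RandomZeros.IsRandomPoly.ofReal_integral_closePairs {Ω : Type*} [MeasurableSpace Ω]
    {P : Measure Ω} [IsProbabilityMeasure P] {n : ℕ} {f : Ω → ℝ[X]} (hf : IsRandomPoly n f) (x : ℂ)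
    {γ : ℝ} (hγ : 0 < γ) :
    ((∫ η, closePairs x γ (f η) ∂P : ℝ) : ℂ) =
      (∫ η, rootSum (rescale x γ bumpPair) (f η) ∂P) -
        ∫ η, rootSum (rescale x γ bumpSq) (f η) ∂P := by
  rw [← integral_sub
    (hf.integrable_rootSum_rescale x hγ two_ne_zero smoothBdd_bumpPair bumpPair_eq_zero)
    (hf.integrable_rootSum_rescale x hγ one_ne_zero smoothBdd_bumpSq bumpSq_eq_zero),
    ← integral_complex_ofReal]
  simp only [closePairs_eq]

lemma RandomZeros.IsRandomPoly.measureReal_one_le_closePairs {Ω : Type*} [MeasurableSpace Ω]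
    {P : Measure Ω} [IsProbabilityMeasure P] {n : ℕ} {f : Ω → ℝ[X]} (hf : IsRandomPoly n f) (x : ℂ)
    {γ : ℝ} (hγ : 0 < γ) :
    P.real {η | 1 ≤ closePairs x γ (f η)} ≤ ∫ η, closePairs x γ (f η) ∂P := by
  have hi : Integrable (fun η => closePairs x γ (f η)) P :=
    Integrable.of_bound (hf.measurable_closePairs x hγ).aestronglyMeasurable ((n : ℝ) ^ 2)
      (Filter.Eventually.of_forall fun η => by
        rw [Real.norm_of_nonneg (closePairs_nonneg _ _ _)]
        exact closePairs_le_sq _ _ (hf.natDegree_le η))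
  have := mul_meas_ge_le_integral_of_nonneg
    (Filter.Eventually.of_forall fun η => closePairs_nonneg x γ (f η)) hi 1
  rwa [one_mul] at this

/-- The width of the strip around the real axis which is unlikely to contain nonreal zeros. The
exponent `5 K` is large enough for a union bound over a grid of mesh `stripWidth`, and small enough
for `stripWidth ^ (-2 K)` to be negligible against the gain `N ^ (34 K²)` in the comparison. -/
def stripWidth (C N : ℝ) (K : ℕ) : ℝ := (8 * C)⁻¹ * (N ^ (5 * K))⁻¹

/-- Close pairs of zeros near a real point are unlikely for both random polynomials. -/
theorem exists_measureReal_closePairs_le {C r₀ c₀ A : ℝ} {a₀ K : ℕ}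
    (hK : ReplacementConstants C r₀ c₀ A a₀ K) :
    ∃ D : ℝ, 0 < D ∧ ∀ {Ω Ω' : Type*} [MeasurableSpace Ω] [MeasurableSpace Ω']
      {P : Measure Ω} {P' : Measure Ω'} [IsProbabilityMeasure P] [IsProbabilityMeasure P']
      {f : Ω → ℝ[X]} {f' : Ω' → ℝ[X]} {n : ℕ} {W U : Set ℂ},
      Replaceable C r₀ c₀ A a₀ n P P' f f' W U → ∀ w ∈ W, ∀ x : ℝ,
      ‖x - w‖ ≤ 2 * r₀ + 2 * stripWidth C ((n : ℝ) ^ (1 / A)) K →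
      P.real {η | 1 ≤ closePairs x (stripWidth C ((n : ℝ) ^ (1 / A)) K) (f η)} ≤
          D * (((n : ℝ) ^ (1 / A)) ^ (8 * K))⁻¹ ∧
        P'.real {η | 1 ≤ closePairs x (stripWidth C ((n : ℝ) ^ (1 / A)) K) (f' η)} ≤
          D * (((n : ℝ) ^ (1 / A)) ^ (8 * K))⁻¹ := by
  have hr := hK.one_le_r
  have hC := hK.one_le_C
  have hA1 := hK.one_le_A
  have hK1 := hK.one_le_K
  have hKK : K ≤ K ^ 2 := by nlinarith
  obtain ⟨D₁, hD₁, hc₁⟩ := exists_norm_integral_rootSum_sub_le_pow hK 1 hK1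
  obtain ⟨D₀, hD₀, hc₀⟩ := exists_norm_integral_rootSum_sub_le_pow hK 0 (Nat.zero_le _)
  obtain ⟨B₁, hB₁, hb₁⟩ := exists_rescale_bound smoothBdd_bumpPair
  obtain ⟨B₀, hB₀, hb₀⟩ := exists_rescale_bound smoothBdd_bumpSq
  set C₁ : ℝ := 8 * C * (A + 1) + 1 with hC₁
  have hC₁0 : 0 < C₁ := by positivity
  set C₂ : ℝ := 2 * (A + 1) * C with hC₂
  have hC₂0 : 0 < C₂ := by positivity
  set E₁ : ℝ := 64 * C * (1 + 2 * ((3 * r₀) ^ 2 * C₁)) * ((8 * C)⁻¹) ^ 2 + C₂ with hE₁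
  have hE₁0 : 0 < E₁ := by positivity
  set E₂ : ℝ := D₁ * (B₁ * (8 * C) ^ 4) + D₀ * (B₀ * (8 * C) ^ 4) with hE₂
  have hE₂0 : 0 < E₂ := by positivity
  refine ⟨E₁ + E₂, by positivity, ?_⟩
  intro Ω Ω' _ _ P P' _ _ f f' n W U hR w hw x hx
  have hn := hR.one_le
  set N : ℝ := (n : ℝ) ^ (1 / A) with hN
  have hN1 : 1 ≤ N := hK.one_le_N hn
  have hN0 : 0 < N := by linarith
  set γ : ℝ := stripWidth C N K with hγdef
  have hγ0 : 0 < γ := by rw [hγdef, stripWidth]; positivity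
  have hγ8 : γ ≤ (8 * C)⁻¹ := by
    rw [hγdef, stripWidth]
    exact mul_le_of_le_one_right (by positivity) (inv_le_one_of_one_le₀ (one_le_pow₀ hN1))
  have hγC : 8 * γ ≤ 1 / C := by
    have : 8 * (8 * C)⁻¹ = 1 / C := by field_simp
    linarith
  have hγ1 : γ ≤ 1 / 8 := by
    have : 1 / C ≤ 1 := by rw [div_le_one (by linarith)]; exact hC
    linarith
  have hxR : ‖(x : ℂ) - w‖ + 4 * γ < 3 * r₀ := by linarith
  have hball : Metric.ball (x : ℂ) (4 * γ) ⊆ Metric.ball w (3 * r₀) := by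
    refine Metric.ball_subset_ball' ?_
    rw [dist_eq_norm]
    linarith
  have hballU : Metric.ball (x : ℂ) (4 * γ) ⊆ U :=
    (hball.trans (Metric.ball_subset_ball (by linarith))).trans (hR.ball_subset w hw)
  -- For `f'` the bound comes from repulsion: two zeros in a disk of radius `4 γ` cost `γ ²`.
  have hf' : ∫ η, closePairs x γ (f' η) ∂P' ≤ E₁ * (N ^ (8 * K))⁻¹ := by
    have hδ := (hR.nonClustering' w hw).measureReal_zeroWeight hR.random' hn (by linarith) hA1
    have hδ' : P'.real {η | ¬ ∑ i : RootIdx (f' η),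
        (Metric.ball (x : ℂ) (4 * γ)).indicator (fun _ => (1 : ℝ)) i.1 ≤
          (3 * r₀) ^ 2 * (C₁ * N ^ 2)} ≤ C₂ * N * (n : ℝ) ^ (-A) := by
      refine (measureReal_mono (fun η hη => ?_) (measure_ne_top _ _)).trans hδ
      intro hcon
      refine hη ?_
      calc _ ≤ ∑ i : RootIdx (f' η), (Metric.ball w (3 * r₀)).indicator (fun _ => (1 : ℝ)) i.1 :=
            Finset.sum_le_sum fun i _ =>
              Set.indicator_le_indicator_of_subset hball (fun _ => zero_le_one) _
        _ ≤ (3 * r₀) ^ 2 * zeroWeight w (f' η) := sum_indicator_le_zeroWeight _ _ (by linarith)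
        _ ≤ _ := by gcongr
    refine (hR.repulsion.integral_closePairs_le hR.random' (by linarith) x hγ0 hγC hballU
      (by positivity) hδ').trans ?_
    have t1 : 64 * C * (1 + 2 * ((3 * r₀) ^ 2 * (C₁ * N ^ 2))) * γ ^ 2 ≤
        64 * C * (1 + 2 * ((3 * r₀) ^ 2 * C₁)) * ((8 * C)⁻¹) ^ 2 * (N ^ (8 * K))⁻¹ := by
      have h1 : 1 + 2 * ((3 * r₀) ^ 2 * (C₁ * N ^ 2)) ≤ (1 + 2 * ((3 * r₀) ^ 2 * C₁)) * N ^ 2 := by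
        have : 1 ≤ N ^ 2 := one_le_pow₀ hN1
        nlinarith
      have h2 : γ ^ 2 = ((8 * C)⁻¹) ^ 2 * (N ^ (10 * K))⁻¹ := by
        rw [hγdef, stripWidth, mul_pow, inv_pow (N ^ _), ← pow_mul]
        congr 3
        ring
      calc _ ≤ 64 * C * ((1 + 2 * ((3 * r₀) ^ 2 * C₁)) * N ^ 2) *
            (((8 * C)⁻¹) ^ 2 * (N ^ (10 * K))⁻¹) := by rw [h2]; gcongr
        _ = 64 * C * (1 + 2 * ((3 * r₀) ^ 2 * C₁)) * ((8 * C)⁻¹) ^ 2 *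
            (N ^ 2 * (N ^ (10 * K))⁻¹) := by ring
        _ ≤ _ := by
          gcongr
          exact pow_mul_inv_pow_le hN1 (by omega)
    have t2 : (n : ℝ) ^ 2 * (C₂ * N * (n : ℝ) ^ (-A)) ≤ C₂ * (N ^ (8 * K))⁻¹ := by
      calc _ = C₂ * (N ^ 1 * ((n : ℝ) ^ 2 * (n : ℝ) ^ (-A))) := by ring
        _ ≤ C₂ * (N ^ 1 * (N ^ (600 * K ^ 2 - 2))⁻¹) := by
          gcongr
          exact hK.rpow_neg_A_le hn (by nlinarith)
        _ ≤ _ := by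
          gcongr
          exact pow_mul_inv_pow_le hN1 (by omega)
    calc _ ≤ _ := add_le_add t1 t2
      _ = _ := by rw [hE₁]; ring
  -- The number of close pairs is a difference of two smooth statistics, so the bound transfers
  -- to `f`.
  have hcmp : |(∫ η, closePairs x γ (f η) ∂P) - ∫ η, closePairs x γ (f' η) ∂P'| ≤
      E₂ * (N ^ (8 * K))⁻¹ := by
    have hγinv : (γ⁻¹) ^ 4 = (8 * C) ^ 4 * N ^ (20 * K) := by
      rw [hγdef, stripWidth, mul_inv, inv_inv, inv_inv, mul_pow, ← pow_mul]
      congr 2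
      ring
    have hγinv1 : 1 ≤ γ⁻¹ := (one_le_inv₀ hγ0).2 (by linarith)
    have hpow : N ^ (20 * K) * (N ^ (34 * K ^ 2))⁻¹ ≤ (N ^ (8 * K))⁻¹ :=
      pow_mul_inv_pow_le hN1 (by omega)
    obtain ⟨s1, n1, l1⟩ := hb₁ x γ hγ0 (by linarith)
    obtain ⟨s0, n0, l0⟩ := hb₀ x γ hγ0 (by linarith)
    have k1 := hc₁ hR (fun _ => w) _ _ (fun _ => hw) s1
      (tsupport_rescale_subset bumpPair_eq_zero hγ0 hxR) n1 l1
    have k0 := hc₀ hR (fun _ => w) _ _ (fun _ => hw) s0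
      (tsupport_rescale_subset bumpSq_eq_zero hγ0 hxR) n0 l0
    have j1 : D₁ * (B₁ * γ⁻¹ ^ (2 * 2)) * (N ^ (34 * K ^ 2))⁻¹ ≤
        D₁ * (B₁ * (8 * C) ^ 4) * (N ^ (8 * K))⁻¹ := by
      rw [show 2 * 2 = 4 from rfl, hγinv]
      calc _ = D₁ * (B₁ * (8 * C) ^ 4) * (N ^ (20 * K) * (N ^ (34 * K ^ 2))⁻¹) := by ring
        _ ≤ _ := by gcongr
    have j0 : D₀ * (B₀ * γ⁻¹ ^ (2 * 1)) * (N ^ (34 * K ^ 2))⁻¹ ≤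
        D₀ * (B₀ * (8 * C) ^ 4) * (N ^ (8 * K))⁻¹ := by
      have h1 : γ⁻¹ ^ (2 * 1) ≤ γ⁻¹ ^ 4 := pow_le_pow_right₀ hγinv1 (by norm_num)
      calc _ ≤ D₀ * (B₀ * γ⁻¹ ^ 4) * (N ^ (34 * K ^ 2))⁻¹ := by gcongr
        _ = D₀ * (B₀ * (8 * C) ^ 4) * (N ^ (20 * K) * (N ^ (34 * K ^ 2))⁻¹) := by
            rw [hγinv]; ring
        _ ≤ _ := by gcongr
    rw [← Real.norm_eq_abs, ← Complex.norm_real, Complex.ofReal_sub,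
      hR.random.ofReal_integral_closePairs _ hγ0, hR.random'.ofReal_integral_closePairs _ hγ0]
    have hre (a b c d : ℂ) : (a - b) - (c - d) = (a - c) - (b - d) := by ring
    rw [hre]
    refine (norm_sub_le _ _).trans ((add_le_add (k1.trans j1) (k0.trans j0)).trans ?_)
    rw [hE₂, add_mul]
  have hpos : 0 ≤ (N ^ (8 * K))⁻¹ := by positivity
  constructor
  · refine (hR.random.measureReal_one_le_closePairs _ hγ0).trans ?_
    have := (abs_le.1 hcmp).2
    rw [add_mul]
    linarith
  · refine (hR.random'.measureReal_one_le_closePairs _ hγ0).trans (hf'.trans ?_)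
    gcongr
    linarith

/-- The polynomial `p` has a nonreal zero of imaginary part at most `γ` in the disk of radius
`2 r₀` around `w`. -/
def HasStripZero (w : ℂ) (r₀ γ : ℝ) (p : ℝ[X]) : Prop :=
  ∃ ζ ∈ p.aroots ℂ, ζ.im ≠ 0 ∧ |ζ.im| ≤ γ ∧ ‖ζ - w‖ ≤ 2 * r₀

/-- A nonreal zero close to the real axis forms a close pair with its conjugate, and the strip is
covered by disks centred at a grid of mesh `γ` on the real axis. -/
lemma HasStripZero.exists_one_le_closePairs {w : ℂ} {r₀ γ : ℝ} {p : ℝ[X]} (hγ : 0 < γ)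
    (h : HasStripZero w r₀ γ p) :
    ∃ j ∈ Finset.Icc (-⌈2 * r₀ / γ + 1⌉) ⌈2 * r₀ / γ + 1⌉,
      ‖((w.re + j * γ : ℝ) : ℂ) - w‖ ≤ 2 * r₀ + 2 * γ ∧
        1 ≤ closePairs ((w.re + j * γ : ℝ) : ℂ) γ p := by
  obtain ⟨ζ, hζ, him, hγζ, hw⟩ := h
  set t : ℝ := (ζ.re - w.re) / γ with ht
  have hre : |ζ.re - w.re| ≤ 2 * r₀ := by
    have := Complex.abs_re_le_norm (ζ - w)
    rw [Complex.sub_re] at this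
    linarith
  have htle : |t| ≤ 2 * r₀ / γ := by
    rw [ht, abs_div, abs_of_pos hγ]
    gcongr
  have hround := abs_sub_round t
  set j := round t with hj
  have hx : ‖ζ - ((w.re + j * γ : ℝ) : ℂ)‖ ≤ 2 * γ := by
    have h1 : |ζ.re - (w.re + j * γ)| ≤ γ := by
      have : ζ.re - (w.re + j * γ) = (t - j) * γ := by
        rw [ht]; field_simp; ring
      rw [this, abs_mul, abs_of_pos hγ]
      nlinarith
    calc _ ≤ |(ζ - ((w.re + j * γ : ℝ) : ℂ)).re| + |(ζ - ((w.re + j * γ : ℝ) : ℂ)).im| :=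
          Complex.norm_le_abs_re_add_abs_im _
      _ ≤ γ + γ := by
          rw [Complex.sub_re, Complex.sub_im, Complex.ofReal_re, Complex.ofReal_im, sub_zero]
          gcongr
      _ = _ := by ring
  refine ⟨j, ?_, ?_, one_le_closePairs hζ him hγ hx⟩
  · have h1 : |(j : ℝ)| ≤ 2 * r₀ / γ + 1 := by
      calc |(j : ℝ)| = |t - (t - j)| := by congr 1; ring
        _ ≤ |t| + |t - j| := abs_sub _ _
        _ ≤ _ := by linarith
    have h2 := Int.le_ceil (2 * r₀ / γ + 1)
    rw [Finset.mem_Icc]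
    have h3 := abs_le.1 (h1.trans h2)
    constructor
    · exact_mod_cast h3.1
    · exact_mod_cast h3.2
  · calc _ = ‖(ζ - w) - (ζ - ((w.re + j * γ : ℝ) : ℂ))‖ := by congr 1; ring
      _ ≤ _ := (norm_sub_le _ _).trans (add_le_add hw hx)

lemma measureReal_hasStripZero_le {Ω : Type*} [MeasurableSpace Ω] {P : Measure Ω}
    [IsProbabilityMeasure P] {f : Ω → ℝ[X]} {w : ℂ} {r₀ γ b : ℝ} (hγ : 0 < γ) (hr : 0 ≤ r₀)
    (hb : 0 ≤ b)
    (h : ∀ x : ℝ, ‖x - w‖ ≤ 2 * r₀ + 2 * γ → P.real {η | 1 ≤ closePairs x γ (f η)} ≤ b) :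
    P.real {η | HasStripZero w r₀ γ (f η)} ≤ (4 * r₀ / γ + 5) * b := by
  classical
  set J : ℤ := ⌈2 * r₀ / γ + 1⌉ with hJ
  have hJ0 : 0 ≤ J := Int.ceil_nonneg (by positivity)
  set s := (Finset.Icc (-J) J).filter fun j : ℤ =>
    ‖((w.re + j * γ : ℝ) : ℂ) - w‖ ≤ 2 * r₀ + 2 * γ with hs
  let S : ℤ → Set Ω := fun j => {η | 1 ≤ closePairs ((w.re + j * γ : ℝ) : ℂ) γ (f η)}
  have hsub : {η | HasStripZero w r₀ γ (f η)} ⊆ ⋃ j ∈ s, S j := by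
    intro η hη
    obtain ⟨j, hj, hj1, hj2⟩ := HasStripZero.exists_one_le_closePairs hγ hη
    exact Set.mem_biUnion (Finset.mem_filter.2 ⟨hj, hj1⟩ : j ∈ s) hj2
  have h1 := measureReal_mono (μ := P) hsub (measure_ne_top _ _)
  have h2 := measureReal_biUnion_finset_le (μ := P) s S
  have h3 : ∑ j ∈ s, P.real (S j) ≤ ∑ _j ∈ s, b :=
    Finset.sum_le_sum fun j hj => h _ (Finset.mem_filter.1 hj).2
  rw [Finset.sum_const, nsmul_eq_mul] at h3
  refine h1.trans (h2.trans (h3.trans ?_))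
  gcongr
  have h4 : (s.card : ℝ) ≤ ((Finset.Icc (-J) J).card : ℝ) := by
    exact_mod_cast Finset.card_filter_le _ _
  rw [Int.card_Icc] at h4
  have h5 : (((J + 1 - -J).toNat : ℕ) : ℝ) = 2 * J + 1 := by
    have : (((J + 1 - -J).toNat : ℤ) : ℝ) = ((J + 1 - -J : ℤ) : ℝ) := by
      rw [Int.toNat_of_nonneg (by omega)]
    rw [Int.cast_natCast] at this
    rw [this]
    push_cast
    ring
  have h6 : (J : ℝ) < 2 * r₀ / γ + 1 + 1 := Int.ceil_lt_add_one _
  rw [h5] at h4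
  have h7 : 4 * r₀ / γ = 2 * (2 * r₀ / γ) := by ring
  rw [h7]
  linarith

/-- Both random polynomials are unlikely to have nonreal zeros in a thin strip around the real
axis. -/
theorem exists_measureReal_hasStripZero_le {C r₀ c₀ A : ℝ} {a₀ K : ℕ}
    (hK : ReplacementConstants C r₀ c₀ A a₀ K) :
    ∃ D : ℝ, 0 < D ∧ ∀ {Ω Ω' : Type*} [MeasurableSpace Ω] [MeasurableSpace Ω']
      {P : Measure Ω} {P' : Measure Ω'} [IsProbabilityMeasure P] [IsProbabilityMeasure P']
      {f : Ω → ℝ[X]} {f' : Ω' → ℝ[X]} {n : ℕ} {W U : Set ℂ},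
      Replaceable C r₀ c₀ A a₀ n P P' f f' W U → ∀ w ∈ W,
      P.real {η | HasStripZero w r₀ (stripWidth C ((n : ℝ) ^ (1 / A)) K) (f η)} ≤
          D * (((n : ℝ) ^ (1 / A)) ^ (3 * K))⁻¹ ∧
        P'.real {η | HasStripZero w r₀ (stripWidth C ((n : ℝ) ^ (1 / A)) K) (f' η)} ≤
          D * (((n : ℝ) ^ (1 / A)) ^ (3 * K))⁻¹ := by
  have hr := hK.one_le_r
  have hC := hK.one_le_C
  obtain ⟨D, hD, h⟩ := exists_measureReal_closePairs_le hK
  refine ⟨9 * r₀ * (8 * C) * D, by positivity, ?_⟩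
  intro Ω Ω' _ _ P P' _ _ f f' n W U hR w hw
  have h := h hR w hw
  set N : ℝ := (n : ℝ) ^ (1 / A) with hN
  have hN1 : 1 ≤ N := hK.one_le_N hR.one_le
  have hN0 : 0 < N := by linarith
  have hγ0 : 0 < stripWidth C N K := by rw [stripWidth]; positivity
  have hinv : (stripWidth C N K)⁻¹ = 8 * C * N ^ (5 * K) := by
    rw [stripWidth, mul_inv, inv_inv, inv_inv]
  have hinv1 : 1 ≤ (stripWidth C N K)⁻¹ := by
    rw [hinv]
    have : 1 ≤ N ^ (5 * K) := one_le_pow₀ hN1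
    nlinarith
  have hfin : (4 * r₀ / stripWidth C N K + 5) * (D * (N ^ (8 * K))⁻¹) ≤
      9 * r₀ * (8 * C) * D * (N ^ (3 * K))⁻¹ := by
    have h1 : 4 * r₀ / stripWidth C N K + 5 ≤ 9 * r₀ * (8 * C * N ^ (5 * K)) := by
      rw [div_eq_mul_inv, ← hinv]
      nlinarith
    calc _ ≤ 9 * r₀ * (8 * C * N ^ (5 * K)) * (D * (N ^ (8 * K))⁻¹) := by gcongr
      _ = 9 * r₀ * (8 * C) * D * (N ^ (5 * K) * (N ^ (8 * K))⁻¹) := by ring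
      _ ≤ _ := by
        gcongr
        exact pow_mul_inv_pow_le hN1 (by omega)
  exact ⟨(measureReal_hasStripZero_le hγ0 (by linarith) (by positivity)
      fun x hx => (h x hx).1).trans hfin,
    (measureReal_hasStripZero_le hγ0 (by linarith) (by positivity)
      fun x hx => (h x hx).2).trans hfin⟩

end Strip

/-! ### Localized test functions for the zero tuples -/

section TestFunctions

lemma norm_iteratedFDeriv_le_of_gradNorm {ι V : Type*} [Fintype ι] [NormedAddCommGroup V]
    [NormedSpace ℝ V] (b : Module.Basis ι ℝ V) (hb : ∀ v i, |b.repr v i| ≤ ‖v‖) {a : ℕ} {F : V → ℂ}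
    {w : V} {M : ℝ} (h : gradNorm b a F w ≤ M) :
    ‖iteratedFDeriv ℝ a F w‖ ≤ (Fintype.card ι : ℝ) ^ a * M := by
  classical
  have hM : 0 ≤ M := (Real.sqrt_nonneg _).trans h
  have hterm (i : Fin a → ι) : ‖iteratedFDeriv ℝ a F w (fun j => b (i j))‖ ≤ M := by
    refine le_trans ?_ h
    rw [gradNorm]
    refine Real.le_sqrt_of_sq_le ?_
    exact Finset.single_le_sum
      (f := fun i : Fin a → ι => ‖iteratedFDeriv ℝ a F w (fun j => b (i j))‖ ^ 2)
      (fun _ _ => sq_nonneg _) (Finset.mem_univ i)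
  refine ContinuousMultilinearMap.opNorm_le_bound (by positivity) fun v => ?_
  have hv : v = fun j => ∑ i, b.repr (v j) i • b i := by
    funext j
    exact (b.sum_repr (v j)).symm
  have hexp : iteratedFDeriv ℝ a F w v =
      ∑ r : Fin a → ι, (∏ j, b.repr (v j) (r j)) • iteratedFDeriv ℝ a F w fun j => b (r j) := by
    conv_lhs => rw [hv]
    rw [ContinuousMultilinearMap.map_sum]
    exact Finset.sum_congr rfl fun r _ => ContinuousMultilinearMap.map_smul_univ _ _ _
  rw [hexp]
  calc _ ≤ ∑ _r : Fin a → ι, (∏ j, ‖v j‖) * M := by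
        refine (norm_sum_le _ _).trans (Finset.sum_le_sum fun r _ => ?_)
        rw [norm_smul, Real.norm_eq_abs, Finset.abs_prod]
        gcongr with j
        · exact hb _ _
        · exact hterm r
    _ = _ := by
        rw [Finset.sum_const, Finset.card_univ, Fintype.card_pi, Finset.prod_const,
          Finset.card_univ, Fintype.card_fin, nsmul_eq_mul]
        push_cast
        ring

lemma abs_mixedBasis_repr_le {k l : ℕ} (v : (Fin k → ℝ) × (Fin l → ℂ))
    (i : Fin k ⊕ (Σ _ : Fin l, Fin 2)) : |(mixedBasis k l).repr v i| ≤ ‖v‖ := by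
  rcases i with s | ⟨t, e⟩
  · simp only [mixedBasis, Module.Basis.prod_repr_inl, Pi.basisFun_repr]
    exact (norm_le_pi_norm v.1 s).trans (norm_fst_le v)
  · simp only [mixedBasis, Module.Basis.prod_repr_inr, complexBasis, Pi.basis_repr]
    have h : ‖v.2 t‖ ≤ ‖v‖ := (norm_le_pi_norm v.2 t).trans (norm_snd_le v)
    refine le_trans ?_ h
    fin_cases e
    · simpa using Complex.abs_re_le_norm (v.2 t)
    · simpa using Complex.abs_im_le_norm (v.2 t)

lemma exists_derivLE_of_gradNorm (k l d : ℕ) : ∃ D : ℝ, 0 < D ∧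
    ∀ (G : (Fin k → ℝ) × (Fin l → ℂ) → ℂ) (M : ℝ),
      (∀ a ≤ d, ∀ w, gradNorm (mixedBasis k l) a G w ≤ M) → DerivLE d (D * M) G := by
  set c : ℝ := (Fintype.card (Fin k ⊕ (Σ _ : Fin l, Fin 2)) : ℝ) + 1 with hc
  have hc1 : 1 ≤ c := by
    rw [hc]
    exact le_add_of_nonneg_left (Nat.cast_nonneg _)
  refine ⟨c ^ d, by positivity, fun G M h a ha w => ?_⟩
  have hM : 0 ≤ M := (Real.sqrt_nonneg _).trans (h a ha w)
  refine (norm_iteratedFDeriv_le_of_gradNorm _ abs_mixedBasis_repr_le (h a ha w)).trans ?_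
  gcongr
  calc _ ≤ c ^ a := by gcongr; rw [hc]; linarith
    _ ≤ c ^ d := pow_le_pow_right₀ hc1 ha

/-- Conjugation if `ε` is true, as a real-linear map. -/
def conjIfCLM (ε : Bool) : ℂ →L[ℝ] ℂ :=
  bif ε then (Complex.conjCLE : ℂ →L[ℝ] ℂ) else ContinuousLinearMap.id ℝ ℂ

lemma conjIfCLM_apply (ε : Bool) (z : ℂ) : conjIfCLM ε z = conjIf ε z := by
  cases ε <;> simp [conjIfCLM, conjIf]

lemma norm_conjIf (ε : Bool) (z : ℂ) : ‖conjIf ε z‖ = ‖z‖ := by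
  cases ε <;> simp [conjIf]

lemma abs_conjIf_im (ε : Bool) (z : ℂ) : |(conjIf ε z).im| = |z.im| := by
  cases ε <;> simp [conjIf]

lemma conjIf_smul (ε : Bool) (c : ℝ) (z : ℂ) : conjIf ε (c • z) = c • conjIf ε z := by
  rw [← conjIfCLM_apply, map_smul, conjIfCLM_apply]

variable {k l m₁ m₂ : ℕ} (π₁ : Fin k → Fin m₁) (π₂ : Fin l → Fin m₂) (σ : Fin l → Bool)
  (t₀ : Fin m₂ → Fin l)

/-- The point of `ℝ^k × ℂ^l` whose coordinates are read off from a tuple of zeros, along `π₁` for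
the real coordinates and along `π₂` for the complex ones. The `q`-th complex entry of the tuple is
conjugated as prescribed by `σ` at the representative `t₀ q` of the fibre of `q`. -/
def evalMap : (Fin (m₁ + m₂) → ℂ) →L[ℝ] (Fin k → ℝ) × (Fin l → ℂ) :=
  (ContinuousLinearMap.pi fun s => Complex.reCLM.comp
    (ContinuousLinearMap.proj (R := ℝ) (φ := fun _ : Fin (m₁ + m₂) => ℂ)
      (Fin.castAdd m₂ (π₁ s)))).prod
  (ContinuousLinearMap.pi fun t => ((conjIfCLM (σ t)).comp (conjIfCLM (σ (t₀ (π₂ t))))).comp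
    (ContinuousLinearMap.proj (R := ℝ) (φ := fun _ : Fin (m₁ + m₂) => ℂ)
      (Fin.natAdd m₁ (π₂ t))))

lemma evalMap_fst (v : Fin (m₁ + m₂) → ℂ) (s : Fin k) :
    (evalMap π₁ π₂ σ t₀ v).1 s = (v (Fin.castAdd m₂ (π₁ s))).re := rfl

lemma evalMap_snd (v : Fin (m₁ + m₂) → ℂ) (t : Fin l) :
    (evalMap π₁ π₂ σ t₀ v).2 t =
      conjIf (σ t) (conjIf (σ (t₀ (π₂ t))) (v (Fin.natAdd m₁ (π₂ t)))) := by
  rw [← conjIfCLM_apply, ← conjIfCLM_apply]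
  rfl

lemma norm_evalMap_le : ‖evalMap π₁ π₂ σ t₀‖ ≤ 1 := by
  refine ContinuousLinearMap.opNorm_le_bound _ zero_le_one fun v => ?_
  rw [one_mul, Prod.norm_def]
  refine max_le ((pi_norm_le_iff_of_nonneg (norm_nonneg _)).2 fun s => ?_)
    ((pi_norm_le_iff_of_nonneg (norm_nonneg _)).2 fun t => ?_)
  · rw [evalMap_fst, Real.norm_eq_abs]
    exact (Complex.abs_re_le_norm _).trans (norm_le_pi_norm v _)
  · rw [evalMap_snd, norm_conjIf, norm_conjIf]
    exact norm_le_pi_norm v _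

/-- The first `m₁` entries of the tuple are real, and the `q`-th of the others lies in the open
upper or lower half-plane according to `σ (t₀ q)`. -/
def IsType (v : Fin (m₁ + m₂) → ℂ) : Prop :=
  (∀ q : Fin m₁, (v (Fin.castAdd m₂ q)).im = 0) ∧
    ∀ q : Fin m₂, 0 < (conjIf (σ (t₀ q)) (v (Fin.natAdd m₁ q))).im

/-- A smooth approximation of the indicator function of `IsType`, at scale `1`. -/
def typeCutoff (v : Fin (m₁ + m₂) → ℂ) : ℂ :=
  (∏ q : Fin m₁, (cutoff (2 * (v (Fin.castAdd m₂ q)).im) : ℂ)) *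
    ∏ q : Fin m₂, (Real.smoothTransition (conjIf (σ (t₀ q)) (v (Fin.natAdd m₁ q))).im : ℂ)

lemma smoothBdd_typeCutoff : SmoothBdd (typeCutoff (m₁ := m₁) σ t₀) := by
  refine SmoothBdd.mul ?_ ?_
  · refine SmoothBdd.prod Finset.univ fun q _ => ?_
    exact smoothBdd_cutoff.comp_clm ((2 : ℝ) • Complex.imCLM.comp
      (ContinuousLinearMap.proj (R := ℝ) (φ := fun _ : Fin (m₁ + m₂) => ℂ) (Fin.castAdd m₂ q)))
  · refine SmoothBdd.prod Finset.univ fun q _ => ?_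
    have := smoothBdd_smoothTransition.comp_clm ((Complex.imCLM.comp (conjIfCLM (σ (t₀ q)))).comp
      (ContinuousLinearMap.proj (R := ℝ) (φ := fun _ : Fin (m₁ + m₂) => ℂ) (Fin.natAdd m₁ q)))
    convert this using 3
    simp [conjIfCLM_apply]

lemma norm_typeCutoff_le (v : Fin (m₁ + m₂) → ℂ) : ‖typeCutoff σ t₀ v‖ ≤ 1 := by
  rw [typeCutoff, norm_mul, norm_prod, norm_prod]
  refine mul_le_one₀ (Finset.prod_le_one (fun _ _ => norm_nonneg _) fun q _ => ?_)
    (Finset.prod_nonneg fun _ _ => norm_nonneg _)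
    (Finset.prod_le_one (fun _ _ => norm_nonneg _) fun q _ => ?_)
  · rw [Complex.norm_real, Real.norm_of_nonneg cutoff.nonneg]
    exact cutoff.le_one
  · rw [Complex.norm_real, Real.norm_of_nonneg (Real.smoothTransition.nonneg _)]
    exact Real.smoothTransition.le_one _

/-- A sum over tuples of real zeros and tuples of zeros in the upper half-plane, rewritten as a sum
over tuples of complex zeros. -/
lemma sum_roots_upperZeros_eq (p : ℝ[X])
    (F : (Fin k → ℝ) × (Fin l → ℂ) → ℂ) :
    open Classical in
    ∑ a : Fin m₁ → p.roots, ∑ b : Fin m₂ → upperZeros p,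
      F (fun s => (a (π₁ s)).1, conjCoords σ fun t => (b (π₂ t)).1) =
    ∑ i : Fin (m₁ + m₂) → RootIdx p, if IsType σ t₀ (fun q => (i q).1) then
      F (evalMap π₁ π₂ σ t₀ fun q => (i q).1) else 0 := by
  classical
  have hb (a : Fin m₁ → p.roots) : ∑ b : Fin m₂ → upperZeros p,
      F (fun s => (a (π₁ s)).1, conjCoords σ fun t => (b (π₂ t)).1) =
      ∑ i : Fin m₂ → RootIdx p, if ∀ q, 0 < (conjIf (σ (t₀ q)) (i q).1).im then
        F (fun s => (a (π₁ s)).1,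
          fun t => conjIf (σ t) (conjIf (σ (t₀ (π₂ t))) (i (π₂ t)).1)) else 0 := by
    rw [← sum_tuple_change (fun i : RootIdx p => i.1) (fun j : upperZeros p => j.1)
      (fun q => conjIf (σ (t₀ q))) (fun q z => 0 < (conjIf (σ (t₀ q)) z).im)
      (fun q f => sum_upperZeros_eq p (σ (t₀ q)) f)
      (fun v => F (fun s => (a (π₁ s)).1, fun t => conjIf (σ t) (conjIf (σ (t₀ (π₂ t))) (v (π₂ t)))))]
    refine Finset.sum_congr rfl fun b _ => ?_
    congr 2
    funext t
    rw [conjIf_conjIf, conjCoords_apply]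
  simp only [hb]
  have ha := sum_tuple_change (m := m₁) (fun i : RootIdx p => i.1) (fun j : p.roots => j.1)
      (fun _ x => (x : ℂ)) (fun _ z => z.im = 0) (fun _ f => sum_roots_eq p f)
      (fun v => ∑ i : Fin m₂ → RootIdx p, if ∀ q, 0 < (conjIf (σ (t₀ q)) (i q).1).im then
        F (fun s => (v (π₁ s)).re,
          fun t => conjIf (σ t) (conjIf (σ (t₀ (π₂ t))) (i (π₂ t)).1)) else 0)
  simp only [Complex.ofReal_re] at ha
  rw [ha, ← (Fin.appendEquiv m₁ m₂).sum_comp, Fintype.sum_prod_type]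
  refine Finset.sum_congr rfl fun a _ => ?_
  have hi (i : Fin m₂ → RootIdx p) :
      (if IsType σ t₀ (fun q => ((Fin.appendEquiv m₁ m₂ (a, i)) q).1) then
        F (evalMap π₁ π₂ σ t₀ fun q => ((Fin.appendEquiv m₁ m₂ (a, i)) q).1) else 0) =
      if ∀ q, (a q).1.im = 0 then (if ∀ q, 0 < (conjIf (σ (t₀ q)) (i q).1).im then
        F (fun s => (a (π₁ s)).1.re,
          fun t => conjIf (σ t) (conjIf (σ (t₀ (π₂ t))) (i (π₂ t)).1)) else 0) else 0 := by
    rw [← ite_and]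
    have h1 : evalMap π₁ π₂ σ t₀ (fun q => ((Fin.appendEquiv m₁ m₂ (a, i)) q).1) =
        (fun s => (a (π₁ s)).1.re,
          fun t => conjIf (σ t) (conjIf (σ (t₀ (π₂ t))) (i (π₂ t)).1)) := by
      refine Prod.ext (funext fun s => ?_) (funext fun t => ?_)
      · rw [evalMap_fst]
        simp [Fin.appendEquiv]
      · rw [evalMap_snd]
        simp [Fin.appendEquiv]
    rw [h1]
    refine if_congr ?_ rfl rfl
    simp [IsType, Fin.appendEquiv]
  simp only [hi]
  split_ifs <;> simp

end TestFunctions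

section Localized

variable {k l m₁ m₂ : ℕ} (π₁ : Fin k → Fin m₁) (π₂ : Fin l → Fin m₂) (σ : Fin l → Bool)
  (t₀ : Fin m₂ → Fin l)

/-- The smooth test function on tuples of zeros which replaces the restriction of `G` to the tuples
satisfying `IsType`, at scale `γ`. -/
def testFun (γ : ℝ) (G : (Fin k → ℝ) × (Fin l → ℂ) → ℂ) (v : Fin (m₁ + m₂) → ℂ) : ℂ :=
  G (evalMap π₁ π₂ σ t₀ v) * typeCutoff σ t₀ (γ⁻¹ • v)

lemma exists_testFun_bound (d : ℕ) (hd : 2 * (m₁ + m₂) ≤ d) : ∃ D : ℝ, 0 < D ∧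
    ∀ (G : (Fin k → ℝ) × (Fin l → ℂ) → ℂ) (c : (Fin k → ℝ) × (Fin l → ℂ)) (B γ : ℝ),
      ContDiff ℝ ∞ G → DerivLE d B G → 0 < γ → γ ≤ 1 →
      ContDiff ℝ ∞ (testFun π₁ π₂ σ t₀ γ fun q => G (q - c)) ∧
      (∀ v, ‖testFun π₁ π₂ σ t₀ γ (fun q => G (q - c)) v‖ ≤ D * B * (γ⁻¹) ^ d) ∧
      ∀ v, ‖iterLap (testFun π₁ π₂ σ t₀ γ fun q => G (q - c)) v‖ ≤ D * B * (γ⁻¹) ^ d := by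
  set m := m₁ + m₂ with hm
  obtain ⟨E, hE1, hE⟩ := (smoothBdd_typeCutoff (m₁ := m₁) σ t₀).exists_derivLE (2 * m)
  refine ⟨2 ^ m * (2 ^ (2 * m) * E), by positivity, fun G c B γ hG hB hγ hγ1 => ?_⟩
  have hB0 : 0 ≤ B := (norm_nonneg _).trans (hB 0 (Nat.zero_le _) 0)
  have hc : 1 ≤ γ⁻¹ := (one_le_inv₀ hγ).2 hγ1
  have hL : ‖γ⁻¹ • ContinuousLinearMap.id ℝ (Fin m → ℂ)‖ ≤ γ⁻¹ := by
    rw [norm_smul, Real.norm_of_nonneg (by positivity)]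
    exact mul_le_of_le_one_right (by positivity) ContinuousLinearMap.norm_id_le
  have hcut := DerivLE.comp_affine (smoothBdd_typeCutoff (m₁ := m₁) σ t₀).1 hE _ hc hL 0
  have hB' : DerivLE (2 * m) B G := fun i hi => hB i (hi.trans hd)
  have hGd := DerivLE.comp_affine hG hB' (evalMap π₁ π₂ σ t₀) le_rfl
    (norm_evalMap_le π₁ π₂ σ t₀) (-c)
  rw [one_pow, mul_one] at hGd
  have s1 : ContDiff ℝ ∞ fun v : Fin m → ℂ => G (evalMap π₁ π₂ σ t₀ v + -c) :=
    hG.comp ((ContinuousLinearMap.contDiff _).add contDiff_const)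
  have s2 : ContDiff ℝ ∞ fun v : Fin m → ℂ =>
      typeCutoff (m₁ := m₁) σ t₀ ((γ⁻¹ • ContinuousLinearMap.id ℝ (Fin m → ℂ)) v + 0) :=
    (smoothBdd_typeCutoff (m₁ := m₁) σ t₀).1.comp
      ((ContinuousLinearMap.contDiff _).add contDiff_const)
  have heq : (testFun π₁ π₂ σ t₀ γ fun q => G (q - c)) = fun v =>
      G (evalMap π₁ π₂ σ t₀ v + -c) *
        typeCutoff (m₁ := m₁) σ t₀ ((γ⁻¹ • ContinuousLinearMap.id ℝ (Fin m → ℂ)) v + 0) := by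
    funext v
    simp [testFun, sub_eq_add_neg]
  have hmul := DerivLE.mul s1 s2 hGd hcut
  rw [← heq] at hmul
  have hs : ContDiff ℝ ∞ (testFun π₁ π₂ σ t₀ γ fun q => G (q - c)) := by
    rw [heq]
    exact s1.mul s2
  have hpow : γ⁻¹ ^ (2 * m) ≤ γ⁻¹ ^ d := pow_le_pow_right₀ hc hd
  refine ⟨hs, fun v => ?_, fun v => ?_⟩
  · have h0 := hmul 0 (Nat.zero_le _) v
    rw [norm_iteratedFDeriv_zero] at h0
    calc _ ≤ 2 ^ (2 * m) * B * (E * γ⁻¹ ^ (2 * m)) := h0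
      _ ≤ 2 ^ (2 * m) * B * (E * γ⁻¹ ^ d) := by gcongr
      _ ≤ 2 ^ m * (2 ^ (2 * m) * B * (E * γ⁻¹ ^ d)) :=
          le_mul_of_one_le_left (by positivity) (one_le_pow₀ one_le_two)
      _ = _ := by ring
  · calc _ ≤ 2 ^ m * (2 ^ (2 * m) * B * (E * γ⁻¹ ^ (2 * m))) := hmul.norm_iterLap_le hs v
      _ ≤ 2 ^ m * (2 ^ (2 * m) * B * (E * γ⁻¹ ^ d)) := by gcongr
      _ = _ := by ring

variable (s₀ : Fin m₁ → Fin k)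

/-- The centres around which the entries of the tuple are localized. -/
def tupleCenter (x : Fin k → ℝ) (z : Fin l → ℂ) : Fin (m₁ + m₂) → ℂ :=
  Fin.append (fun q => (x (s₀ q) : ℂ)) fun q => z (t₀ q)

variable {π₁ π₂ s₀ t₀} {x : Fin k → ℝ} {z : Fin l → ℂ} {r₀ γ : ℝ}
  {G : (Fin k → ℝ) × (Fin l → ℂ) → ℂ}

lemma abs_re_sub_le (hs₀ : ∀ q, π₁ (s₀ q) = q)
    (hG : ∀ q, G q ≠ 0 → (∀ i, |q.1 i - x i| ≤ r₀) ∧ ∀ j, ‖q.2 j - z j‖ ≤ r₀)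
    {v : Fin (m₁ + m₂) → ℂ} (h : G (evalMap π₁ π₂ σ t₀ v) ≠ 0) (q : Fin m₁) :
    |(v (Fin.castAdd m₂ q)).re - x (s₀ q)| ≤ r₀ := by
  have := (hG _ h).1 (s₀ q)
  rwa [evalMap_fst, hs₀] at this

lemma norm_sub_le_of_ne (ht₀ : ∀ q, π₂ (t₀ q) = q)
    (hG : ∀ q, G q ≠ 0 → (∀ i, |q.1 i - x i| ≤ r₀) ∧ ∀ j, ‖q.2 j - z j‖ ≤ r₀)
    {v : Fin (m₁ + m₂) → ℂ} (h : G (evalMap π₁ π₂ σ t₀ v) ≠ 0) (q : Fin m₂) :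
    ‖v (Fin.natAdd m₁ q) - z (t₀ q)‖ ≤ r₀ := by
  have := (hG _ h).2 (t₀ q)
  rwa [evalMap_snd, ht₀, conjIf_conjIf] at this

lemma norm_sub_ofReal_le {ζ : ℂ} {a : ℝ} (h1 : |ζ.re - a| ≤ r₀) (h2 : |ζ.im| ≤ r₀) :
    ‖ζ - a‖ ≤ 2 * r₀ := by
  refine (Complex.norm_le_abs_re_add_abs_im _).trans ?_
  rw [Complex.sub_re, Complex.sub_im, Complex.ofReal_re, Complex.ofReal_im, sub_zero]
  linarith

lemma norm_sub_tupleCenter_le (hs₀ : ∀ q, π₁ (s₀ q) = q) (ht₀ : ∀ q, π₂ (t₀ q) = q) (hr : 0 ≤ r₀)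
    (hG : ∀ q, G q ≠ 0 → (∀ i, |q.1 i - x i| ≤ r₀) ∧ ∀ j, ‖q.2 j - z j‖ ≤ r₀)
    {v : Fin (m₁ + m₂) → ℂ} (h : G (evalMap π₁ π₂ σ t₀ v) ≠ 0)
    (him : ∀ q, |(v (Fin.castAdd m₂ q)).im| ≤ r₀) (q : Fin (m₁ + m₂)) :
    ‖v q - tupleCenter t₀ s₀ x z q‖ ≤ 2 * r₀ := by
  refine Fin.addCases (fun q => ?_) (fun q => ?_) q
  · rw [tupleCenter, Fin.append_left]
    exact norm_sub_ofReal_le (abs_re_sub_le σ hs₀ hG h q) (him q)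
  · rw [tupleCenter, Fin.append_right]
    linarith [norm_sub_le_of_ne σ ht₀ hG h q]

lemma abs_im_le_of_typeCutoff_ne (hγ : 0 < γ) {v : Fin (m₁ + m₂) → ℂ}
    (h : typeCutoff σ t₀ (γ⁻¹ • v) ≠ 0) (q : Fin m₁) : |(v (Fin.castAdd m₂ q)).im| ≤ γ := by
  by_contra hcon
  refine h (mul_eq_zero_of_left (Finset.prod_eq_zero (Finset.mem_univ q) ?_) _)
  rw [cutoff_of_two_le, Complex.ofReal_zero]
  rw [Pi.smul_apply, Complex.smul_im, smul_eq_mul, abs_mul, abs_mul, abs_of_pos two_pos,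
    abs_of_pos (inv_pos.2 hγ)]
  have : 1 ≤ γ⁻¹ * |(v (Fin.castAdd m₂ q)).im| := by
    rw [inv_mul_eq_div, le_div_iff₀ hγ, one_mul]
    exact (not_le.1 hcon).le
  linarith

lemma tsupport_testFun_subset (hs₀ : ∀ q, π₁ (s₀ q) = q) (ht₀ : ∀ q, π₂ (t₀ q) = q) (hγ : 0 < γ)
    (hγr : γ ≤ r₀)
    (hG : ∀ q, G q ≠ 0 → (∀ i, |q.1 i - x i| ≤ r₀) ∧ ∀ j, ‖q.2 j - z j‖ ≤ r₀) :
    tsupport (testFun π₁ π₂ σ t₀ γ G) ⊆ polyBall (tupleCenter t₀ s₀ x z) (3 * r₀) := by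
  have hr : 0 < r₀ := hγ.trans_le hγr
  have hsub : tsupport (testFun π₁ π₂ σ t₀ γ G) ⊆
      {v | ∀ q, v q ∈ Metric.closedBall (tupleCenter t₀ s₀ x z q) (2 * r₀)} := by
    refine closure_minimal (fun v hv q => ?_) ?_
    · rw [mem_closedBall_iff_norm]
      refine norm_sub_tupleCenter_le σ hs₀ ht₀ hr.le hG (left_ne_zero_of_mul hv) (fun q => ?_) q
      exact (abs_im_le_of_typeCutoff_ne σ hγ (right_ne_zero_of_mul hv) q).trans hγr
    · rw [Set.ofPred_forall]
      exact isClosed_iInter fun j => Metric.isClosed_closedBall.preimage (continuous_apply j)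
  intro v hv q
  exact Metric.closedBall_subset_ball (by linarith) (hsub hv q)

/-- In the absence of nonreal zeros in the strip, the smooth cutoff agrees with the indicator
function of `IsType` on tuples of zeros. -/
lemma ite_isType_eq_testFun (hs₀ : ∀ q, π₁ (s₀ q) = q) (ht₀ : ∀ q, π₂ (t₀ q) = q) (hγ : 0 < γ)
    (hγr : γ ≤ r₀)
    (hG : ∀ q, G q ≠ 0 → (∀ i, |q.1 i - x i| ≤ r₀) ∧ ∀ j, ‖q.2 j - z j‖ ≤ r₀) {p : ℝ[X]}
    (hp1 : ∀ i, ¬ HasStripZero (x i) r₀ γ p) (hp2 : ∀ j, ¬ HasStripZero (z j) r₀ γ p)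
    {v : Fin (m₁ + m₂) → ℂ} (hv : ∀ q, v q ∈ p.aroots ℂ) [Decidable (IsType σ t₀ v)] :
    (if IsType σ t₀ v then G (evalMap π₁ π₂ σ t₀ v) else 0) = testFun π₁ π₂ σ t₀ γ G v := by
  have hr : 0 < r₀ := hγ.trans_le hγr
  by_cases h : G (evalMap π₁ π₂ σ t₀ v) = 0
  · simp [testFun, h]
  have hreal (q : Fin m₁) (h0 : (v (Fin.castAdd m₂ q)).im ≠ 0) :
      γ < |(v (Fin.castAdd m₂ q)).im| := by
    by_contra hcon
    exact hp1 (s₀ q) ⟨_, hv _, h0, not_lt.1 hcon,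
      norm_sub_ofReal_le (abs_re_sub_le σ hs₀ hG h q) ((not_lt.1 hcon).trans hγr)⟩
  have hcplx (q : Fin m₂) (h0 : 0 < (conjIf (σ (t₀ q)) (v (Fin.natAdd m₁ q))).im) :
      γ < (conjIf (σ (t₀ q)) (v (Fin.natAdd m₁ q))).im := by
    by_contra hcon
    have habs := abs_conjIf_im (σ (t₀ q)) (v (Fin.natAdd m₁ q))
    rw [abs_of_pos h0] at habs
    refine hp2 (t₀ q) ⟨_, hv (Fin.natAdd m₁ q), ?_, habs ▸ not_lt.1 hcon, ?_⟩
    · rw [← abs_pos, ← habs]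
      exact h0
    · linarith [norm_sub_le_of_ne σ ht₀ hG h q]
  have him (q : Fin m₁) : 2 * ((γ⁻¹ • v) (Fin.castAdd m₂ q)).im =
      2 * (γ⁻¹ * (v (Fin.castAdd m₂ q)).im) := by
    rw [Pi.smul_apply, Complex.smul_im, smul_eq_mul]
  have himc (q : Fin m₂) : (conjIf (σ (t₀ q)) ((γ⁻¹ • v) (Fin.natAdd m₁ q))).im =
      γ⁻¹ * (conjIf (σ (t₀ q)) (v (Fin.natAdd m₁ q))).im := by
    rw [Pi.smul_apply, conjIf_smul, Complex.smul_im, smul_eq_mul]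
  by_cases hT : IsType σ t₀ v
  · rw [if_pos hT, testFun, typeCutoff, Finset.prod_eq_one, Finset.prod_eq_one, mul_one, mul_one]
    · intro q _
      rw [himc, Real.smoothTransition.one_of_one_le, Complex.ofReal_one]
      rw [inv_mul_eq_div, le_div_iff₀ hγ, one_mul]
      exact (hcplx q (hT.2 q)).le
    · intro q _
      rw [him, hT.1 q, cutoff_of_abs_le (by simp), Complex.ofReal_one]
  · rw [if_neg hT, testFun]
    symm
    refine mul_eq_zero_of_right _ ?_
    by_contra hne
    refine hT ⟨fun q => ?_, fun q => ?_⟩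
    · by_contra h0
      exact (hreal q h0).not_ge (abs_im_le_of_typeCutoff_ne σ hγ hne q)
    · by_contra h0
      refine hne (mul_eq_zero_of_right _ (Finset.prod_eq_zero (Finset.mem_univ q) ?_))
      rw [himc, Real.smoothTransition.zero_of_nonpos, Complex.ofReal_zero]
      exact mul_nonpos_of_nonneg_of_nonpos (inv_nonneg.2 hγ.le) (not_lt.1 h0)

/-- A sum over tuples of zeros localized in disks is controlled by the weight of the zeros. -/
lemma norm_sum_le_of_polyBall {m : ℕ} {w : Fin m → ℂ} {R Q M : ℝ} (hR : 1 ≤ R) (p : ℝ[X])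
    (hQ : ∀ q, zeroWeight (w q) p ≤ Q) (hM : 0 ≤ M) (F : (Fin m → RootIdx p) → ℂ)
    (hF : ∀ i, ‖F i‖ ≤ M) (h : ∀ i, F i ≠ 0 → ∀ q, (i q).1 ∈ Metric.ball (w q) R) :
    ‖∑ i, F i‖ ≤ M * (R ^ 2 * Q) ^ m := by
  have hpt (i : Fin m → RootIdx p) :
      ‖F i‖ ≤ M * ∏ q, (Metric.ball (w q) R).indicator (fun _ => (1 : ℝ)) (i q).1 := by
    by_cases hi : F i = 0
    · rw [hi, norm_zero]
      exact mul_nonneg hM (Finset.prod_nonneg fun q _ => indicator_one_nonneg _ _)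
    · rw [Finset.prod_eq_one fun q _ => Set.indicator_of_mem (h i hi q) _, mul_one]
      exact hF i
  refine (norm_sum_le _ _).trans ((Finset.sum_le_sum fun i _ => hpt i).trans ?_)
  rw [← Finset.mul_sum]
  gcongr
  have := Finset.prod_univ_sum (fun _ : Fin m => (Finset.univ : Finset (RootIdx p)))
    fun q i => (Metric.ball (w q) R).indicator (fun _ => (1 : ℝ)) i.1
  rw [Fintype.piFinset_univ] at this
  rw [← this]
  calc _ ≤ ∏ _q : Fin m, R ^ 2 * Q := by
        refine Finset.prod_le_prod
          (fun q _ => Finset.sum_nonneg fun i _ => indicator_one_nonneg _ _) fun q _ => ?_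
        refine (sum_indicator_le_zeroWeight p (w q) hR).trans ?_
        gcongr
        exact hQ q
    _ = _ := by simp

end Localized

/-! ### The replacement principle -/

section Replacement

/-- Integrals against `zeroTuples` as combinations of sums over all tuples of complex zeros. -/
lemma exists_integral_zeroTuples_eq (k l : ℕ) :
    ∃ (m₁ : Finset (Fin k × Fin k) → ℕ) (m₂ : Finset (Fin l × Fin l) → ℕ)
      (π₁ : ∀ e, Fin k → Fin (m₁ e)) (π₂ : ∀ e, Fin l → Fin (m₂ e))
      (s₀ : ∀ e, Fin (m₁ e) → Fin k) (t₀ : ∀ e, Fin (m₂ e) → Fin l)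
      (c : Finset (Fin k × Fin k) → Finset (Fin l × Fin l) → ℂ),
      (∀ e q, π₁ e (s₀ e q) = q) ∧ (∀ e q, π₂ e (t₀ e q) = q) ∧
      (∀ e₁ e₂, m₁ e₁ + m₂ e₂ ≤ k + l) ∧ (∀ e₁ e₂, 0 < k + l → m₁ e₁ + m₂ e₂ ≠ 0) ∧
      ∀ (p : ℝ[X]) (G : (Fin k → ℝ) × (Fin l → ℂ) → ℂ), Continuous G →
        open Classical in
        ∫ q, G q ∂(zeroTuples k l p) = ∑ e₁, ∑ e₂, ∑ σ : Fin l → Bool, c e₁ e₂ *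
          ∑ i : Fin (m₁ e₁ + m₂ e₂) → RootIdx p,
            if IsType σ (t₀ e₂) (fun q => (i q).1) then
              G (evalMap (π₁ e₁) (π₂ e₂) σ (t₀ e₂) fun q => (i q).1) else 0 := by
  classical
  obtain ⟨m₁, π₁, c₁, hs₁, h₁⟩ := exists_sum_embedding_eq k
  obtain ⟨m₂, π₂, c₂, hs₂, h₂⟩ := exists_sum_embedding_eq l
  refine ⟨m₁, m₂, π₁, π₂, fun e => Function.surjInv (hs₁ e), fun e => Function.surjInv (hs₂ e),
    fun e₁ e₂ => (c₁ e₁ : ℂ) * c₂ e₂, fun e => Function.surjInv_eq (hs₁ e),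
    fun e => Function.surjInv_eq (hs₂ e), fun e₁ e₂ => ?_, fun e₁ e₂ hkl hcon => ?_,
    fun p G hG => ?_⟩
  · exact add_le_add (card_le_of_surjective_fin (hs₁ e₁)) (card_le_of_surjective_fin (hs₂ e₂))
  · rcases Nat.eq_zero_or_pos k with hk | hk
    · have := (π₂ e₂ ⟨0, by omega⟩).pos
      omega
    · have := (π₁ e₁ ⟨0, hk⟩).pos
      omega
  · rw [integral_zeroTuples k l p hG]
    have hj (i : Fin k ↪ p.roots) : ∑ j : Fin l ↪ upperZeros p, ∑ σ : Fin l → Bool,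
        G (fun s => (i s).1, conjCoords σ fun t => (j t).1) =
        ∑ e₂, (c₂ e₂ : ℂ) * ∑ b : Fin (m₂ e₂) → upperZeros p, ∑ σ : Fin l → Bool,
          G (fun s => (i s).1, conjCoords σ fun t => (b (π₂ e₂ t)).1) :=
      h₂ (upperZeros p) fun j => ∑ σ : Fin l → Bool,
        G (fun s => (i s).1, conjCoords σ fun t => (j t).1)
    simp only [hj]
    have hi := h₁ p.roots fun i => ∑ e₂, (c₂ e₂ : ℂ) * ∑ b : Fin (m₂ e₂) → upperZeros p,
      ∑ σ : Fin l → Bool, G (fun s => (i s).1, conjCoords σ fun t => (b (π₂ e₂ t)).1)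
    refine hi.trans (Finset.sum_congr rfl fun e₁ _ => ?_)
    rw [Finset.sum_comm, Finset.mul_sum]
    refine Finset.sum_congr rfl fun e₂ _ => ?_
    rw [← Finset.mul_sum, ← mul_assoc, ← Finset.mul_sum]
    congr 1
    have hσ (a : Fin (m₁ e₁) → p.roots) : ∑ b : Fin (m₂ e₂) → upperZeros p, ∑ σ : Fin l → Bool,
        G (fun s => ((a ∘ π₁ e₁) s).1, conjCoords σ fun t => (b (π₂ e₂ t)).1) =
        ∑ σ : Fin l → Bool, ∑ b : Fin (m₂ e₂) → upperZeros p,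
          G (fun s => (a (π₁ e₁ s)).1, conjCoords σ fun t => (b (π₂ e₂ t)).1) := Finset.sum_comm
    simp only [hσ]
    rw [Finset.sum_comm]
    exact Finset.sum_congr rfl fun σ _ => sum_roots_upperZeros_eq (π₁ e₁) (π₂ e₂) σ _ p G

/-- If `Z` and `R` agree on polynomials without zeros in the strip, and differ little on
polynomials whose zeros do not cluster, then their expectations are close. -/
lemma norm_integral_sub_le_of_strip {Ω : Type*} [MeasurableSpace Ω] {P : Measure Ω}
    [IsProbabilityMeasure P] {n : ℕ} {f : Ω → ℝ[X]} (hf : IsRandomPoly n f) {m : ℕ} {w : Fin m → ℂ}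
    {Z R : ℝ[X] → ℂ} {r₀ γ Q b b₁ δ₁ δ₂ : ℝ} (hZm : Measurable fun η => Z (f η))
    (hRm : Measurable fun η => R (f η)) (hZb : ∀ p : ℝ[X], p.natDegree ≤ n → ‖Z p‖ ≤ b)
    (hRb : ∀ p : ℝ[X], p.natDegree ≤ n → ‖R p‖ ≤ b)
    (h0 : ∀ p, (∀ q, ¬ HasStripZero (w q) r₀ γ p) → Z p = R p) (hb₁ : 0 ≤ b₁)
    (h1 : ∀ p, (∀ q, zeroWeight (w q) p ≤ Q) → ‖Z p - R p‖ ≤ b₁)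
    (hδ₁ : ∀ q, P.real {η | HasStripZero (w q) r₀ γ (f η)} ≤ δ₁)
    (hδ₂ : P.real {η | ¬ ∀ q, zeroWeight (w q) (f η) ≤ Q} ≤ δ₂) :
    ‖(∫ η, Z (f η) ∂P) - ∫ η, R (f η) ∂P‖ ≤ b₁ * (m * δ₁) + 2 * b * δ₂ := by
  have hb : 0 ≤ b := (norm_nonneg _).trans (hZb 0 (by simp))
  have hZ : Integrable (fun η => Z (f η)) P := Integrable.of_bound hZm.aestronglyMeasurable b
    (Filter.Eventually.of_forall fun η => hZb _ (hf.natDegree_le η))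
  have hR : Integrable (fun η => R (f η)) P := Integrable.of_bound hRm.aestronglyMeasurable b
    (Filter.Eventually.of_forall fun η => hRb _ (hf.natDegree_le η))
  let T : Fin m → Set Ω := fun q => {η | HasStripZero (w q) r₀ γ (f η)}
  set S₁ : Set Ω := ⋃ q ∈ Finset.univ, T q with hS₁
  set S₂ : Set Ω := {η | ¬ ∀ q, zeroWeight (w q) (f η) ≤ Q} with hS₂
  have hP₁ : P.real S₁ ≤ m * δ₁ := by
    have e1 := measureReal_biUnion_finset_le (μ := P) Finset.univ T
    have e2 := Finset.sum_le_sum fun q (_ : q ∈ Finset.univ) => hδ₁ q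
    rw [Finset.sum_const, Finset.card_univ, Fintype.card_fin, nsmul_eq_mul] at e2
    exact e1.trans e2
  set B₁ := toMeasurable P S₁ with hB₁
  set B₂ := toMeasurable P S₂ with hB₂
  have hm₁ : MeasurableSet B₁ := measurableSet_toMeasurable _ _
  have hm₂ : MeasurableSet B₂ := measurableSet_toMeasurable _ _
  have hi₁ : Integrable (B₁.indicator fun _ => b₁) P := (integrable_const b₁).indicator hm₁
  have hi₂ : Integrable (B₂.indicator fun _ => 2 * b) P := (integrable_const (2 * b)).indicator hm₂
  rw [← integral_sub hZ hR]
  refine (norm_integral_le_of_norm_le (hi₁.add hi₂) (Filter.Eventually.of_forall fun η => ?_)).trans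
    ?_
  · show ‖Z (f η) - R (f η)‖ ≤ B₁.indicator (fun _ => b₁) η + B₂.indicator (fun _ => 2 * b) η
    have n₁ : 0 ≤ B₁.indicator (fun _ => b₁) η := Set.indicator_nonneg (fun _ _ => hb₁) _
    by_cases e2 : η ∈ S₂
    · rw [Set.indicator_of_mem (subset_toMeasurable P S₂ e2)]
      have := (norm_sub_le (Z (f η)) (R (f η))).trans
        (add_le_add (hZb _ (hf.natDegree_le η)) (hRb _ (hf.natDegree_le η)))
      linarith
    · have n₂ : 0 ≤ B₂.indicator (fun _ => 2 * b) η :=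
        Set.indicator_nonneg (fun _ _ => by positivity) _
      by_cases e1 : η ∈ S₁
      · rw [Set.indicator_of_mem (subset_toMeasurable P S₁ e1)]
        have := h1 (f η) (not_not.1 e2)
        linarith
      · rw [h0 (f η), sub_self, norm_zero]
        · positivity
        · intro q hq
          exact e1 (Set.mem_biUnion (Finset.mem_coe.2 (Finset.mem_univ q)) hq)
  · have e : ∫ η, (B₁.indicator (fun _ => b₁) + B₂.indicator (fun _ => 2 * b) : Ω → ℝ) η ∂P =
        P.real S₁ * b₁ + P.real S₂ * (2 * b) := by
      rw [integral_add' hi₁ hi₂, integral_indicator_const _ hm₁, integral_indicator_const _ hm₂]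
      simp only [Measure.real, hB₁, hB₂, measure_toMeasurable, smul_eq_mul]
    rw [e, mul_comm, mul_comm _ (2 * b)]
    gcongr

lemma exists_norm_integral_rootSum_sub_le_of_ne_zero {C r₀ c₀ A : ℝ} {a₀ K : ℕ}
    (hK : ReplacementConstants C r₀ c₀ A a₀ K) (m : ℕ) (hm0 : m ≠ 0) (hm : m ≤ K) :
    ∃ D : ℝ, 0 < D ∧ ∀ {Ω Ω' : Type*} [MeasurableSpace Ω] [MeasurableSpace Ω']
      {P : Measure Ω} {P' : Measure Ω'} [IsProbabilityMeasure P] [IsProbabilityMeasure P']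
      {f : Ω → ℝ[X]} {f' : Ω' → ℝ[X]} {n : ℕ} {W U : Set ℂ},
      Replaceable C r₀ c₀ A a₀ n P P' f f' W U →
      ∀ (w : Fin m → ℂ) (B : ℝ) (h : (Fin m → ℂ) → ℂ), (∀ j, w j ∈ W) →
      ContDiff ℝ ∞ h → tsupport h ⊆ polyBall w (3 * r₀) → (∀ v, ‖h v‖ ≤ B) →
      (∀ v, ‖iterLap h v‖ ≤ B) →
      ‖(∫ η, rootSum h (f η) ∂P) - ∫ η, rootSum h (f' η) ∂P'‖ ≤
        D * B * (((n : ℝ) ^ (1 / A)) ^ (34 * K ^ 2))⁻¹ := by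
  obtain ⟨m, rfl⟩ := Nat.exists_eq_succ_of_ne_zero hm0
  exact exists_norm_integral_rootSum_sub_le_pow hK m (by omega)

lemma integral_sum_sum_sum {Ω α β τ : Type*} [MeasurableSpace Ω] {P : Measure Ω} [Fintype α]
    [Fintype β] [Fintype τ] {T : α → β → τ → Ω → ℂ} (h : ∀ a b t, Integrable (T a b t) P) :
    ∫ η, ∑ a, ∑ b, ∑ t, T a b t η ∂P = ∑ a, ∑ b, ∑ t, ∫ η, T a b t η ∂P := by
  rw [integral_finsetSum _ fun a _ => integrable_finsetSum _ fun b _ =>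
    integrable_finsetSum _ fun t _ => h a b t]
  refine Finset.sum_congr rfl fun a _ => ?_
  rw [integral_finsetSum _ fun b _ => integrable_finsetSum _ fun t _ => h a b t]
  exact Finset.sum_congr rfl fun b _ => integral_finsetSum _ fun t _ => h a b t

lemma RandomZeros.IsRandomPoly.integrable_rootSum {Ω : Type*} [MeasurableSpace Ω] {P : Measure Ω}
    [IsProbabilityMeasure P] {n : ℕ} {f : Ω → ℝ[X]} (hf : IsRandomPoly n f) {R : ℝ} (hR : 1 ≤ R)
    {m : ℕ} (hm : m ≠ 0) {g : (Fin m → ℂ) → ℂ} (hg : ContDiff ℝ ∞ g) {w : Fin m → ℂ}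
    (hs : tsupport g ⊆ polyBall w R) {B : ℝ} (hB : ∀ v, ‖g v‖ ≤ B) :
    Integrable (fun η => rootSum g (f η)) P :=
  Integrable.of_bound (hf.measurable_rootSum hR hm hg hs).aestronglyMeasurable ((n : ℝ) ^ m * B)
    (Filter.Eventually.of_forall fun η => norm_rootSum_le hB (hf.natDegree_le η))

/-- The error of passing to smooth statistics, for `K` zeros: `B` bounds the test function, `r` is the
squared radius of the disks, `C₁` and `C₂` are the constants of non-clustering and `Ds` is that of
the strip. -/
lemma ReplacementConstants.side_error_le {C r₀ c₀ A : ℝ} {a₀ K : ℕ}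
    (hK : ReplacementConstants C r₀ c₀ A a₀ K) {n : ℕ} (hn : 1 ≤ n) {Kc B r C₁ Ds C₂ : ℝ}
    (hKc : 0 ≤ Kc) (hB : 0 ≤ B) (hr : 0 ≤ r) (hC₁ : 0 ≤ C₁) (hDs : 0 ≤ Ds) (hC₂ : 0 ≤ C₂) :
    2 * Kc * B * (r * (C₁ * ((n : ℝ) ^ (1 / A)) ^ 2)) ^ K *
        (K * (Ds * (((n : ℝ) ^ (1 / A)) ^ (3 * K))⁻¹)) +
      2 * (Kc * ((n : ℝ) ^ K * B)) * (K * (C₂ * (n : ℝ) ^ (1 / A) * (n : ℝ) ^ (-A))) ≤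
    (2 * Kc * B * (r * C₁) ^ K * (K * Ds) + 2 * (Kc * B) * (K * C₂)) *
      (((n : ℝ) ^ (1 / A)) ^ K)⁻¹ := by
  have hN1 := hK.one_le_N hn
  have hK1 := hK.one_le_K
  have hKK : K ≤ K ^ 2 := by nlinarith
  have e2 : (n : ℝ) ^ K * (n : ℝ) ^ (-A) ≤ (((n : ℝ) ^ (1 / A)) ^ (600 * K ^ 2 - K))⁻¹ :=
    hK.rpow_neg_A_le hn (by omega)
  generalize (n : ℝ) ^ (1 / A) = N at *
  have hN0 : 0 ≤ N := by linarith
  have e1 : N ^ (2 * K) * (N ^ (3 * K))⁻¹ ≤ (N ^ K)⁻¹ := pow_mul_inv_pow_le hN1 (by omega)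
  have e3 : N ^ 1 * (N ^ (600 * K ^ 2 - K))⁻¹ ≤ (N ^ K)⁻¹ := pow_mul_inv_pow_le hN1 (by omega)
  have e4 := (mul_le_mul_of_nonneg_left e2 (pow_nonneg hN0 1)).trans e3
  have f1 : (r * (C₁ * N ^ 2)) ^ K = (r * C₁) ^ K * N ^ (2 * K) := by
    rw [← mul_assoc, mul_pow, ← pow_mul]
  have p1 : 0 ≤ 2 * Kc * B * (r * C₁) ^ K * (K * Ds) := by positivity
  have p2 : 0 ≤ 2 * (Kc * B) * (K * C₂) := by positivity
  rw [f1]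
  have := add_le_add (mul_le_mul_of_nonneg_left e1 p1) (mul_le_mul_of_nonneg_left e4 p2)
  rw [pow_one] at this
  rw [add_mul]
  refine le_trans (le_of_eq ?_) this
  ring

set_option maxHeartbeats 1000000 in
/-- The replacement principle, for replaceable pairs of random polynomials: the sum of `G` over the
tuples of zeros is replaced by smooth statistics over tuples of complex zeros, and these are
compared. -/
theorem exists_norm_integral_mixedCorr_sub_le {C r₀ c₀ A : ℝ} {a₀ k l : ℕ}
    (hK : ReplacementConstants C r₀ c₀ A a₀ (k + l)) :
    ∃ D : ℝ, ∀ {Ω Ω' : Type*} [MeasurableSpace Ω] [MeasurableSpace Ω']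
      {P : Measure Ω} {P' : Measure Ω'} [IsProbabilityMeasure P] [IsProbabilityMeasure P']
      {f : Ω → ℝ[X]} {f' : Ω' → ℝ[X]} {n : ℕ} {U : Set ℂ} {x : Fin k → ℝ} {z : Fin l → ℂ},
      Replaceable C r₀ c₀ A a₀ n P P' f f' (Set.range (Fin.append (fun i => (x i : ℂ)) z)) U →
      ∀ (G : (Fin k → ℝ) × (Fin l → ℂ) → ℂ) (M : ℝ), 0 ≤ M → ContDiff ℝ ∞ G →
      (∀ q, G q ≠ 0 → (∀ i, |q.1 i| ≤ r₀) ∧ ∀ j, ‖q.2 j‖ ≤ r₀) →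
      (∀ a ≤ 2 * (k + l), ∀ w, gradNorm (mixedBasis k l) a G w ≤ M) →
      ‖(∫ q, G (q - (x, z)) ∂(mixedCorr P f k l)) - ∫ q, G (q - (x, z)) ∂(mixedCorr P' f' k l)‖ ≤
        D * M * (((n : ℝ) ^ (1 / A)) ^ (k + l))⁻¹ := by
  classical
  obtain ⟨m₁, m₂, π₁, π₂, s₀, t₀, c, hs₀, ht₀, hmK, hm0, hexp⟩ := exists_integral_zeroTuples_eq k l
  have hr := hK.one_le_r
  have hC := hK.one_le_C
  have hA1 := hK.one_le_A
  have hK1 := hK.one_le_K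
  set K : ℕ := k + l with hKdef
  have hKK : K ≤ K ^ 2 := by nlinarith
  obtain ⟨DG, hDG, hGd⟩ := exists_derivLE_of_gradNorm k l (2 * K)
  choose Dt hDt htest using fun e : Finset (Fin k × Fin k) × Finset (Fin l × Fin l) ×
    (Fin l → Bool) => exists_testFun_bound (π₁ e.1) (π₂ e.2.1) e.2.2 (t₀ e.2.1) (2 * K)
      (Nat.mul_le_mul_left 2 (hmK e.1 e.2.1))
  choose Dc hDc hcmp using fun e : Finset (Fin k × Fin k) × Finset (Fin l × Fin l) =>
    exists_norm_integral_rootSum_sub_le_of_ne_zero hK (m₁ e.1 + m₂ e.2) (hm0 _ _ (by omega))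
      (hmK _ _)
  obtain ⟨Ds, hDs, hstrip⟩ := exists_measureReal_hasStripZero_le hK
  set C₁ : ℝ := 8 * C * (A + 1) + 1 with hC₁
  have hC₁1 : 1 ≤ C₁ := by
    have : 0 ≤ 8 * C * (A + 1) := by positivity
    linarith
  set C₂ : ℝ := 2 * (A + 1) * C with hC₂
  have hC₂0 : 0 < C₂ := by positivity
  set Kc : ℝ := ∑ e₁, ∑ e₂, ∑ _σ : Fin l → Bool, ‖c e₁ e₂‖ with hKc
  have hKc0 : 0 ≤ Kc := Finset.sum_nonneg fun _ _ => Finset.sum_nonneg fun _ _ =>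
    Finset.sum_nonneg fun _ _ => norm_nonneg _
  set Et : ℝ := ∑ e₁, ∑ e₂, ∑ σ : Fin l → Bool,
    ‖c e₁ e₂‖ * (Dc (e₁, e₂) * (Dt (e₁, e₂, σ) * DG)) with hEt
  set Es : ℝ := 2 * Kc * DG * ((3 * r₀) ^ 2 * C₁) ^ K * (K * Ds) + 2 * (Kc * DG) * (K * C₂) with hEs
  refine ⟨Et * (8 * C) ^ (2 * K) + 2 * Es, ?_⟩
  intro Ω Ω' _ _ P P' _ _ f f' n U x z hR G M hM hG hGs hGg
  have hn := hR.one_le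
  set N : ℝ := (n : ℝ) ^ (1 / A) with hN
  have hN1 : 1 ≤ N := hK.one_le_N hn
  have hN0 : 0 < N := by linarith
  set γ : ℝ := stripWidth C N K with hγdef
  have hγ0 : 0 < γ := by rw [hγdef, stripWidth]; positivity
  have hγ1 : γ ≤ 1 := by
    rw [hγdef, stripWidth]
    refine mul_le_one₀ (inv_le_one_of_one_le₀ (by linarith)) (by positivity)
      (inv_le_one_of_one_le₀ (one_le_pow₀ hN1))
  have hγr : γ ≤ r₀ := hγ1.trans hr
  have hder : DerivLE (2 * K) (DG * M) G := hGd G M hGg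
  have hGb (q) : ‖G q‖ ≤ DG * M := by
    have := hder 0 (Nat.zero_le _) q
    rwa [norm_iteratedFDeriv_zero] at this
  set B : ℝ := DG * M with hB
  have hB0 : 0 ≤ B := by positivity
  set w : Fin (k + l) → ℂ := Fin.append (fun i => (x i : ℂ)) z with hw
  set G' : (Fin k → ℝ) × (Fin l → ℂ) → ℂ := fun q => G (q - (x, z)) with hG'
  have hG'c : Continuous G' := hG.continuous.comp (by fun_prop)
  have hG's : ∀ q, G' q ≠ 0 → (∀ i, |q.1 i - x i| ≤ r₀) ∧ ∀ j, ‖q.2 j - z j‖ ≤ r₀ :=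
    fun q hq => hGs _ hq
  have hG'b (q) : ‖G' q‖ ≤ B := hGb _
  set h : ∀ e₁ e₂, (Fin l → Bool) → (Fin (m₁ e₁ + m₂ e₂) → ℂ) → ℂ := fun e₁ e₂ σ =>
    testFun (π₁ e₁) (π₂ e₂) σ (t₀ e₂) γ G' with hh
  have hhs (e₁ e₂ σ) : ContDiff ℝ ∞ (h e₁ e₂ σ) :=
    (htest (e₁, e₂, σ) G (x, z) B γ hG hder hγ0 hγ1).1
  have hhsupp (e₁ e₂ σ) : tsupport (h e₁ e₂ σ) ⊆
      polyBall (tupleCenter (t₀ e₂) (s₀ e₁) x z) (3 * r₀) :=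
    tsupport_testFun_subset σ (hs₀ e₁) (ht₀ e₂) hγ0 hγr hG's
  have hhB (e₁ e₂ σ v) : ‖h e₁ e₂ σ v‖ ≤ B := by
    simp only [hh, testFun, norm_mul]
    calc _ ≤ B * 1 := mul_le_mul (hG'b _) (norm_typeCutoff_le _ _ _) (norm_nonneg _) hB0
      _ = B := mul_one B
  have hcenter (e₁ e₂) (q : Fin (m₁ e₁ + m₂ e₂)) :
      ∃ i, tupleCenter (t₀ e₂) (s₀ e₁) x z q = w i := by
    refine Fin.addCases (fun q => ?_) (fun q => ?_) q
    · exact ⟨Fin.castAdd l (s₀ e₁ q), by rw [tupleCenter, Fin.append_left, hw, Fin.append_left]⟩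
    · exact ⟨Fin.natAdd k (t₀ e₂ q), by rw [tupleCenter, Fin.append_right, hw, Fin.append_right]⟩
  set F : ∀ (p : ℝ[X]) (e₁ e₂) (_ : Fin l → Bool), (Fin (m₁ e₁ + m₂ e₂) → RootIdx p) → ℂ :=
    fun p e₁ e₂ σ i => if IsType σ (t₀ e₂) (fun q => (i q).1) then
      G' (evalMap (π₁ e₁) (π₂ e₂) σ (t₀ e₂) fun q => (i q).1) else 0 with hF
  set Z : ℝ[X] → ℂ := fun p => ∫ q, G' q ∂(zeroTuples k l p) with hZ
  set R : ℝ[X] → ℂ := fun p => ∑ e₁, ∑ e₂, ∑ σ : Fin l → Bool, c e₁ e₂ * rootSum (h e₁ e₂ σ) p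
    with hRdef
  have hZF (p) : Z p = ∑ e₁, ∑ e₂, ∑ σ : Fin l → Bool, c e₁ e₂ * ∑ i, F p e₁ e₂ σ i :=
    hexp p G' hG'c
  have hFb (p e₁ e₂ σ i) : ‖F p e₁ e₂ σ i‖ ≤ B := by
    simp only [hF]
    split_ifs
    · exact hG'b _
    · rw [norm_zero]; exact hB0
  -- sums with the coefficients of the expansion
  have hcomb {T : ∀ (e₁ : Finset (Fin k × Fin k)) (e₂ : Finset (Fin l × Fin l)),
      (Fin l → Bool) → ℂ} {b : ℝ} (hT : ∀ e₁ e₂ σ, ‖T e₁ e₂ σ‖ ≤ b) :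
      ‖∑ e₁, ∑ e₂, ∑ σ : Fin l → Bool, c e₁ e₂ * T e₁ e₂ σ‖ ≤ Kc * b := by
    rw [hKc, Finset.sum_mul]
    refine norm_sum_le_of_le _ fun e₁ _ => ?_
    rw [Finset.sum_mul]
    refine norm_sum_le_of_le _ fun e₂ _ => ?_
    rw [Finset.sum_mul]
    refine norm_sum_le_of_le _ fun σ _ => ?_
    rw [norm_mul]
    gcongr
    exact hT e₁ e₂ σ
  have hpown (e₁ e₂) : (n : ℝ) ^ (m₁ e₁ + m₂ e₂) * B ≤ (n : ℝ) ^ K * B := by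
    gcongr
    · exact_mod_cast hn
    · exact hmK e₁ e₂
  have hZb (p : ℝ[X]) (hp : p.natDegree ≤ n) : ‖Z p‖ ≤ Kc * ((n : ℝ) ^ K * B) := by
    rw [hZF]
    refine hcomb fun e₁ e₂ σ => le_trans ?_ (hpown e₁ e₂)
    refine (norm_sum_le _ _).trans ((Finset.sum_le_sum fun i _ => hFb p e₁ e₂ σ i).trans ?_)
    rw [Finset.sum_const, Finset.card_univ, Fintype.card_pi, Finset.prod_const, Finset.card_univ,
      Fintype.card_fin, nsmul_eq_mul]
    push_cast
    gcongr
    exact card_rootIdx_le hp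
  have hRb (p : ℝ[X]) (hp : p.natDegree ≤ n) : ‖R p‖ ≤ Kc * ((n : ℝ) ^ K * B) :=
    hcomb fun e₁ e₂ σ => (norm_rootSum_le (hhB e₁ e₂ σ) hp).trans (hpown e₁ e₂)
  have h0 (p) (hp : ∀ q, ¬ HasStripZero (w q) r₀ γ p) : Z p = R p := by
    rw [hZF]
    refine Finset.sum_congr rfl fun e₁ _ => Finset.sum_congr rfl fun e₂ _ =>
      Finset.sum_congr rfl fun σ _ => ?_
    congr 1
    refine Finset.sum_congr rfl fun i _ => ?_
    refine ite_isType_eq_testFun σ (hs₀ e₁) (ht₀ e₂) hγ0 hγr hG's (fun i => ?_) (fun j => ?_)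
      fun q => mem_aroots_of_rootIdx (i q)
    · simpa [hw] using hp (Fin.castAdd l i)
    · simpa [hw] using hp (Fin.natAdd k j)
  have h1 (p) (hp : ∀ q, zeroWeight (w q) p ≤ C₁ * N ^ 2) :
      ‖Z p - R p‖ ≤ 2 * Kc * B * ((3 * r₀) ^ 2 * (C₁ * N ^ 2)) ^ K := by
    have hbase : 1 ≤ (3 * r₀) ^ 2 * (C₁ * N ^ 2) :=
      one_le_mul_of_one_le_of_one_le (one_le_pow₀ (by linarith))
        (one_le_mul_of_one_le_of_one_le hC₁1 (one_le_pow₀ hN1))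
    have hpw (e₁ e₂) : B * ((3 * r₀) ^ 2 * (C₁ * N ^ 2)) ^ (m₁ e₁ + m₂ e₂) ≤
        B * ((3 * r₀) ^ 2 * (C₁ * N ^ 2)) ^ K := by
      gcongr
      exact hmK e₁ e₂
    have hQ (e₁ e₂) (q : Fin (m₁ e₁ + m₂ e₂)) :
        zeroWeight (tupleCenter (t₀ e₂) (s₀ e₁) x z q) p ≤ C₁ * N ^ 2 := by
      obtain ⟨i, hi⟩ := hcenter e₁ e₂ q
      rw [hi]
      exact hp i
    have b1 : ‖Z p‖ ≤ Kc * (B * ((3 * r₀) ^ 2 * (C₁ * N ^ 2)) ^ K) := by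
      rw [hZF]
      refine hcomb fun e₁ e₂ σ => le_trans ?_ (hpw e₁ e₂)
      refine norm_sum_le_of_polyBall (by linarith) p (hQ e₁ e₂) hB0 _ (hFb p e₁ e₂ σ)
        fun i hi q => ?_
      have hT : IsType σ (t₀ e₂) (fun q => (i q).1) := by
        by_contra hcon
        exact hi (if_neg hcon)
      have hne : G' (evalMap (π₁ e₁) (π₂ e₂) σ (t₀ e₂) fun q => (i q).1) ≠ 0 := by
        intro hcon
        refine hi ?_
        simp only [hF, if_pos hT, hcon]
      rw [mem_ball_iff_norm]
      have := norm_sub_tupleCenter_le σ (hs₀ e₁) (ht₀ e₂) (by linarith) hG's hne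
        (fun q => by rw [hT.1 q, abs_zero]; linarith) q
      linarith
    have b2 : ‖R p‖ ≤ Kc * (B * ((3 * r₀) ^ 2 * (C₁ * N ^ 2)) ^ K) := by
      refine hcomb fun e₁ e₂ σ => le_trans ?_ (hpw e₁ e₂)
      refine norm_sum_le_of_polyBall (by linarith) p (hQ e₁ e₂) hB0 _ (fun i => hhB e₁ e₂ σ _)
        fun i hi q => ?_
      exact hhsupp e₁ e₂ σ (subset_tsupport _ hi) q
    refine (norm_sub_le _ _).trans ((add_le_add b1 b2).trans (le_of_eq ?_))
    ring
  have hr3 : 1 ≤ 3 * r₀ := by linarith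
  have hRm : (Measurable fun η => R (f η)) ∧ Measurable fun η => R (f' η) := by
    constructor
    all_goals
      simp only [hRdef]
      refine Finset.measurable_sum _ fun e₁ _ => Finset.measurable_sum _ fun e₂ _ =>
        Finset.measurable_sum _ fun σ _ => Measurable.const_mul ?_ _
    · exact hR.random.measurable_rootSum hr3 (hm0 e₁ e₂ (by omega)) (hhs e₁ e₂ σ) (hhsupp e₁ e₂ σ)
    · exact hR.random'.measurable_rootSum hr3 (hm0 e₁ e₂ (by omega)) (hhs e₁ e₂ σ)
        (hhsupp e₁ e₂ σ)
  -- `Z` and `R` differ only if there is a zero in the strip, which has probability `N ^ (-3 K)`, and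
  -- then typically by at most `N ^ (2 K)`.
  have hb₁ : 0 ≤ 2 * Kc * B * ((3 * r₀) ^ 2 * (C₁ * N ^ 2)) ^ K := by positivity
  have side₁ := norm_integral_sub_le_of_strip hR.random
    (measurable_integral_zeroTuples hR.random hG'c).measurable hRm.1 hZb hRb h0 hb₁ h1
    (fun q => (hstrip hR (w q) ⟨q, rfl⟩).1)
    (measureReal_not_forall_zeroWeight_le hR.random hn (by linarith) hA1
      fun q => hR.nonClustering _ ⟨q, rfl⟩)
  have side₂ := norm_integral_sub_le_of_strip hR.random'
    (measurable_integral_zeroTuples hR.random' hG'c).measurable hRm.2 hZb hRb h0 hb₁ h1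
    (fun q => (hstrip hR (w q) ⟨q, rfl⟩).2)
    (measureReal_not_forall_zeroWeight_le hR.random' hn (by linarith) hA1
      fun q => hR.nonClustering' _ ⟨q, rfl⟩)
  have hside : 2 * Kc * B * ((3 * r₀) ^ 2 * (C₁ * N ^ 2)) ^ K * (K * (Ds * (N ^ (3 * K))⁻¹)) +
      2 * (Kc * ((n : ℝ) ^ K * B)) * (K * (C₂ * N * (n : ℝ) ^ (-A))) ≤ Es * M * (N ^ K)⁻¹ := by
    refine (hK.side_error_le hn hKc0 hB0 (by positivity) (by linarith) hDs.le hC₂0.le).trans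
      (le_of_eq ?_)
    rw [hEs, hB]
    ring
  -- the comparison of the smooth statistics
  have hmid : ‖(∫ η, R (f η) ∂P) - ∫ η, R (f' η) ∂P'‖ ≤
      Et * (8 * C) ^ (2 * K) * M * (N ^ K)⁻¹ := by
    have i₁ (e₁ e₂ σ) : Integrable (fun η => c e₁ e₂ * rootSum (h e₁ e₂ σ) (f η)) P :=
      (hR.random.integrable_rootSum hr3 (hm0 e₁ e₂ (by omega)) (hhs e₁ e₂ σ) (hhsupp e₁ e₂ σ)
        (hhB e₁ e₂ σ)).const_mul _
    have i₂ (e₁ e₂ σ) : Integrable (fun η => c e₁ e₂ * rootSum (h e₁ e₂ σ) (f' η)) P' :=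
      (hR.random'.integrable_rootSum hr3 (hm0 e₁ e₂ (by omega)) (hhs e₁ e₂ σ) (hhsupp e₁ e₂ σ)
        (hhB e₁ e₂ σ)).const_mul _
    have hγinv : (γ⁻¹) ^ (2 * K) = (8 * C) ^ (2 * K) * N ^ (10 * K ^ 2) := by
      rw [hγdef, stripWidth, mul_inv, inv_inv, inv_inv, mul_pow, ← pow_mul]
      congr 2
      ring
    have hpow : N ^ (10 * K ^ 2) * (N ^ (34 * K ^ 2))⁻¹ ≤ (N ^ K)⁻¹ :=
      pow_mul_inv_pow_le hN1 (by omega)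
    have hterm (e₁ e₂ σ) : ‖(∫ η, rootSum (h e₁ e₂ σ) (f η) ∂P) -
        ∫ η, rootSum (h e₁ e₂ σ) (f' η) ∂P'‖ ≤
        Dc (e₁, e₂) * (Dt (e₁, e₂, σ) * DG) * ((8 * C) ^ (2 * K) * M * (N ^ K)⁻¹) := by
      obtain ⟨g1, g2, g3⟩ := htest (e₁, e₂, σ) G (x, z) B γ hG hder hγ0 hγ1
      have hd1 := hDc (e₁, e₂)
      have hd2 := hDt (e₁, e₂, σ)
      refine (hcmp (e₁, e₂) hR (tupleCenter (t₀ e₂) (s₀ e₁) x z) _ (h e₁ e₂ σ)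
        (fun q => ?_) g1 (hhsupp e₁ e₂ σ) g2 g3).trans ?_
      · obtain ⟨i, hi⟩ := hcenter e₁ e₂ q
        exact ⟨i, hi.symm⟩
      · calc _ = Dc (e₁, e₂) * (Dt (e₁, e₂, σ) * DG) * ((8 * C) ^ (2 * K) * M *
              (N ^ (10 * K ^ 2) * (N ^ (34 * K ^ 2))⁻¹)) := by
              rw [hγinv, hB]; ring
          _ ≤ _ := by gcongr
    simp only [hRdef]
    rw [integral_sum_sum_sum i₁, integral_sum_sum_sum i₂]
    simp only [integral_const_mul, ← Finset.sum_sub_distrib, ← mul_sub]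
    rw [mul_assoc, mul_assoc, ← mul_assoc ((8 * C) ^ (2 * K)), hEt, Finset.sum_mul]
    refine norm_sum_le_of_le _ fun e₁ _ => ?_
    rw [Finset.sum_mul]
    refine norm_sum_le_of_le _ fun e₂ _ => ?_
    rw [Finset.sum_mul]
    refine norm_sum_le_of_le _ fun σ _ => ?_
    rw [norm_mul, mul_assoc]
    gcongr
    exact hterm e₁ e₂ σ
  rw [integral_mixedCorr hR.random hG'c hG'b, integral_mixedCorr hR.random' hG'c hG'b]
  have hsplit : (∫ η, Z (f η) ∂P) - ∫ η, Z (f' η) ∂P' =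
      ((∫ η, Z (f η) ∂P) - ∫ η, R (f η) ∂P) + ((∫ η, R (f η) ∂P) - ∫ η, R (f' η) ∂P') -
        ((∫ η, Z (f' η) ∂P') - ∫ η, R (f' η) ∂P') := by ring
  rw [hsplit]
  refine (norm_sub_le _ _).trans ((add_le_add_left (norm_add_le _ _) _).trans ?_)
  have := side₁.trans hside
  have := side₂.trans hside
  linarith

end Replacement

lemma inv_pow_rpow_one_div_eq {c₀ A : ℝ} {a₀ k l : ℕ} (hc₀ : 0 < c₀) (hkl : 0 < k + l)
    (hA : A = 200 * ((k : ℝ) + l) ^ 2 * ((a₀ : ℝ) + 2) / c₀) (n : ℕ) :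
    (((n : ℝ) ^ (1 / A)) ^ (k + l))⁻¹ =
      (n : ℝ) ^ (-(c₀ / (200 * ((a₀ : ℝ) + 2) * ((k : ℝ) + l)))) := by
  have hK : (k : ℝ) + l ≠ 0 := by exact_mod_cast hkl.ne'
  have ha : (a₀ : ℝ) + 2 ≠ 0 := by positivity
  have hc := hc₀.ne'
  rw [Real.rpow_neg (Nat.cast_nonneg n), ← Real.rpow_natCast, ← Real.rpow_mul (Nat.cast_nonneg n)]
  congr 2
  rw [hA]
  push_cast
  field_simp

end

theorem theorem3p1 (C r₀ c₀ : ℝ) (hC : 1 ≤ C) (hr₀ : 1 ≤ r₀) (hc₀ : 0 < c₀) (hc₀' : c₀ ≤ 1)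
    (a₀ k l : ℕ) (ha₀ : 1 ≤ a₀) (hkl : 0 < k + l)
    (A : ℝ) (hA : A = 200 * ((k : ℝ) + l) ^ 2 * ((a₀ : ℝ) + 2) / c₀) :
    ∃ C' : ℝ, ∀ (n : ℕ), 1 ≤ n →
      ∀ {Ω Ω' : Type*} [MeasurableSpace Ω] [MeasurableSpace Ω']
        (P : Measure Ω) (P' : Measure Ω') [IsProbabilityMeasure P] [IsProbabilityMeasure P']
        (f : Ω → ℝ[X]) (f' : Ω' → ℝ[X]) (x : Fin k → ℝ) (z : Fin l → ℂ),
        IsRandomPoly n f → IsRandomPoly n f' →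
        NonDegenerate P f n C A → NonDegenerate P' f' n C A →
        (∀ i, NonClusteringAt P f n C A (x i)) → (∀ j, NonClusteringAt P f n C A (z j)) →
        (∀ i, NonClusteringAt P' f' n C A (x i)) → (∀ j, NonClusteringAt P' f' n C A (z j)) →
        LogComparable P P' f f' n C c₀ a₀ (region x z (100 * r₀)) →
        WeakLevelRepulsion P' f' C (region x z (100 * r₀)) →
        ∀ (G : (Fin k → ℝ) × (Fin l → ℂ) → ℂ) (M : ℝ), 0 < M → ContDiff ℝ ∞ G →
          (∀ q, G q ≠ 0 → (∀ i, q.1 i ∈ Set.Icc (-r₀) r₀) ∧ ∀ j, q.2 j ∈ Metric.ball 0 r₀) →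
          (∀ a ≤ a₀ + 2 * (k + l) + 1, ∀ w, gradNorm (mixedBasis k l) a G w ≤ M) →
          ‖(∫ q, G (q - (x, z)) ∂(mixedCorr P f k l)) -
              ∫ q, G (q - (x, z)) ∂(mixedCorr P' f' k l)‖
            ≤ C' * M * (n : ℝ) ^ (-(c₀ / (200 * ((a₀ : ℝ) + 2) * ((k : ℝ) + l)))) := by

  have hK : ReplacementConstants C r₀ c₀ A a₀ (k + l) :=
    ⟨hC, hr₀, hc₀, hc₀', hkl, by rw [hA]; push_cast; rfl, ha₀⟩
  obtain ⟨D, hD⟩ := exists_norm_integral_mixedCorr_sub_le (k := k) (l := l) hK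
  refine ⟨D, ?_⟩
  intro n hn Ω Ω' _ _ P P' _ _ f f' x z hf hf' _ _ h1 h2 h1' h2' hlog hrep G M hM hG hGs hGg
  have hR : Replaceable C r₀ c₀ A a₀ n P P' f f'
      (Set.range (Fin.append (fun i => (x i : ℂ)) z)) (region x z (100 * r₀)) := by
    refine ⟨hn, hf, hf', ?_, ?_, hlog, hrep, ?_⟩
    all_goals
      rintro _ ⟨q, rfl⟩
      refine Fin.addCases (fun i => ?_) (fun j => ?_) q
      · rw [Fin.append_left]
        first
        | exact h1 i
        | exact h1' i
        | exact (Set.subset_iUnion (fun i => Metric.ball (x i : ℂ) (100 * r₀)) i).trans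
            Set.subset_union_left
      · rw [Fin.append_right]
        first
        | exact h2 j
        | exact h2' j
        | exact (Set.subset_iUnion (fun j => Metric.ball (z j) (100 * r₀)) j).trans
            Set.subset_union_right
  rw [← inv_pow_rpow_one_div_eq hc₀ hkl hA]
  refine hD hR G M hM.le hG (fun q hq => ⟨fun i => abs_le.2 ((hGs q hq).1 i), fun j => ?_⟩)
    fun a ha => hGg a (by omega)
  exact (mem_ball_zero_iff.1 ((hGs q hq).2 j)).le
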